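/- Let $e\ge 2$ be an integer. For a partition $\lambda=(\lambda_1,\lambda_2,\dots)$ let $\beta(\lambda)=\{\lambda_i-i\mid i\ge 1\}\subset\mathbb Z$. For $b\in\mathbb Z$ let $\mathrm{wt}_\lambda(b)$ be the number of integers $x<b$ with $x\equiv b \pmod e$ and $x\notin\beta(\lambda)$, and put $$\mathcal A(\lambda)=\{(b;q)\mid b\in\beta(\lambda),\ q=b-je \text{ for some integer } 0\le j<\mathrm{wt}_\lambda(b)\}.$$ This is a finite set; its cardinality $w$ is the $e$-weight of $\lambda$. Order it by $(b;q)<(b';q')$ iff $q<q'$, or $q=q'$ and $b<b'$, write its elements in ascending order as $(b_1;q_1)<\dots<(b_w;q_w)$, and set $$z(\lambda)=(z_1,\dots,z_w),\qquad z_i=\bigl|\{x\in\mathbb Z\mid q_i-e<x\le q_i,\ x\notin\beta(\lambda)\}\bigr|.$$ The partition $\lambda$ is $0$-increasing if $z_1\le z_2\le\dots\le z_w$, and $e$-regular if there is no $i$ with $\lambda_i=\lambda_{i+1}=\dots=\lambda_{i+e-1}\ne 0$. An integer $x$ is removable for $\lambda$ if $x\in\beta(\lambda)$ and $x-1\notin\beta(\lambda)$.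 A removable $x$ is normal if for every $y>x$ with $y\equiv x \pmod e$, among the integers $t\equiv x\pmod e$ with $x<t\le y$ there are at least as many with $t\in\beta(\lambda)$, $t-1\notin\beta(\lambda)$ as with $t\notin\beta(\lambda)$, $t-1\in\beta(\lambda)$. For $i\in\mathbb Z/e\mathbb Z$ write $\mu\xrightarrow{\,i\,}\lambda$ if $\lambda$ has a normal integer in the class $i$ and $\beta(\mu)=(\beta(\lambda)\setminus\{x\})\cup\{x-1\}$, where $x$ is the smallest one. A partition $\mu$ is a Mullineux–Kleshchev image of $\lambda$ if there are $n\geq 0$, residues $i_1,\dots,i_n\in\mathbb Z/e\mathbb Z$ and paths $$\emptyset\xrightarrow{\,i_1\,}\cdots\xrightarrow{\,i_n\,}\lambda,\qquad \emptyset\xrightarrow{\,-i_1\,}\cdots\xrightarrow{\,-i_n\,}\mu .$$ Proposition. Let $\lambda$ be a $0$-increasing $e$-regular partition of $e$-weight $w$, with $z(\lambda)=(z_1,\dots,z_w)$. Then $\lambda$ has exactly one Mullineux–Kleshchev image $\lambda^*$, and $$z(\lambda^*)=(e-z_w,\ e-z_{w-1},\ \dots,\ e-z_1).$$ -/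

import Mathlib

/-!
Partitions are Mathlib's Young diagrams (English notation); `lam.rowLen i` is the part with
index `i + 1`.  Positions of the abacus are integers, runner `r` consists of the integers
congruent to `r` modulo `e`, and "above" on a runner means smaller.
-/

namespace Abacus

/-- The set of beta-numbers `{lam_1 - 1, lam_2 - 2, ...}` (parts indexed from 1). -/
def beta (lam : YoungDiagram) : Set ℤ :=
  Set.range fun i : ℕ => (lam.rowLen i : ℤ) - (i + 1)

/-- The number of unoccupied positions above `b` on the runner of `b`. -/
noncomputable def wt (e : ℕ) (lam : YoungDiagram) (b : ℤ) : ℕ :=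
  {x : ℤ | x < b ∧ x ≡ b [ZMOD e] ∧ x ∉ beta lam}.ncard

/-- The bead movements `(b; q)`, with `b` a bead and `q = b - j * e` for some
`0 ≤ j < wt b`.  The movement `(b; q)` is stored as `(q, b)` in the lexicographic product, so that
movements are ordered by starting position `q` first, and then by `b`. -/
def beadMovements (e : ℕ) (lam : YoungDiagram) : Set (ℤ ×ₗ ℤ) :=
  {p | ∃ b ∈ beta lam, ∃ j : ℕ, j < wt e lam b ∧ p = toLex (b - (j : ℤ) * e, b)}

theorem beadMovements_finite (e : ℕ) (lam : YoungDiagram) : (beadMovements e lam).Finite := by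
  have key : beadMovements e lam ⊆ ⋃ i ∈ Set.Iio (lam.colLen 0),
      (fun j : ℕ => (toLex ((lam.rowLen i : ℤ) - (i + 1) - (j : ℤ) * e,
        (lam.rowLen i : ℤ) - (i + 1)) : ℤ ×ₗ ℤ)) ''
        Set.Iio (wt e lam ((lam.rowLen i : ℤ) - (i + 1))) := by
    rintro p ⟨b, ⟨i, rfl⟩, j, hj, rfl⟩
    have hrow : ∀ k : ℕ, lam.colLen 0 ≤ k → lam.rowLen k = 0 := by
      intro k hk
      by_contra h
      have h1 : (k, 0) ∈ lam := YoungDiagram.mem_iff_lt_rowLen.2 (Nat.pos_of_ne_zero h)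
      have h2 := YoungDiagram.mem_iff_lt_colLen.1 h1
      omega
    have hi : i < lam.colLen 0 := by
      by_contra hi
      have hi' : lam.colLen 0 ≤ i := not_lt.1 hi
      have h0 : wt e lam ((lam.rowLen i : ℤ) - (i + 1)) = 0 := by
        unfold wt
        convert Set.ncard_empty ℤ
        ext x
        simp only [Set.mem_ofPred_eq, Set.mem_empty_iff_false, iff_false, not_and, not_not]
        intro hx _
        rw [hrow i hi'] at hx
        refine ⟨(-x - 1).toNat, ?_⟩
        have hk : lam.colLen 0 ≤ (-x - 1).toNat := by omega
        simp only [hrow _ hk]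
        omega
      exact absurd hj (by simp [h0])
    exact Set.mem_biUnion (Set.mem_Iio.2 hi) ⟨j, hj, rfl⟩
  exact ((Set.finite_Iio _).biUnion fun i _ => (Set.finite_Iio _).image _).subset key

/-- The number of unoccupied positions in the half-open interval `(q - e, q]`. -/
noncomputable def armLength (e : ℕ) (lam : YoungDiagram) (q : ℤ) : ℕ :=
  (Set.Ioc (q - e) q \ beta lam).ncard

/-- The tuple `z(lam)`: the arm lengths of the starting positions of the bead movements, the
movements being listed in ascending order.  Its length, the number of bead movements, is the
`e`-weight of `lam`. -/
noncomputable def zTuple (e : ℕ) (lam : YoungDiagram) : List ℤ :=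
  ((beadMovements_finite e lam).toFinset.sort (· ≤ ·)).map
    fun p => (armLength e lam (ofLex p).1 : ℤ)

/-- `lam` is `m`-increasing: `z_{i+1} - z_i ≥ m` for all pairs of consecutive entries. -/
def IsIncreasing (e : ℕ) (m : ℤ) (lam : YoungDiagram) : Prop :=
  (zTuple e lam).IsChain fun a b => m ≤ b - a

/-- `lam` is `e`-regular: no `e` consecutive parts are equal and nonzero. -/
def IsRegular (e : ℕ) (lam : YoungDiagram) : Prop :=
  ¬ ∃ i : ℕ, lam.rowLen i ≠ 0 ∧ ∀ j < e, lam.rowLen (i + j) = lam.rowLen i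

/-- The position `x` carries a removable bead (its preceding position is unoccupied). -/
def IsRemovable (lam : YoungDiagram) (x : ℤ) : Prop :=
  x ∈ beta lam ∧ x - 1 ∉ beta lam

/-- The removable bead at `x` is normal: for each `y` below `x` on the runner of `x`, between `x`
(excluded) and `y` (included) there are at least as many removable beads on that runner as addable
beads on the preceding runner. -/
def IsNormal (e : ℕ) (lam : YoungDiagram) (x : ℤ) : Prop :=
  IsRemovable lam x ∧ ∀ y : ℤ, x < y → y ≡ x [ZMOD e] →
    {t : ℤ | x < t ∧ t ≤ y ∧ t ≡ x [ZMOD e] ∧ t ∉ beta lam ∧ t - 1 ∈ beta lam}.ncard ≤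
      {t : ℤ | x < t ∧ t ≤ y ∧ t ≡ x [ZMOD e] ∧ t ∈ beta lam ∧ t - 1 ∉ beta lam}.ncard

/-- The arrow `mu --i--> lam` of the crystal graph, that is `Ẽ_i(lam) = mu`, for a residue `i`
modulo `e` (given by an integer representative): `mu` is obtained from `lam` by moving the top
normal bead on runner `i` to its preceding position.  In terms of diagrams, `mu` is `lam` with its
good node of residue `i` removed. -/
def CrystalArrow (e : ℕ) (i : ℤ) (mu lam : YoungDiagram) : Prop :=
  ∃ x : ℤ, x ≡ i [ZMOD e] ∧ IsNormal e lam x ∧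
    (∀ y : ℤ, y ≡ i [ZMOD e] → IsNormal e lam y → x ≤ y) ∧
    beta mu = insert (x - 1) (beta lam \ {x})

/-- `MullineuxKleshchev e lam mu` says that `mu` is the Mullineux-Kleshchev image of `lam`: there
is a sequence of residues `i_1, ..., i_n` labelling a path of the crystal graph from the empty
partition to `lam`, such that `-i_1, ..., -i_n` labels a path from the empty partition to `mu`. -/
inductive MullineuxKleshchev (e : ℕ) : YoungDiagram → YoungDiagram → Prop
  | empty : MullineuxKleshchev e ⊥ ⊥
  | step {lam lam' mu mu' : YoungDiagram} (i : ℤ) : MullineuxKleshchev e lam mu →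
      CrystalArrow e i lam lam' → CrystalArrow e (-i) mu mu' → MullineuxKleshchev e lam' mu'

end Abacus

/-! Cut the beta-set into `e` runners, each parametrised by levels. For a residue `i`, the runners
`i - 1` and `i` define a walk `W`: removable beads of residue `i` are its up-steps, addable ones its
down-steps. The signature rule then says that an arrow of the crystal moves the bead at the last
minimum of the walk (`crystalArrow_iff`); its inverse acts at the first minimum (`E_iff_firstMin`).
Statements about the crystal thus become statements about minima of integer walks.

Existence and uniqueness of the image. If `e = 2` then `-i` and `i` are the same residue and the
image is the partition itself. If `e ≥ 3`, operators of adjacent residues either commute or satisfy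
the relation `E_i E_j² E_i = E_j E_i² E_j`, and the same holds for their inverses (`E_commute`,
`E_braid`, `coE_commute`, `coE_braid`). By induction on the length of paths, a pair of related abaci
can be followed along every further arrow (`sim`), so the image does not depend on the path
(`MK.unique`). A nonempty regular partition always has a normal bead, and the operators preserve
regularity, which gives existence (`Reg.exists_MK`).

The tuple `z`. A sorted tuple is determined by its multiplicities, so the claim is that the image is
again increasing (`Inc`) and that the number of movements of arm length `v` becomes that of arm
length `e - v` (`Mirror`). The number of movements at a level of a runner is the minimum of the gaps
before and the beads from there on (`mult`). Two mechanisms prove the claim.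

Reflection: applying `E_i` or its inverse as often as the charges of the runners `i - 1` and `i`
differ exchanges these charges. On increasing abaci it keeps monotonicity and all arm length counts,
because `NoAscent`, `dropMult` and the arm lengths off runner `i - 1` are invariant (`E.pairRel`,
`PairRel.wsum_eq`, `PairRel.inc`). All charge vectors are connected by such exchanges
(`Balanced.descent`), so for given counts the claim for one charge vector implies it for all.

Reduction of the weight: let `g + 1` be the least arm length and `n` its multiplicity. Choose
charges so that two adjacent runners differ by `n - 1` and are far from all others, with `g` runners
far before and the rest far after. Then one crystal operator deletes exactly the `n` movements of
arm length `g + 1` (`Env.exists_remove`). On the image side, undoing the corresponding step creates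
`n` movements of arm length `e - (g + 1)` (`Env.inc_of_E`). Induction on the weight ends at weight
zero, where the charges can be taken to be those of the empty partition (`mirror_of_balanced`). -/

namespace Abacus

/-! ### Walks on the integers -/

/-- `l` is the last point at which `S` attains its minimum. -/
def LastMin (S : ℤ → ℤ) (l : ℤ) : Prop := (∀ t, S l ≤ S t) ∧ ∀ t, l < t → S l < S t

/-- `l` is the first point at which `S` attains its minimum. -/
def FirstMin (S : ℤ → ℤ) (l : ℤ) : Prop := (∀ t, S l ≤ S t) ∧ ∀ t, t < l → S l < S t

/-- The indicator of the half-line `(a, ∞)`. -/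
def gtInd (a t : ℤ) : ℤ := if a < t then 1 else 0

theorem gtInd_of_lt {a t : ℤ} (h : a < t) : gtInd a t = 1 := if_pos h

theorem gtInd_of_le {a t : ℤ} (h : t ≤ a) : gtInd a t = 0 := if_neg (not_lt.2 h)

theorem gtInd_cases (a t : ℤ) : (a < t ∧ gtInd a t = 1) ∨ (t ≤ a ∧ gtInd a t = 0) := by
  rcases lt_or_ge a t with h | h
  · exact Or.inl ⟨h, gtInd_of_lt h⟩
  · exact Or.inr ⟨h, gtInd_of_le h⟩

theorem LastMin.unique {S : ℤ → ℤ} {a b : ℤ} (ha : LastMin S a) (hb : LastMin S b) : a = b := by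
  rcases lt_trichotomy a b with h | h | h
  · have h1 := ha.2 b h; have h2 := hb.1 a; omega
  · exact h
  · have h1 := hb.2 a h; have h2 := ha.1 b; omega

theorem FirstMin.unique {S : ℤ → ℤ} {a b : ℤ} (ha : FirstMin S a) (hb : FirstMin S b) : a = b := by
  rcases lt_trichotomy a b with h | h | h
  · have h1 := hb.2 a h; have h2 := ha.1 b; omega
  · exact h
  · have h1 := ha.2 b h; have h2 := hb.1 a; omega

theorem int_fun_ext {f g : ℤ → ℤ} (N : ℤ) (h0 : f N = g N)
    (hs : ∀ t, f (t + 1) - f t = g (t + 1) - g t) (t : ℤ) : f t = g t := by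
  induction t using Int.inductionOn' (b := N) with
  | zero => exact h0
  | succ k _ ih => have := hs k; omega
  | pred k _ ih =>
    have := hs (k - 1)
    rw [sub_add_cancel] at this
    omega

/-- The greatest element satisfying `P` among the integers below a bound. -/
theorem exists_last {P : ℤ → Prop} (b : ℤ) (hb : ∀ z, P z → z ≤ b) (h : ∃ z, P z) :
    ∃ z, P z ∧ ∀ y, P y → y ≤ z := by
  obtain ⟨z, h1, h2⟩ := Int.exists_greatest_of_bdd ⟨b, hb⟩ h
  exact ⟨z, h1, h2⟩

theorem exists_first {P : ℤ → Prop} (b : ℤ) (hb : ∀ z, P z → b ≤ z) (h : ∃ z, P z) :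
    ∃ z, P z ∧ ∀ y, P y → z ≤ y := by
  obtain ⟨z, h1, h2⟩ := Int.exists_least_of_bdd ⟨b, hb⟩ h
  exact ⟨z, h1, h2⟩

/-! ### Maya diagrams -/

open Classical in
/-- The indicator function of a set of integers. -/
noncomputable def ind (A : Set ℤ) (t : ℤ) : ℤ := if t ∈ A then 1 else 0

theorem ind_mem {A : Set ℤ} {t : ℤ} (h : t ∈ A) : ind A t = 1 := if_pos h

theorem ind_notMem {A : Set ℤ} {t : ℤ} (h : t ∉ A) : ind A t = 0 := if_neg h

theorem ind_eq_one {A : Set ℤ} {t : ℤ} : ind A t = 1 ↔ t ∈ A := by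
  by_cases h : t ∈ A <;> simp [ind, h]

theorem ind_eq_zero {A : Set ℤ} {t : ℤ} : ind A t = 0 ↔ t ∉ A := by
  by_cases h : t ∈ A <;> simp [ind, h]

theorem ind_cases (A : Set ℤ) (t : ℤ) : (t ∈ A ∧ ind A t = 1) ∨ (t ∉ A ∧ ind A t = 0) := by
  by_cases h : t ∈ A
  · exact Or.inl ⟨h, ind_mem h⟩
  · exact Or.inr ⟨h, ind_notMem h⟩

theorem ind_ext {A B : Set ℤ} (h : ∀ t, ind A t = ind B t) : A = B := by
  ext t
  rw [← ind_eq_one, ← ind_eq_one, h]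

/-- A Maya diagram: a set containing all small integers and no large ones. -/
def IsMaya (A : Set ℤ) : Prop := (∃ N, ∀ x < N, x ∈ A) ∧ ∃ N, ∀ x ≥ N, x ∉ A

/-- The number of gaps before `t`. -/
noncomputable def gp (A : Set ℤ) (t : ℤ) : ℤ := ({u : ℤ | u < t ∧ u ∉ A}.ncard : ℤ)

/-- The number of beads at or after `t`. -/
noncomputable def bd (A : Set ℤ) (t : ℤ) : ℤ := ({u : ℤ | t ≤ u ∧ u ∈ A}.ncard : ℤ)

/-- The charge of a Maya diagram. -/
noncomputable def ch (A : Set ℤ) : ℤ := bd A 0 - gp A 0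

theorem gp_nonneg (A : Set ℤ) (t : ℤ) : 0 ≤ gp A t := Int.natCast_nonneg _

theorem bd_nonneg (A : Set ℤ) (t : ℤ) : 0 ≤ bd A t := Int.natCast_nonneg _

theorem IsMaya.finite_gaps {A : Set ℤ} (hA : IsMaya A) (t : ℤ) : {u : ℤ | u < t ∧ u ∉ A}.Finite := by
  obtain ⟨N, hN⟩ := hA.1
  refine (Set.finite_Ico N t).subset ?_
  rintro u ⟨h1, h2⟩
  refine ⟨?_, h1⟩
  by_contra h
  exact h2 (hN u (not_le.1 h))

theorem IsMaya.finite_beads {A : Set ℤ} (hA : IsMaya A) (t : ℤ) :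
    {u : ℤ | t ≤ u ∧ u ∈ A}.Finite := by
  obtain ⟨N, hN⟩ := hA.2
  refine (Set.finite_Ico t N).subset ?_
  rintro u ⟨h1, h2⟩
  refine ⟨h1, ?_⟩
  by_contra h
  exact hN u (not_lt.1 h) h2

theorem gp_succ {A : Set ℤ} (hA : IsMaya A) (t : ℤ) : gp A (t + 1) = gp A t + 1 - ind A t := by
  unfold gp
  rcases ind_cases A t with ⟨h, h'⟩ | ⟨h, h'⟩
  · have : {u : ℤ | u < t + 1 ∧ u ∉ A} = {u : ℤ | u < t ∧ u ∉ A} := by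
      ext u
      simp only [Set.mem_ofPred_eq]
      constructor
      · rintro ⟨h1, h2⟩
        refine ⟨?_, h2⟩
        rcases eq_or_ne u t with rfl | h3
        · exact absurd h h2
        · omega
      · rintro ⟨h1, h2⟩
        exact ⟨by omega, h2⟩
    rw [this, h']; ring
  · have : {u : ℤ | u < t + 1 ∧ u ∉ A} = insert t {u : ℤ | u < t ∧ u ∉ A} := by
      ext u
      simp only [Set.mem_ofPred_eq, Set.mem_insert_iff]
      constructor
      · rintro ⟨h1, h2⟩
        rcases eq_or_ne u t with rfl | h3
        · exact Or.inl rfl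
        · exact Or.inr ⟨by omega, h2⟩
      · rintro (rfl | ⟨h1, h2⟩)
        · exact ⟨by omega, h⟩
        · exact ⟨by omega, h2⟩
    rw [this, Set.ncard_insert_of_notMem (by simp) (hA.finite_gaps t), h']
    push_cast; ring

theorem bd_succ {A : Set ℤ} (hA : IsMaya A) (t : ℤ) : bd A (t + 1) = bd A t - ind A t := by
  unfold bd
  rcases ind_cases A t with ⟨h, h'⟩ | ⟨h, h'⟩
  · have : {u : ℤ | t ≤ u ∧ u ∈ A} = insert t {u : ℤ | t + 1 ≤ u ∧ u ∈ A} := by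
      ext u
      simp only [Set.mem_ofPred_eq, Set.mem_insert_iff]
      constructor
      · rintro ⟨h1, h2⟩
        rcases eq_or_ne u t with rfl | h3
        · exact Or.inl rfl
        · exact Or.inr ⟨by omega, h2⟩
      · rintro (rfl | ⟨h1, h2⟩)
        · exact ⟨le_rfl, h⟩
        · exact ⟨by omega, h2⟩
    rw [this, Set.ncard_insert_of_notMem (by simp) (hA.finite_beads (t + 1)), h']
    push_cast; ring
  · have : {u : ℤ | t + 1 ≤ u ∧ u ∈ A} = {u : ℤ | t ≤ u ∧ u ∈ A} := by
      ext u
      simp only [Set.mem_ofPred_eq]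
      constructor
      · rintro ⟨h1, h2⟩
        exact ⟨by omega, h2⟩
      · rintro ⟨h1, h2⟩
        refine ⟨?_, h2⟩
        rcases eq_or_ne u t with rfl | h3
        · exact absurd h2 h
        · omega
    rw [this, h']; ring

theorem bd_sub_gp {A : Set ℤ} (hA : IsMaya A) (t : ℤ) : bd A t - gp A t = ch A - t := by
  refine int_fun_ext (f := fun t => bd A t - gp A t) (g := fun t => ch A - t) 0 (by simp [ch]) ?_ t
  intro t
  have h1 := gp_succ hA t
  have h2 := bd_succ hA t
  omega

theorem gp_pos_iff {A : Set ℤ} (hA : IsMaya A) (t : ℤ) : 0 < gp A t ↔ ∃ u < t, u ∉ A := by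
  unfold gp
  rw [Int.natCast_pos, Set.ncard_pos (hA.finite_gaps t)]
  rfl

theorem bd_pos_iff {A : Set ℤ} (hA : IsMaya A) (t : ℤ) : 0 < bd A t ↔ ∃ u, t ≤ u ∧ u ∈ A := by
  unfold bd
  rw [Int.natCast_pos, Set.ncard_pos (hA.finite_beads t)]
  rfl

theorem gp_eq_zero {A : Set ℤ} {t : ℤ} (h : ∀ u < t, u ∈ A) : gp A t = 0 := by
  unfold gp
  have : {u : ℤ | u < t ∧ u ∉ A} = ∅ := by
    ext u
    simp only [Set.mem_ofPred_eq, Set.mem_empty_iff_false, iff_false, not_and, not_not]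
    exact h u
  rw [this]; simp

theorem bd_eq_zero {A : Set ℤ} {t : ℤ} (h : ∀ u, t ≤ u → u ∉ A) : bd A t = 0 := by
  unfold bd
  have : {u : ℤ | t ≤ u ∧ u ∈ A} = ∅ := by
    ext u
    simp only [Set.mem_ofPred_eq, Set.mem_empty_iff_false, iff_false, not_and]
    exact h u
  rw [this]; simp

theorem gp_mono {A : Set ℤ} (hA : IsMaya A) {s t : ℤ} (h : s ≤ t) : gp A s ≤ gp A t := by
  unfold gp
  exact_mod_cast Set.ncard_le_ncard (s := {u : ℤ | u < s ∧ u ∉ A}) (t := {u : ℤ | u < t ∧ u ∉ A})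
    (fun u hu => ⟨lt_of_lt_of_le hu.1 h, hu.2⟩) (hA.finite_gaps t)

theorem bd_anti {A : Set ℤ} (hA : IsMaya A) {s t : ℤ} (h : s ≤ t) : bd A t ≤ bd A s := by
  unfold bd
  exact_mod_cast Set.ncard_le_ncard (s := {u : ℤ | t ≤ u ∧ u ∈ A}) (t := {u : ℤ | s ≤ u ∧ u ∈ A})
    (fun u hu => ⟨h.trans hu.1, hu.2⟩) (hA.finite_beads s)

/-- The effect on the counting functions of changing the set at one point. -/
theorem counts_of_ind_add {A A' : Set ℤ} (hA : IsMaya A) (hA' : IsMaya A') {x c : ℤ}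
    (h : ∀ t, ind A' t = ind A t + if t = x then c else 0) :
    (∀ t, gp A' t = gp A t - c * gtInd x t) ∧ (∀ t, bd A' t = bd A t + c * (1 - gtInd x t)) ∧
      ch A' = ch A + c := by
  have h1 : ∀ t, gp A' t = gp A t - c * gtInd x t := by
    obtain ⟨N, hN⟩ := hA.1
    obtain ⟨N', hN'⟩ := hA'.1
    refine fun t => int_fun_ext (g := fun t => gp A t - c * gtInd x t) (min (min N N') x) ?_ ?_ t
    · rw [gp_eq_zero fun u hu => hN' u (by omega), gp_eq_zero fun u hu => hN u (by omega),
        gtInd_of_le (by omega)]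
      simp
    · intro t
      have e1 := gp_succ hA t
      have e2 := gp_succ hA' t
      have e3 := h t
      rcases lt_trichotomy t x with h0 | h0 | h0
      · rw [if_neg (by omega)] at e3
        rw [gtInd_of_le (by omega), gtInd_of_le (by omega)]; omega
      · rw [if_pos h0] at e3
        rw [gtInd_of_lt (by omega), gtInd_of_le (by omega)]; omega
      · rw [if_neg (by omega)] at e3
        rw [gtInd_of_lt (by omega), gtInd_of_lt (by omega)]; omega
  have h2 : ∀ t, bd A' t = bd A t + c * (1 - gtInd x t) := by
    obtain ⟨N, hN⟩ := hA.2
    obtain ⟨N', hN'⟩ := hA'.2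
    refine fun t => int_fun_ext (g := fun t => bd A t + c * (1 - gtInd x t))
      (max (max N N') (x + 1)) ?_ ?_ t
    · rw [bd_eq_zero fun u hu => hN' u (by omega), bd_eq_zero fun u hu => hN u (by omega),
        gtInd_of_lt (by omega)]
      simp
    · intro t
      have e1 := bd_succ hA t
      have e2 := bd_succ hA' t
      have e3 := h t
      rcases lt_trichotomy t x with h0 | h0 | h0
      · rw [if_neg (by omega)] at e3
        rw [gtInd_of_le (by omega), gtInd_of_le (by omega)]; omega
      · rw [if_pos h0] at e3
        rw [gtInd_of_lt (by omega), gtInd_of_le (by omega)]; linarith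
      · rw [if_neg (by omega)] at e3
        rw [gtInd_of_lt (by omega), gtInd_of_lt (by omega)]; omega
  refine ⟨h1, h2, ?_⟩
  have e1 := h1 0
  have e2 := h2 0
  unfold ch
  rcases gtInd_cases x 0 with ⟨_, h0⟩ | ⟨_, h0⟩ <;> rw [h0] at e1 e2 <;> ring_nf at e1 e2 <;> omega

theorem ch_eq_of_gp {A : Set ℤ} (hA : IsMaya A) {N t : ℤ} (hN : ∀ x ≥ N, x ∉ A) (ht : N ≤ t) :
    gp A t = t - ch A := by
  have := bd_sub_gp hA t
  rw [bd_eq_zero fun u hu => hN u (by omega)] at this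
  omega

/-! ### The walk of a pair of runners -/

/-- The walk of a pair of runners; its steps are `ind B t - ind A t`. -/
noncomputable def walk (A B : Set ℤ) (t : ℤ) : ℤ := gp A t - gp B t

theorem walk_succ {A B : Set ℤ} (hA : IsMaya A) (hB : IsMaya B) (t : ℤ) :
    walk A B (t + 1) = walk A B t + ind B t - ind A t := by
  unfold walk
  rw [gp_succ hA, gp_succ hB]; ring

theorem walk_step_le {A B : Set ℤ} (hA : IsMaya A) (hB : IsMaya B) (t : ℤ) :
    walk A B (t + 1) ≤ walk A B t + 1 := by
  rw [walk_succ hA hB]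
  rcases ind_cases A t with ⟨_, h⟩ | ⟨_, h⟩ <;> rcases ind_cases B t with ⟨_, h'⟩ | ⟨_, h'⟩ <;> omega

theorem walk_le_step {A B : Set ℤ} (hA : IsMaya A) (hB : IsMaya B) (t : ℤ) :
    walk A B t ≤ walk A B (t + 1) + 1 := by
  rw [walk_succ hA hB]
  rcases ind_cases A t with ⟨_, h⟩ | ⟨_, h⟩ <;> rcases ind_cases B t with ⟨_, h'⟩ | ⟨_, h'⟩ <;> omega

theorem walk_left {A B : Set ℤ} (hA : IsMaya A) (hB : IsMaya B) :
    ∃ N, ∀ t ≤ N, walk A B t = 0 := by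
  obtain ⟨N, hN⟩ := hA.1
  obtain ⟨N', hN'⟩ := hB.1
  refine ⟨min N N', fun t ht => ?_⟩
  unfold walk
  rw [gp_eq_zero fun u hu => hN u (by omega), gp_eq_zero fun u hu => hN' u (by omega)]; simp

/-- Past all beads, the number of gaps before `t` is `t` minus the charge. The end value of the walk
decides whether a last minimum exists, hence whether the operator applies. -/
theorem walk_right {A B : Set ℤ} (hA : IsMaya A) (hB : IsMaya B) :
    ∃ N, ∀ t ≥ N, walk A B t = ch B - ch A := by
  obtain ⟨N, hN⟩ := hA.2
  obtain ⟨N', hN'⟩ := hB.2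
  refine ⟨max N N', fun t ht => ?_⟩
  unfold walk
  rw [ch_eq_of_gp hA hN (by omega), ch_eq_of_gp hB hN' (by omega)]; ring

theorem walk_exists_min {A B : Set ℤ} (hA : IsMaya A) (hB : IsMaya B) :
    ∃ t, ∀ u, walk A B t ≤ walk A B u := by
  obtain ⟨N, hN⟩ := walk_left hA hB
  obtain ⟨N', hN'⟩ := walk_right hA hB
  obtain ⟨t, ht, hmin⟩ := Set.exists_min_image (Set.Icc (min N N') (max N N')) (walk A B)
    (Set.finite_Icc _ _) ⟨N, by simp⟩
  refine ⟨t, fun u => ?_⟩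
  rcases le_or_gt u N with h | h
  · rw [hN u h, ← hN N le_rfl]
    exact hmin N (by simp)
  · rcases le_or_gt N' u with h' | h'
    · rw [hN' u h', ← hN' N' le_rfl]
      exact hmin N' (by simp)
    · exact hmin u ⟨by omega, by omega⟩

/-- The minimum of the walk of a pair of runners. -/
noncomputable def walkMin (A B : Set ℤ) : ℤ := sInf (Set.range (walk A B))

theorem walkMin_eq {A B : Set ℤ} {t : ℤ} (h : ∀ u, walk A B t ≤ walk A B u) :
    walkMin A B = walk A B t := by
  have : IsLeast (Set.range (walk A B)) (walk A B t) := ⟨⟨t, rfl⟩, by rintro _ ⟨u, rfl⟩; exact h u⟩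
  exact this.csInf_eq

theorem walkMin_le {A B : Set ℤ} (hA : IsMaya A) (hB : IsMaya B) (t : ℤ) :
    walkMin A B ≤ walk A B t := by
  obtain ⟨u, hu⟩ := walk_exists_min hA hB
  rw [walkMin_eq hu]; exact hu t

theorem exists_walk_eq_min {A B : Set ℤ} (hA : IsMaya A) (hB : IsMaya B) :
    ∃ t, walk A B t = walkMin A B := by
  obtain ⟨u, hu⟩ := walk_exists_min hA hB
  exact ⟨u, (walkMin_eq hu).symm⟩

theorem walkMin_nonpos {A B : Set ℤ} (hA : IsMaya A) (hB : IsMaya B) : walkMin A B ≤ 0 := by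
  obtain ⟨N, hN⟩ := walk_left hA hB
  rw [← hN N le_rfl]; exact walkMin_le hA hB N

theorem walkMin_le_charge {A B : Set ℤ} (hA : IsMaya A) (hB : IsMaya B) :
    walkMin A B ≤ ch B - ch A := by
  obtain ⟨N, hN⟩ := walk_right hA hB
  rw [← hN N le_rfl]; exact walkMin_le hA hB N

theorem exists_lastMin {A B : Set ℤ} (hA : IsMaya A) (hB : IsMaya B)
    (h : walkMin A B < ch B - ch A) : ∃ x, LastMin (walk A B) x := by
  obtain ⟨N, hN⟩ := walk_right hA hB
  obtain ⟨x, hx, hlast⟩ := exists_last (P := fun t => walk A B t = walkMin A B) N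
    (fun z hz => by
      by_contra hc
      have := hN z (by omega)
      omega) (exists_walk_eq_min hA hB)
  refine ⟨x, fun t => hx ▸ walkMin_le hA hB t, fun t ht => ?_⟩
  have h1 := walkMin_le hA hB t
  have h2 := hlast t
  omega

theorem exists_firstMin {A B : Set ℤ} (hA : IsMaya A) (hB : IsMaya B)
    (h : walkMin A B < 0) : ∃ x, FirstMin (walk A B) x := by
  obtain ⟨N, hN⟩ := walk_left hA hB
  obtain ⟨x, hx, hlast⟩ := exists_first (P := fun t => walk A B t = walkMin A B) N
    (fun z hz => by
      by_contra hc
      have := hN z (by omega)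
      omega) (exists_walk_eq_min hA hB)
  refine ⟨x, fun t => hx ▸ walkMin_le hA hB t, fun t ht => ?_⟩
  have h1 := walkMin_le hA hB t
  have h2 := hlast t
  omega

theorem LastMin.walkMin_lt {A B : Set ℤ} (hA : IsMaya A) (hB : IsMaya B) {x : ℤ}
    (h : LastMin (walk A B) x) : walkMin A B < ch B - ch A := by
  obtain ⟨N, hN⟩ := walk_right hA hB
  rw [walkMin_eq h.1, ← hN (max N (x + 1)) (le_max_left _ _)]
  exact h.2 _ (by omega)

/-- The walk has to rise immediately after its last minimum, and the only rising step is a bead of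
`B` facing a gap of `A`. -/
theorem LastMin.mem {A B : Set ℤ} (hA : IsMaya A) (hB : IsMaya B) {x : ℤ}
    (h : LastMin (walk A B) x) : x ∈ B ∧ x ∉ A := by
  have h1 := h.2 (x + 1) (by omega)
  rw [walk_succ hA hB] at h1
  rcases ind_cases A x with ⟨_, h2⟩ | ⟨h2', h2⟩ <;> rcases ind_cases B x with ⟨h3', h3⟩ | ⟨_, h3⟩ <;>
    first | omega | exact ⟨h3', h2'⟩

theorem FirstMin.mem {A B : Set ℤ} (hA : IsMaya A) (hB : IsMaya B) {x : ℤ}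
    (h : FirstMin (walk A B) (x + 1)) : x ∈ A ∧ x ∉ B := by
  have h1 := h.2 x (by omega)
  rw [walk_succ hA hB] at h1
  rcases ind_cases A x with ⟨h2', h2⟩ | ⟨_, h2⟩ <;> rcases ind_cases B x with ⟨_, h3⟩ | ⟨h3', h3⟩ <;>
    first | omega | exact ⟨h2', h3'⟩

/-- Every value beyond `x` is at least `S x + 1`, and the first one equals it; lowering all of them
by 2 creates a new minimum, one smaller, first attained at `x + 1`. Together with `FirstMin.lastMin`
this makes the crystal operator invertible. -/
theorem LastMin.firstMin {S S' : ℤ → ℤ} {x : ℤ} (h : LastMin S x) (hs : S (x + 1) ≤ S x + 1)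
    (hS : ∀ t, S' t = S t - 2 * gtInd x t) : FirstMin S' (x + 1) := by
  have h0 := h.2 (x + 1) (by omega)
  have e := hS (x + 1)
  rw [gtInd_of_lt (by omega)] at e
  refine ⟨fun t => ?_, fun t ht => ?_⟩
  · have e' := hS t
    rcases gtInd_cases x t with ⟨h1, h2⟩ | ⟨h1, h2⟩ <;> rw [h2] at e'
    · have := h.2 t h1; omega
    · have := h.1 t; omega
  · have e' := hS t
    rw [gtInd_of_le (by omega)] at e'
    have := h.1 t; omega

theorem FirstMin.lastMin {S S' : ℤ → ℤ} {x : ℤ} (h : FirstMin S' (x + 1))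
    (hs : S' x ≤ S' (x + 1) + 1) (hS : ∀ t, S' t = S t - 2 * gtInd x t) : LastMin S x := by
  have h0 := h.2 x (by omega)
  have e := hS x
  rw [gtInd_of_le (by omega)] at e
  refine ⟨fun t => ?_, fun t ht => ?_⟩
  · have e' := hS t
    rcases gtInd_cases x t with ⟨h1, h2⟩ | ⟨h1, h2⟩ <;> rw [h2] at e'
    · have := h.1 t; omega
    · have := h.2 t (by omega); omega
  · have e' := hS t
    rw [gtInd_of_lt (by omega)] at e'
    have := h.1 t; omega

/-! ### Runners and crystal operators -/

/-- The runner of `r`, parametrised by levels. -/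
def rn (e : ℕ) (X : Set ℤ) (r : ℤ) : Set ℤ := {t | r + e * t ∈ X}

theorem mem_rn {e : ℕ} {X : Set ℤ} {r t : ℤ} : t ∈ rn e X r ↔ r + e * t ∈ X := Iff.rfl

theorem ind_rn (e : ℕ) (X : Set ℤ) (r t : ℤ) : ind (rn e X r) t = ind X (r + e * t) := rfl

theorem IsMaya.rn {X : Set ℤ} (hX : IsMaya X) {e : ℕ} (he : 0 < e) (r : ℤ) : IsMaya (rn e X r) := by
  obtain ⟨⟨N, hN⟩, ⟨M, hM⟩⟩ := hX
  have he' : (1 : ℤ) ≤ e := by exact_mod_cast he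
  refine ⟨⟨-|N - r|, fun t ht => hN _ ?_⟩, ⟨|M - r|, fun t ht => hM _ ?_⟩⟩
  · have h1 := neg_abs_le (N - r)
    have h2 : (e : ℤ) * t ≤ t := by nlinarith [abs_nonneg (N - r)]
    linarith
  · have h1 := le_abs_self (M - r)
    have h2 : t ≤ (e : ℤ) * t := by nlinarith [abs_nonneg (M - r)]
    linarith

theorem gp_shift (e : ℕ) (X : Set ℤ) (r k t : ℤ) :
    gp (rn e X (r + e * k)) t = gp (rn e X r) (t + k) := by
  unfold gp
  congr 1
  have : {u : ℤ | u < t + k ∧ u ∉ rn e X r} =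
      (fun u => u + k) '' {u : ℤ | u < t ∧ u ∉ rn e X (r + e * k)} := by
    ext u
    simp only [Set.mem_ofPred_eq, Set.mem_image, mem_rn]
    constructor
    · rintro ⟨h1, h2⟩
      refine ⟨u - k, ⟨by omega, ?_⟩, by ring⟩
      rwa [show r + e * k + e * (u - k) = r + e * u by ring]
    · rintro ⟨v, ⟨h1, h2⟩, rfl⟩
      refine ⟨by omega, ?_⟩
      rwa [show r + e * (v + k) = r + e * k + e * v by ring]
  rw [this, Set.ncard_image_of_injective _ (add_left_injective k)]

theorem bd_shift (e : ℕ) (X : Set ℤ) (r k t : ℤ) :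
    bd (rn e X (r + e * k)) t = bd (rn e X r) (t + k) := by
  unfold bd
  congr 1
  have : {u : ℤ | t + k ≤ u ∧ u ∈ rn e X r} =
      (fun u => u + k) '' {u : ℤ | t ≤ u ∧ u ∈ rn e X (r + e * k)} := by
    ext u
    simp only [Set.mem_ofPred_eq, Set.mem_image, mem_rn]
    constructor
    · rintro ⟨h1, h2⟩
      refine ⟨u - k, ⟨by omega, ?_⟩, by ring⟩
      rwa [show r + e * k + e * (u - k) = r + e * u by ring]
    · rintro ⟨v, ⟨h1, h2⟩, rfl⟩
      refine ⟨by omega, ?_⟩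
      rwa [show r + e * (v + k) = r + e * k + e * v by ring]
  rw [this, Set.ncard_image_of_injective _ (add_left_injective k)]

theorem ch_shift {X : Set ℤ} (hX : IsMaya X) {e : ℕ} (he : 0 < e) (r k : ℤ) :
    ch (rn e X (r + e * k)) = ch (rn e X r) - k := by
  have h1 := bd_sub_gp (hX.rn he r) k
  unfold ch at h1 ⊢
  rw [gp_shift, bd_shift, zero_add]
  exact h1

/-- The walk attached to the residue `i`. -/
noncomputable def W (e : ℕ) (X : Set ℤ) (i : ℤ) : ℤ → ℤ := walk (rn e X (i - 1)) (rn e X i)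

/-- The minimum of the walk attached to the residue `i`. -/
noncomputable def mW (e : ℕ) (X : Set ℤ) (i : ℤ) : ℤ := walkMin (rn e X (i - 1)) (rn e X i)

theorem W_shift (e : ℕ) (X : Set ℤ) (i k t : ℤ) : W e X (i + e * k) t = W e X i (t + k) := by
  unfold W walk
  rw [show i + e * k - 1 = i - 1 + e * k by ring, gp_shift, gp_shift]

/-- `Y` arises from `X` by moving the bead `i + e * x` one position back. -/
def Moved (e : ℕ) (i x : ℤ) (X Y : Set ℤ) : Prop :=
  ∀ z, ind Y z = ind X z + (if z = i - 1 + e * x then 1 else 0) - if z = i + e * x then 1 else 0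

/-- The crystal operator: `Y` arises from `X` by moving the first normal bead of residue `i`. -/
def E (e : ℕ) (i : ℤ) (X Y : Set ℤ) : Prop := ∃ x, LastMin (W e X i) x ∧ Moved e i x X Y

/-- Replacing a residue by another representative only renumbers the levels, so extrema and moved
bead correspond. -/
theorem E_shift (e : ℕ) (X Y : Set ℤ) (i k : ℤ) : E e (i + e * k) X Y ↔ E e i X Y := by
  unfold E
  have key : ∀ x, LastMin (W e X (i + e * k)) x ↔ LastMin (W e X i) (x + k) := by
    intro x
    simp only [LastMin, W_shift]
    constructor
    · rintro ⟨h1, h2⟩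
      refine ⟨fun t => ?_, fun t ht => ?_⟩
      · have := h1 (t - k); rwa [sub_add_cancel] at this
      · have := h2 (t - k) (by omega); rwa [sub_add_cancel] at this
    · rintro ⟨h1, h2⟩
      exact ⟨fun t => h1 _, fun t ht => h2 _ (by omega)⟩
  have key2 : ∀ x, Moved e (i + e * k) x X Y ↔ Moved e i (x + k) X Y := by
    intro x
    unfold Moved
    rw [show i + e * k - 1 + e * x = i - 1 + e * (x + k) by ring,
      show i + e * k + e * x = i + e * (x + k) by ring]
  constructor
  · rintro ⟨x, h1, h2⟩
    exact ⟨x + k, (key x).1 h1, (key2 x).1 h2⟩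
  · rintro ⟨x, h1, h2⟩
    refine ⟨x - k, (key _).2 ?_, (key2 _).2 ?_⟩ <;> rwa [sub_add_cancel]

theorem Moved.isMaya {e : ℕ} {i x : ℤ} {X Y : Set ℤ} (h : Moved e i x X Y) : IsMaya X ↔ IsMaya Y := by
  have key : ∀ z, z < i - 1 + e * x ∨ i + e * x < z → (z ∈ Y ↔ z ∈ X) := by
    intro z hz
    have := h z
    rw [if_neg (by omega), if_neg (by omega)] at this
    rw [← ind_eq_one, ← ind_eq_one]; omega
  constructor
  · rintro ⟨⟨N, hN⟩, ⟨M, hM⟩⟩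
    refine ⟨⟨min N (i - 1 + e * x), fun z hz => ?_⟩, ⟨max M (i + e * x + 1), fun z hz => ?_⟩⟩
    · rw [key z (by omega)]; exact hN z (by omega)
    · rw [key z (by omega)]; exact hM z (by omega)
  · rintro ⟨⟨N, hN⟩, ⟨M, hM⟩⟩
    refine ⟨⟨min N (i - 1 + e * x), fun z hz => ?_⟩, ⟨max M (i + e * x + 1), fun z hz => ?_⟩⟩
    · rw [← key z (by omega)]; exact hN z (by omega)
    · rw [← key z (by omega)]; exact hM z (by omega)

theorem E.isMaya {e : ℕ} {i : ℤ} {X Y : Set ℤ} (h : E e i X Y) : IsMaya X ↔ IsMaya Y := by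
  obtain ⟨x, -, h⟩ := h; exact h.isMaya

theorem exists_moved {e : ℕ} {i x : ℤ} {X : Set ℤ} (h1 : i + e * x ∈ X) (h2 : i - 1 + e * x ∉ X) :
    ∃ Y, Moved e i x X Y := by
  refine ⟨insert (i - 1 + e * x) (X \ {i + e * x}), fun z => ?_⟩
  by_cases h3 : z = i - 1 + e * x
  · rw [if_pos h3, if_neg (by omega), ind_mem (by simp [h3]), ind_notMem (h3 ▸ h2)]; rfl
  · by_cases h4 : z = i + e * x
    · rw [if_neg h3, if_pos h4, ind_notMem (by simp [h4]; omega), ind_mem (h4 ▸ h1)]; rfl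
    · rw [if_neg h3, if_neg h4]
      rcases ind_cases X z with ⟨h5, h6⟩ | ⟨h5, h6⟩
      · rw [h6, ind_mem (by simp [h3, h4, h5])]; rfl
      · rw [h6, ind_notMem (by simp [h3, h4, h5])]; rfl

theorem exists_moved_back {e : ℕ} {i x : ℤ} {Y : Set ℤ} (h1 : i - 1 + e * x ∈ Y)
    (h2 : i + e * x ∉ Y) : ∃ X, Moved e i x X Y := by
  refine ⟨insert (i + e * x) (Y \ {i - 1 + e * x}), fun z => ?_⟩
  by_cases h3 : z = i + e * x
  · rw [if_neg (by omega), if_pos h3, ind_mem (A := insert _ _) (by simp [h3]),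
      ind_notMem (h3 ▸ h2)]; rfl
  · by_cases h4 : z = i - 1 + e * x
    · rw [if_neg h3, if_pos h4, ind_notMem (A := insert _ _) (by simp [h4]),
        ind_mem (h4 ▸ h1)]; rfl
    · rw [if_neg h3, if_neg h4]
      rcases ind_cases Y z with ⟨h5, h6⟩ | ⟨h5, h6⟩
      · rw [h6, ind_mem (A := insert _ _) (by simp [h3, h4, h5])]; rfl
      · rw [h6, ind_notMem (A := insert _ _) (by simp [h3, h4, h5])]; rfl

theorem ind_rn_lower {e : ℕ} (he : 2 ≤ e) {i x : ℤ} {X Y : Set ℤ} (h : Moved e i x X Y) (t : ℤ) :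
    ind (rn e Y (i - 1)) t = ind (rn e X (i - 1)) t + if t = x then 1 else 0 := by
  have he' : (2 : ℤ) ≤ e := by exact_mod_cast he
  rw [ind_rn, ind_rn, h]
  have h1 : i - 1 + e * t ≠ i + e * x := by
    intro h0
    have h1 : (e : ℤ) ∣ 1 := ⟨t - x, by linarith⟩
    have := Int.le_of_dvd one_pos h1
    omega
  rw [if_neg h1]
  have h2 : (i - 1 + e * t = i - 1 + e * x) ↔ t = x := by
    constructor
    · intro h0; exact mul_left_cancel₀ (by omega : (e : ℤ) ≠ 0) (by linarith)
    · rintro rfl; rfl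
  simp only [h2, sub_zero]

theorem ind_rn_upper {e : ℕ} (he : 2 ≤ e) {i x : ℤ} {X Y : Set ℤ} (h : Moved e i x X Y) (t : ℤ) :
    ind (rn e Y i) t = ind (rn e X i) t + if t = x then -1 else 0 := by
  have he' : (2 : ℤ) ≤ e := by exact_mod_cast he
  rw [ind_rn, ind_rn, h]
  have h1 : i + e * t ≠ i - 1 + e * x := by
    intro h0
    have h1 : (e : ℤ) ∣ 1 := ⟨x - t, by linarith⟩
    have := Int.le_of_dvd one_pos h1
    omega
  rw [if_neg h1]
  have h2 : (i + e * t = i + e * x) ↔ t = x := by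
    constructor
    · intro h0; exact mul_left_cancel₀ (by omega : (e : ℤ) ≠ 0) (by linarith)
    · rintro rfl; rfl
  simp only [h2]
  split_ifs <;> ring

theorem rn_other {e : ℕ} {i x r : ℤ} {X Y : Set ℤ} (h : Moved e i x X Y)
    (h1 : ¬ (e : ℤ) ∣ r - i) (h2 : ¬ (e : ℤ) ∣ r - (i - 1)) : rn e Y r = rn e X r := by
  refine ind_ext fun t => ?_
  rw [ind_rn, ind_rn, h, if_neg, if_neg]
  · ring
  · exact fun h0 => h1 ⟨x - t, by linarith⟩
  · exact fun h0 => h2 ⟨x - t, by linarith⟩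

/-! ### Effect of moving one bead on charges and walks; existence and injectivity of the crystal
operators. -/

section effects

variable {e : ℕ} {i x : ℤ} {X Y : Set ℤ}

theorem lower_counts (he : 2 ≤ e) (hX : IsMaya X) (h : Moved e i x X Y) :
    (∀ t, gp (rn e Y (i - 1)) t = gp (rn e X (i - 1)) t - gtInd x t) ∧
    (∀ t, bd (rn e Y (i - 1)) t = bd (rn e X (i - 1)) t + (1 - gtInd x t)) ∧
      ch (rn e Y (i - 1)) = ch (rn e X (i - 1)) + 1 := by
  have := counts_of_ind_add (hX.rn (by omega) _) ((h.isMaya.1 hX).rn (by omega) _)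
    (ind_rn_lower he h)
  simpa using this

theorem upper_counts (he : 2 ≤ e) (hX : IsMaya X) (h : Moved e i x X Y) :
    (∀ t, gp (rn e Y i) t = gp (rn e X i) t + gtInd x t) ∧
    (∀ t, bd (rn e Y i) t = bd (rn e X i) t - (1 - gtInd x t)) ∧
      ch (rn e Y i) = ch (rn e X i) - 1 := by
  have := counts_of_ind_add (hX.rn (by omega) _) ((h.isMaya.1 hX).rn (by omega) _)
    (ind_rn_upper he h)
  obtain ⟨h1, h2, h3⟩ := this
  exact ⟨fun t => by rw [h1]; ring, fun t => by rw [h2]; ring, by rw [h3]; ring⟩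

theorem W_self (he : 2 ≤ e) (hX : IsMaya X) (h : Moved e i x X Y) (t : ℤ) :
    W e Y i t = W e X i t - 2 * gtInd x t := by
  unfold W walk
  rw [(lower_counts he hX h).1, (upper_counts he hX h).1]; ring

theorem not_dvd_of_pos_lt {e : ℕ} {a : ℤ} (h0 : 0 < a) (h : a < e) : ¬ (e : ℤ) ∣ a :=
  fun hd => absurd (Int.le_of_dvd h0 hd) (by omega)

/-- The walks of residues `i` and `i + 1` share only the runner `i`, so just one gap count changes.
This needs `e ≥ 3`: for `e = 2` the runners `i - 1` and `i + 1` coincide up to a shift of levels. -/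
theorem W_succ (he : 3 ≤ e) (hX : IsMaya X) (h : Moved e i x X Y) (t : ℤ) :
    W e Y (i + 1) t = W e X (i + 1) t + gtInd x t := by
  unfold W walk
  rw [add_sub_cancel_right, (upper_counts (by omega) hX h).1, rn_other h
    (not_dvd_of_pos_lt (by omega) (by omega)) (not_dvd_of_pos_lt (by omega) (by omega))]
  ring

theorem W_pred (he : 3 ≤ e) (hX : IsMaya X) (h : Moved e (i + 1) x X Y) (t : ℤ) :
    W e Y i t = W e X i t + gtInd x t := by
  have h1 := (lower_counts (by omega) hX h).1
  rw [add_sub_cancel_right] at h1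
  unfold W walk
  rw [h1, rn_other h (r := i - 1)]
  · ring
  · rw [← dvd_neg]; exact not_dvd_of_pos_lt (by omega) (by omega)
  · rw [← dvd_neg]; exact not_dvd_of_pos_lt (by omega) (by omega)

theorem W_other {j : ℤ} (h : Moved e i x X Y)
    (h1 : ¬ (e : ℤ) ∣ j - i) (h2 : ¬ (e : ℤ) ∣ j - i + 1) (h3 : ¬ (e : ℤ) ∣ j - i - 1) :
    W e Y j = W e X j := by
  unfold W
  rw [rn_other h h1 (by rwa [show j - (i - 1) = j - i + 1 by ring]), rn_other h (r := j - 1)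
    (by rwa [show j - 1 - i = j - i - 1 by ring]) (by rwa [show j - 1 - (i - 1) = j - i by ring])]

theorem W_step_le (he : 2 ≤ e) (hX : IsMaya X) (i t : ℤ) : W e X i (t + 1) ≤ W e X i t + 1 :=
  walk_step_le (hX.rn (by omega) _) (hX.rn (by omega) _) t

theorem W_le_step (he : 2 ≤ e) (hX : IsMaya X) (i t : ℤ) : W e X i t ≤ W e X i (t + 1) + 1 :=
  walk_le_step (hX.rn (by omega) _) (hX.rn (by omega) _) t

/-- The image alone determines which bead was moved; this description yields uniqueness of preimages
and the existence criterion `exists_F`. -/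
theorem E_iff_firstMin (he : 2 ≤ e) (hX : IsMaya X) :
    E e i X Y ↔ ∃ x, FirstMin (W e Y i) (x + 1) ∧ Moved e i x X Y := by
  constructor
  · rintro ⟨x, h1, h2⟩
    exact ⟨x, h1.firstMin (W_step_le he hX i x) (W_self he hX h2), h2⟩
  · rintro ⟨x, h1, h2⟩
    exact ⟨x, h1.lastMin (W_le_step he (h2.isMaya.1 hX) i x) (W_self he hX h2), h2⟩

theorem E.det {Y' : Set ℤ} (h : E e i X Y) (h' : E e i X Y') : Y = Y' := by
  obtain ⟨x, h1, h2⟩ := h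
  obtain ⟨x', h1', h2'⟩ := h'
  obtain rfl := h1.unique h1'
  exact ind_ext fun z => by rw [h2, h2']

theorem E.det_back (he : 2 ≤ e) {X' : Set ℤ} (hX : IsMaya X) (h : E e i X Y) (h' : E e i X' Y) :
    X = X' := by
  have hX' : IsMaya X' := h'.isMaya.2 (h.isMaya.1 hX)
  obtain ⟨x, h1, h2⟩ := (E_iff_firstMin he hX).1 h
  obtain ⟨x', h1', h2'⟩ := (E_iff_firstMin he hX').1 h'
  have := h1.unique h1'
  obtain rfl : x = x' := by omega
  refine ind_ext fun z => ?_
  have e1 := h2 z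
  have e2 := h2' z
  omega

theorem exists_E_of_lastMin (he : 2 ≤ e) (hX : IsMaya X) (h : LastMin (W e X i) x) :
    ∃ Y, Moved e i x X Y := by
  have := LastMin.mem (hX.rn (by omega) _) (hX.rn (by omega) _) h
  exact exists_moved this.1 this.2

theorem exists_E (he : 2 ≤ e) (hX : IsMaya X)
    (h : mW e X i < ch (rn e X i) - ch (rn e X (i - 1))) : ∃ Y, E e i X Y := by
  obtain ⟨x, hx⟩ := exists_lastMin (hX.rn (by omega) _) (hX.rn (by omega) _) h
  obtain ⟨Y, hY⟩ := exists_E_of_lastMin he hX hx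
  exact ⟨Y, x, hx, hY⟩

theorem exists_F (he : 2 ≤ e) (hY : IsMaya Y) (h : mW e Y i < 0) : ∃ X, E e i X Y := by
  obtain ⟨x, hx⟩ := exists_firstMin (hY.rn (by omega) _) (hY.rn (by omega) _) h
  obtain ⟨y, rfl⟩ : ∃ y, x = y + 1 := ⟨x - 1, by ring⟩
  have := FirstMin.mem (hY.rn (by omega) _) (hY.rn (by omega) _) hx
  obtain ⟨X, hX⟩ := exists_moved_back this.1 this.2
  exact ⟨X, (E_iff_firstMin he (hX.isMaya.2 hY)).2 ⟨y, hx, hX⟩⟩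

theorem E.mW_lt (he : 2 ≤ e) (hX : IsMaya X) (h : E e i X Y) :
    mW e X i < ch (rn e X i) - ch (rn e X (i - 1)) := by
  obtain ⟨x, h1, -⟩ := h
  exact LastMin.walkMin_lt (hX.rn (by omega) _) (hX.rn (by omega) _) h1

theorem mW_eq {t : ℤ} (h : ∀ u, W e X i t ≤ W e X i u) : mW e X i = W e X i t := walkMin_eq h

theorem mW_le (he : 2 ≤ e) (hX : IsMaya X) (i t : ℤ) : mW e X i ≤ W e X i t :=
  walkMin_le (hX.rn (by omega) _) (hX.rn (by omega) _) t

theorem exists_W_eq_mW (he : 2 ≤ e) (hX : IsMaya X) (i : ℤ) : ∃ t, W e X i t = mW e X i :=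
  exists_walk_eq_min (hX.rn (by omega) _) (hX.rn (by omega) _)

/-- The minimum drops by exactly one at each application, so `-mW` measures how often the inverse
operator applies. -/
theorem E.mW_self (he : 2 ≤ e) (hX : IsMaya X) (h : E e i X Y) : mW e Y i = mW e X i - 1 := by
  obtain ⟨x, h1, h2⟩ := h
  have h3 := h1.firstMin (W_step_le he hX i x) (W_self he hX h2)
  rw [mW_eq h3.1, mW_eq h1.1, W_self he hX h2, gtInd_of_lt (by omega)]
  have := h1.2 (x + 1) (by omega)
  have := W_step_le he hX i x
  omega

theorem E.mW_neg (he : 2 ≤ e) (hX : IsMaya X) (h : E e i X Y) : mW e Y i < 0 := by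
  have h1 := h.mW_self he hX
  have : mW e X i ≤ 0 := walkMin_nonpos (hX.rn (by omega) _) (hX.rn (by omega) _)
  omega

end effects

/-- The Maya diagram of the empty partition. -/
def vac : Set ℤ := {x | x < 0}

theorem vac_isMaya : IsMaya vac := ⟨⟨0, fun _ h => h⟩, ⟨0, fun _ h => not_lt.2 h⟩⟩

/-- The Mullineux relation on Maya diagrams, with the length of the paths. -/
inductive MK (e : ℕ) : ℕ → Set ℤ → Set ℤ → Prop
  | vac : MK e 0 vac vac
  | step {n : ℕ} {X Y X' Y' : Set ℤ} (i : ℤ) : MK e n X Y → E e i X' X → E e (-i) Y' Y →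
      MK e (n + 1) X' Y'

theorem MK.symm {e n : ℕ} {X Y : Set ℤ} (h : MK e n X Y) : MK e n Y X := by
  induction h with
  | vac => exact .vac
  | step i _ h1 h2 ih => exact .step (-i) ih h2 (by rwa [neg_neg])

theorem MK.isMaya {e n : ℕ} {X Y : Set ℤ} (h : MK e n X Y) : IsMaya X ∧ IsMaya Y := by
  induction h with
  | vac => exact ⟨vac_isMaya, vac_isMaya⟩
  | step i _ h1 h2 ih => exact ⟨h1.isMaya.2 ih.1, h2.isMaya.2 ih.2⟩

/-! ### Local relations between neighbouring crystal operators -/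

theorem LastMin.congr {S S' : ℤ → ℤ} {l c : ℤ} (h : LastMin S l) (hS : ∀ t, S' t = S t + c) :
    LastMin S' l := by
  refine ⟨fun t => ?_, fun t ht => ?_⟩
  · have := h.1 t; rw [hS, hS]; omega
  · have := h.2 t ht; rw [hS, hS]; omega

/-- The hypothesis says that the minimum of `S₂` is attained only beyond `l₁`, where the correction
is constant; so the last minimum of `S₂` stays in place, and so does that of `S₁`, which lies before
`l₂`. -/
theorem lastMin_commute {S₁ S₂ : ℤ → ℤ} {l₁ l₂ : ℤ} (h1 : LastMin S₁ l₁) (h2 : LastMin S₂ l₂)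
    (h : ∀ t ≤ l₁, S₂ l₂ < S₂ t) : l₁ < l₂ ∧ LastMin (fun t => S₂ t + gtInd l₁ t) l₂ ∧
      LastMin (fun t => S₁ t + gtInd l₂ t) l₁ := by
  have hl : l₁ < l₂ := by
    by_contra hc
    have := h l₂ (by omega)
    omega
  have e1 := gtInd_of_lt hl
  have e2 : gtInd l₂ l₁ = 0 := gtInd_of_le (by omega)
  refine ⟨hl, ⟨fun t => ?_, fun t ht => ?_⟩, ⟨fun t => ?_, fun t ht => ?_⟩⟩ <;> dsimp only
  · rcases gtInd_cases l₁ t with ⟨h3, h4⟩ | ⟨h3, h4⟩ <;> rw [e1, h4]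
    · have := h2.1 t; omega
    · have := h t h3; omega
  · have := h2.2 t ht
    rw [e1, gtInd_of_lt (by omega)]; omega
  · have := h1.1 t
    rcases gtInd_cases l₂ t with ⟨h3, h4⟩ | ⟨h3, h4⟩ <;> omega
  · have := h1.2 t ht
    rcases gtInd_cases l₂ t with ⟨h3, h4⟩ | ⟨h3, h4⟩ <;> omega

/-- If `S₂` also attains its minimum up to `l₁`, raising it beyond `l₁` moves its last minimum back
to some `p`. Both orders of four operations, with positions `l₁, p, l₂, r` and `l₂, l₁, r, p`, use
the same positions for each residue, which is why they end at the same set. -/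
theorem lastMin_braid {S₁ S₂ : ℤ → ℤ} {l₁ l₂ : ℤ} (h1 : LastMin S₁ l₁) (h2 : LastMin S₂ l₂)
    (hl : l₁ < l₂) (hs : S₁ (l₁ + 1) ≤ S₁ l₁ + 1) (h : ∃ t ≤ l₁, S₂ t = S₂ l₂) :
    ∃ p r, LastMin (fun t => S₂ t + gtInd l₁ t) p ∧
      LastMin (fun t => S₂ t + gtInd l₁ t - 2 * gtInd p t) l₂ ∧
      LastMin (fun t => S₁ t - 2 * gtInd l₁ t + gtInd p t + gtInd l₂ t) r ∧
      S₁ r - 2 * gtInd l₁ r + gtInd p r + gtInd l₂ r = S₁ l₁ ∧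
      LastMin (fun t => S₁ t + gtInd l₂ t) l₁ ∧
      LastMin (fun t => S₁ t + gtInd l₂ t - 2 * gtInd l₁ t) r ∧
      LastMin (fun t => S₂ t - 2 * gtInd l₂ t + gtInd l₁ t + gtInd r t) p ∧
      S₂ p - 2 * gtInd l₂ p + gtInd l₁ p + gtInd r p = S₂ l₂ := by
  -- `p` is the last minimum of `S₂` that is not raised by the first operation.
  obtain ⟨p, ⟨hp, hpm⟩, hplast⟩ := exists_last (P := fun t => t ≤ l₁ ∧ S₂ t = S₂ l₂) l₁
    (fun z hz => hz.1) h
  -- After lowering by 2 beyond `l₁` and raising by 1 beyond `p` and beyond `l₂`, the minimum of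
  -- `S₁` is last attained where `S₁` was one above its old minimum for the last time before `l₂`.
  obtain ⟨r, ⟨hr1, hr2, hrm⟩, hrlast⟩ :=
    exists_last (P := fun t => l₁ < t ∧ t ≤ l₂ ∧ S₁ t = S₁ l₁ + 1) l₂ (fun z hz => hz.2.1)
    ⟨l₁ + 1, by omega, by omega, by have := h1.2 (l₁ + 1) (by omega); omega⟩
  have hp' : ∀ t, p < t → t ≤ l₁ → S₂ l₂ < S₂ t := fun t ht ht' => by
    have := h2.1 t; have := hplast t; omega
  have hr' : ∀ t, r < t → t ≤ l₂ → S₁ l₁ + 1 < S₁ t := fun t ht ht' => by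
    have := h1.2 t (by omega); have := hrlast t; omega
  have f : ∀ a t, gtInd a t = if a < t then 1 else 0 := fun _ _ => rfl
  simp only [f]
  refine ⟨p, r, ⟨fun t => ?_, fun t ht => ?_⟩, ⟨fun t => ?_, fun t ht => ?_⟩,
    ⟨fun t => ?_, fun t ht => ?_⟩, ?_, ⟨fun t => ?_, fun t ht => ?_⟩,
    ⟨fun t => ?_, fun t ht => ?_⟩, ⟨fun t => ?_, fun t ht => ?_⟩, ?_⟩ <;> try dsimp only
  · have := h2.1 t; split_ifs <;> omega
  · have := h2.1 t; have := hp' t ht; split_ifs <;> omega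
  · have := h2.1 t; have := hp' t; split_ifs <;> omega
  · have := h2.2 t ht; split_ifs <;> omega
  · have := h1.1 t; have := h1.2 t; split_ifs <;> omega
  · have := h1.1 t; have := h1.2 t; have := hr' t ht; split_ifs <;> omega
  · split_ifs <;> omega
  · have := h1.1 t; split_ifs <;> omega
  · have := h1.2 t ht; split_ifs <;> omega
  · have := h1.1 t; have := h1.2 t; split_ifs <;> omega
  · have := h1.1 t; have := h1.2 t; have := hr' t ht; split_ifs <;> omega
  · have := h2.1 t; have := h2.2 t; split_ifs <;> omega
  · have := h2.1 t; have := h2.2 t; have := hp' t ht; split_ifs <;> omega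
  · split_ifs <;> omega

/-- Residues (given by integers) that are neighbours. -/
def Nbr (i j : ℤ) : Prop := j = i + 1 ∨ i = j + 1

theorem Nbr.symm {i j : ℤ} (h : Nbr i j) : Nbr j i := Or.symm h

theorem Nbr.neg {i j : ℤ} (h : Nbr i j) : Nbr (-i) (-j) := by
  unfold Nbr at *; omega

/-- A system of operators acting at the last minimum of a walk, as the crystal operators do; their
inverses do so after reversing the direction of the walks. -/
structure WalkSystem where
  P : ℤ → Set ℤ → ℤ → ℤ
  D : ℤ → ℤ → ℤ → ℤ
  cs : ℤ
  cn : ℤ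
  ok : Set ℤ → Prop
  exists_move : ∀ {i l X}, ok X → LastMin (P i X) l →
    ∃ Y, ok Y ∧ ∀ z, ind Y z = ind X z + D i l z
  self : ∀ {i l X Y}, ok X → ok Y → (∀ z, ind Y z = ind X z + D i l z) →
    ∀ t, P i Y t = P i X t - 2 * gtInd l t + cs
  nbr : ∀ {i j l X Y}, Nbr i j → ok X → ok Y → (∀ z, ind Y z = ind X z + D i l z) →
    ∀ t, P j Y t = P j X t + gtInd l t + cn
  step : ∀ {i X t}, ok X → P i X (t + 1) ≤ P i X t + 1

namespace WalkSystem

/-- The operator of a walk system. -/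
def R (s : WalkSystem) (i : ℤ) (X Y : Set ℤ) : Prop :=
  s.ok Y ∧ ∃ l, LastMin (s.P i X) l ∧ ∀ z, ind Y z = ind X z + s.D i l z

variable (s : WalkSystem) {i j : ℤ} {X u v : Set ℤ}

theorem commute (hN : Nbr i j) (hX : s.ok X) {l₁ l₂ : ℤ} (hu : s.ok u) (hv : s.ok v)
    (h1 : LastMin (s.P i X) l₁) (hu' : ∀ z, ind u z = ind X z + s.D i l₁ z)
    (h2 : LastMin (s.P j X) l₂) (hv' : ∀ z, ind v z = ind X z + s.D j l₂ z)
    (h : ∀ t ≤ l₁, s.P j X l₂ < s.P j X t) :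
    ∃ y, s.R j u y ∧ s.R i v y ∧ LastMin (s.P i v) l₁ ∧ s.P i v l₁ = s.P i X l₁ + s.cn := by
  obtain ⟨hl, h3, h4⟩ := lastMin_commute h1 h2 h
  have h3' := h3.congr (s.nbr hN hX hu hu')
  have h4' := h4.congr (s.nbr hN.symm hX hv hv')
  obtain ⟨y, hy, hy'⟩ := s.exists_move hu h3'
  refine ⟨y, ⟨hy, l₂, h3', hy'⟩, ⟨hy, l₁, h4', fun z => ?_⟩, h4', ?_⟩
  · have := hy' z; have := hu' z; have := hv' z; omega
  · rw [s.nbr hN.symm hX hv hv', gtInd_of_le (by omega)]; ring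

theorem braid_of_lt (hN : Nbr i j) (hX : s.ok X) {l₁ l₂ : ℤ} (hl : l₁ < l₂) (hu : s.ok u)
    (hv : s.ok v)
    (h1 : LastMin (s.P i X) l₁) (hu' : ∀ z, ind u z = ind X z + s.D i l₁ z)
    (h2 : LastMin (s.P j X) l₂) (hv' : ∀ z, ind v z = ind X z + s.D j l₂ z)
    (h : ∃ t ≤ l₁, s.P j X t = s.P j X l₂) :
    ∃ u₁ u₂ v₁ v₂ y, s.R j u u₁ ∧ s.R j u₁ u₂ ∧ s.R i u₂ y ∧ s.R i v v₁ ∧ s.R i v₁ v₂ ∧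
      s.R j v₂ y ∧ (∃ r, LastMin (s.P i u₂) r ∧ s.P i u₂ r = s.P i X l₁ + s.cs + 2 * s.cn) ∧
      ∃ p, LastMin (s.P j v₂) p ∧ s.P j v₂ p = s.P j X l₂ + s.cs + 2 * s.cn := by
  obtain ⟨p, r, a1, a2, a3, a4, b1, b2, b3, b4⟩ := lastMin_braid h1 h2 hl (s.step hX) h
  have eu := s.self hX hu hu'
  have eu' := s.nbr hN hX hu hu'
  have ev := s.self hX hv hv'
  have ev' := s.nbr hN.symm hX hv hv'
  have a1' := a1.congr eu'
  obtain ⟨u₁, hu₁, hu₁'⟩ := s.exists_move hu a1'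
  have eu₁ := s.self hu hu₁ hu₁'
  have eu₁' := s.nbr hN.symm hu hu₁ hu₁'
  have a2' : LastMin (s.P j u₁) l₂ :=
    a2.congr (c := s.cn + s.cs) fun t => by rw [eu₁, eu']; ring
  obtain ⟨u₂, hu₂, hu₂'⟩ := s.exists_move hu₁ a2'
  have eu₂' := s.nbr hN.symm hu₁ hu₂ hu₂'
  have a3' : LastMin (s.P i u₂) r :=
    a3.congr (c := s.cs + 2 * s.cn) fun t => by rw [eu₂', eu₁', eu]; ring
  obtain ⟨y, hy, hy'⟩ := s.exists_move hu₂ a3'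
  have b1' := b1.congr ev'
  obtain ⟨v₁, hv₁, hv₁'⟩ := s.exists_move hv b1'
  have ev₁ := s.self hv hv₁ hv₁'
  have ev₁' := s.nbr hN hv hv₁ hv₁'
  have b2' : LastMin (s.P i v₁) r :=
    b2.congr (c := s.cn + s.cs) fun t => by rw [ev₁, ev']; ring
  obtain ⟨v₂, hv₂, hv₂'⟩ := s.exists_move hv₁ b2'
  have ev₂' := s.nbr hN hv₁ hv₂ hv₂'
  have b3' : LastMin (s.P j v₂) p :=
    b3.congr (c := s.cs + 2 * s.cn) fun t => by rw [ev₂', ev₁', ev]; ring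
  refine ⟨u₁, u₂, v₁, v₂, y, ⟨hu₁, p, a1', hu₁'⟩, ⟨hu₂, l₂, a2', hu₂'⟩, ⟨hy, r, a3', hy'⟩,
    ⟨hv₁, l₁, b1', hv₁'⟩, ⟨hv₂, r, b2', hv₂'⟩, ⟨hy, p, b3', fun z => ?_⟩, ⟨r, a3', ?_⟩,
    ⟨p, b3', ?_⟩⟩
  · have := hu' z; have := hu₁' z; have := hu₂' z; have := hy' z
    have := hv' z; have := hv₁' z; have := hv₂' z; omega
  · rw [← a4, eu₂', eu₁', eu]; ring
  · rw [← b4, ev₂', ev₁', ev]; ring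

theorem braid (hN : Nbr i j) (hX : s.ok X) {l₁ l₂ : ℤ} (hu : s.ok u) (hv : s.ok v)
    (h1 : LastMin (s.P i X) l₁) (hu' : ∀ z, ind u z = ind X z + s.D i l₁ z)
    (h2 : LastMin (s.P j X) l₂) (hv' : ∀ z, ind v z = ind X z + s.D j l₂ z)
    (h : ∃ t ≤ l₁, s.P j X t = s.P j X l₂) (h' : ∃ t ≤ l₂, s.P i X t = s.P i X l₁) :
    ∃ u₁ u₂ v₁ v₂ y, s.R j u u₁ ∧ s.R j u₁ u₂ ∧ s.R i u₂ y ∧ s.R i v v₁ ∧ s.R i v₁ v₂ ∧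
      s.R j v₂ y ∧ (∃ r, LastMin (s.P i u₂) r ∧ s.P i u₂ r = s.P i X l₁ + s.cs + 2 * s.cn) ∧
      ∃ p, LastMin (s.P j v₂) p ∧ s.P j v₂ p = s.P j X l₂ + s.cs + 2 * s.cn := by
  rcases lt_trichotomy l₁ l₂ with hl | hl | hl
  · exact s.braid_of_lt hN hX hl hu hv h1 hu' h2 hv' h
  -- Equal positions cannot occur: the step of the second walk at `l₁` is already upward, and the
  -- first move would increase it to at least 2.
  · subst hl
    have e := s.nbr hN hX hu hu'
    have e1 := e l₁
    have e2 := e (l₁ + 1)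
    rw [gtInd_of_le le_rfl] at e1
    rw [gtInd_of_lt (by omega)] at e2
    have h3 := s.step (i := j) (t := l₁) hu
    have h4 := h2.2 (l₁ + 1) (by omega)
    omega
  · obtain ⟨v₁, v₂, u₁, u₂, y, a1, a2, a3, b1, b2, b3, c1, c2⟩ :=
      s.braid_of_lt hN.symm hX hl hv hu h2 hv' h1 hu' h'
    exact ⟨u₁, u₂, v₁, v₂, y, b1, b2, b3, a1, a2, a3, c2, c1⟩

end WalkSystem

theorem W_nbr {e : ℕ} (he : 3 ≤ e) {i j x : ℤ} (hN : Nbr i j) {X Y : Set ℤ} (hX : IsMaya X)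
    (h : Moved e i x X Y) (t : ℤ) : W e Y j t = W e X j t + gtInd x t := by
  rcases hN with rfl | rfl
  · exact W_succ he hX h t
  · exact W_pred he hX h t

/-- The displacement of a bead. -/
def disp (e : ℕ) (i x z : ℤ) : ℤ :=
  (if z = i - 1 + e * x then 1 else 0) - if z = i + e * x then 1 else 0

theorem moved_iff {e : ℕ} {i x : ℤ} {X Y : Set ℤ} :
    Moved e i x X Y ↔ ∀ z, ind Y z = ind X z + disp e i x z := by
  unfold Moved disp
  refine forall_congr' fun z => ?_
  rw [add_sub_assoc]

theorem moved_iff_back {e : ℕ} {i x : ℤ} {X Y : Set ℤ} :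
    Moved e i x X Y ↔ ∀ z, ind X z = ind Y z + -disp e i x z := by
  rw [moved_iff]
  refine forall_congr' fun z => ?_
  constructor <;> intro h <;> omega

/-- The crystal operators as a walk system. -/
noncomputable def crystalSystem (e : ℕ) (he : 3 ≤ e) : WalkSystem where
  P i X := W e X i
  D := disp e
  cs := 0
  cn := 0
  ok := IsMaya
  exists_move {i l X} hX h := by
    obtain ⟨Y, hY⟩ := exists_E_of_lastMin (by omega) hX h
    exact ⟨Y, hY.isMaya.1 hX, moved_iff.1 hY⟩
  self {i l X Y} hX _ h t := by
    rw [W_self (by omega) hX (moved_iff.2 h), add_zero]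
  nbr {i j l X Y} hN hX _ h t := by
    rw [W_nbr he hN hX (moved_iff.2 h), add_zero]
  step {i X t} hX := W_step_le (by omega) hX i t

theorem gtInd_neg (l t : ℤ) : gtInd (-l - 1) (-t) = 1 - gtInd l t := by
  rcases gtInd_cases l t with ⟨h3, h4⟩ | ⟨h3, h4⟩
  · rw [h4, gtInd_of_le (by omega)]; rfl
  · rw [h4, gtInd_of_lt (by omega)]; rfl

theorem lastMin_neg {S : ℤ → ℤ} {l : ℤ} : LastMin (fun t => S (-t)) l ↔ FirstMin S (-l) := by
  constructor
  · rintro ⟨h1, h2⟩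
    refine ⟨fun t => ?_, fun t ht => ?_⟩
    · simpa using h1 (-t)
    · simpa using h2 (-t) (by omega)
  · rintro ⟨h1, h2⟩
    exact ⟨fun t => h1 _, fun t ht => h2 _ (by omega)⟩

/-- The inverses of the crystal operators as a walk system. -/
noncomputable def cocrystalSystem (e : ℕ) (he : 3 ≤ e) : WalkSystem where
  P i X t := W e X i (-t)
  D i l z := -disp e i (-l - 1) z
  -- Reflection turns the indicator of a half-line into one minus an indicator (`gtInd_neg`); the
  -- coefficients of the effects of an inverse move, 2 and -1, become these constants.
  cs := 2
  cn := -1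
  ok := IsMaya
  exists_move {i l X} hX h := by
    have h1 : FirstMin (W e X i) (-l - 1 + 1) := by
      rw [sub_add_cancel]; exact lastMin_neg.1 h
    have h2 := FirstMin.mem (hX.rn (by omega) _) (hX.rn (by omega) _) h1
    obtain ⟨Y, hY⟩ := exists_moved_back h2.1 h2.2
    exact ⟨Y, hY.isMaya.2 hX, moved_iff_back.1 hY⟩
  self {i l X Y} hX hY h t := by
    rw [W_self (by omega) hY (moved_iff_back.2 h), gtInd_neg]; ring
  nbr {i j l X Y} hN hX hY h t := by
    rw [W_nbr he hN hY (moved_iff_back.2 h), gtInd_neg]; ring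
  step {i X t} hX := by
    have := W_le_step (e := e) (by omega) hX i (-(t + 1))
    rwa [show -(t + 1) + 1 = -t by ring] at this

theorem E_of_R {e : ℕ} {he : 3 ≤ e} {i : ℤ} {X Y : Set ℤ} (h : (crystalSystem e he).R i X Y) :
    E e i X Y := by
  obtain ⟨-, l, h1, h2⟩ := h
  exact ⟨l, h1, moved_iff.2 h2⟩

theorem E_of_coR {e : ℕ} {he : 3 ≤ e} {i : ℤ} {X Y : Set ℤ} (h : (cocrystalSystem e he).R i X Y) :
    E e i Y X := by
  obtain ⟨hY, l, h1, h2⟩ := h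
  refine (E_iff_firstMin (by omega) hY).2 ⟨-l - 1, ?_, moved_iff_back.2 h2⟩
  rw [sub_add_cancel]; exact lastMin_neg.1 h1

/-! ### Local relations of Stembridge type for two crystal operators and for their inverses. -/

section stembridge

variable {e : ℕ} {i j : ℤ} {X u v : Set ℤ}

/-- The walk of `j` is raised by one on a half-line. Which of the two alternatives occurs decides
between commutation and the degree four relation. -/
theorem E.mW_nbr (he : 3 ≤ e) (hN : Nbr i j) (hX : IsMaya X) (hu : E e i X u) :
    mW e u j = mW e X j ∨ mW e u j = mW e X j + 1 := by
  have hu0 := hu.isMaya.1 hX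
  obtain ⟨l, -, h2⟩ := hu
  obtain ⟨t, ht⟩ := exists_W_eq_mW (e := e) (by omega) hX j
  obtain ⟨t', ht'⟩ := exists_W_eq_mW (e := e) (by omega) hu0 j
  have h3 := mW_le (e := e) (by omega) hX j t'
  have h4 := mW_le (e := e) (by omega) hu0 j t
  rw [W_nbr he hN hX h2] at ht' h4
  rcases gtInd_cases l t with ⟨_, h5⟩ | ⟨_, h5⟩ <;>
    rcases gtInd_cases l t' with ⟨_, h6⟩ | ⟨_, h6⟩ <;> omega

/-- A raised minimum means that no minimum of the walk of `j` lies at or before the moved level. The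
value of `mW e v i` is recorded in order to check the corresponding hypothesis for the inverse
operators on the image side. -/
theorem E_commute (he : 3 ≤ e) (hN : Nbr i j) (hX : IsMaya X) (hu : E e i X u) (hv : E e j X v)
    (h : mW e u j = mW e X j + 1) :
    ∃ y, E e j u y ∧ E e i v y ∧ mW e v i = mW e X i := by
  have hu0 := hu.isMaya.1 hX
  have hv0 := hv.isMaya.1 hX
  obtain ⟨l₁, h1, hu'⟩ := hu
  obtain ⟨l₂, h2, hv'⟩ := hv
  obtain ⟨y, hy1, hy2, h3, h4⟩ := (crystalSystem e he).commute hN hX hu0 hv0 h1 (moved_iff.1 hu') h2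
    (moved_iff.1 hv') (fun t ht => by
      have h5 := mW_le (e := e) (by omega) hu0 j t
      rw [W_nbr he hN hX hu', gtInd_of_le ht, h, mW_eq h2.1] at h5
      change W e X j l₂ < W e X j t
      omega)
  refine ⟨y, E_of_R hy1, E_of_R hy2, ?_⟩
  rw [mW_eq h3.1, mW_eq h1.1]
  simpa [crystalSystem] using h4

/-- An unchanged minimum means that it is also attained at or before the moved level, in both
directions. The two recorded minima are what `coE_braid` will need on the image side. -/
theorem E_braid (he : 3 ≤ e) (hN : Nbr i j) (hX : IsMaya X) (hu : E e i X u) (hv : E e j X v)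
    (h : mW e u j = mW e X j) (h' : mW e v i = mW e X i) :
    ∃ u₁ u₂ v₁ v₂ y, E e j u u₁ ∧ E e j u₁ u₂ ∧ E e i u₂ y ∧ E e i v v₁ ∧ E e i v₁ v₂ ∧
      E e j v₂ y ∧ mW e u₂ i = mW e X i ∧ mW e v₂ j = mW e X j := by
  have hu0 := hu.isMaya.1 hX
  have hv0 := hv.isMaya.1 hX
  have key : ∀ {i j l₁ l₂ u}, Nbr i j → IsMaya u → Moved e i l₁ X u → LastMin (W e X j) l₂ →
      mW e u j = mW e X j → ∃ t ≤ l₁, W e X j t = W e X j l₂ := by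
    intro i j l₁ l₂ u hN hu0 hu' h2 h
    obtain ⟨t, ht⟩ := exists_W_eq_mW (e := e) (by omega) hu0 j
    rw [W_nbr he hN hX hu', h, mW_eq h2.1] at ht
    have h3 := h2.1 t
    rcases gtInd_cases l₁ t with ⟨h5, h6⟩ | ⟨h5, h6⟩
    · omega
    · exact ⟨t, h5, by omega⟩
  obtain ⟨l₁, h1, hu'⟩ := hu
  obtain ⟨l₂, h2, hv'⟩ := hv
  obtain ⟨u₁, u₂, v₁, v₂, y, a1, a2, a3, b1, b2, b3, ⟨r, c1, c2⟩, ⟨p, d1, d2⟩⟩ :=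
    (crystalSystem e he).braid hN hX hu0 hv0 h1 (moved_iff.1 hu') h2 (moved_iff.1 hv')
      (key hN hu0 hu' h2 h) (key hN.symm hv0 hv' h1 h')
  refine ⟨u₁, u₂, v₁, v₂, y, E_of_R a1, E_of_R a2, E_of_R a3, E_of_R b1, E_of_R b2, E_of_R b3,
    ?_, ?_⟩
  · rw [mW_eq c1.1, mW_eq h1.1]; simpa [crystalSystem] using c2
  · rw [mW_eq d1.1, mW_eq h2.1]; simpa [crystalSystem] using d2

theorem coE_data (he : 2 ≤ e) {y : Set ℤ} (hy : IsMaya y) (hu : E e i u y) :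
    ∃ l, LastMin (fun t => W e y i (-t)) l ∧ Moved e i (-l - 1) u y := by
  obtain ⟨x, h1, h2⟩ := (E_iff_firstMin he (hu.isMaya.2 hy)).1 hu
  refine ⟨-x - 1, lastMin_neg.2 ?_, ?_⟩
  · rwa [show -(-x - 1) = x + 1 by ring]
  · rwa [show -(-x - 1) - 1 = x by ring]

/-- Undoing a move lowers the walk of `j` by one beyond the moved level; if the minimum does not
drop, the first minimum lies outside that half-line and the two inverse moves do not interact. -/
theorem coE_commute (he : 3 ≤ e) (hN : Nbr i j) {y : Set ℤ} (hy : IsMaya y) (hu : E e i u y)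
    (hv : E e j v y) (h : mW e u j = mW e y j) : ∃ x, E e j x u ∧ E e i x v := by
  have hu0 := hu.isMaya.2 hy
  have hv0 := hv.isMaya.2 hy
  obtain ⟨l₁, h1, hu'⟩ := coE_data (by omega) hy hu
  obtain ⟨l₂, h2, hv'⟩ := coE_data (by omega) hy hv
  obtain ⟨x, hx1, hx2, -⟩ := (cocrystalSystem e he).commute hN hy hu0 hv0 h1 (moved_iff_back.1 hu')
    h2 (moved_iff_back.1 hv') (fun t ht => by
      have h5 := mW_le (e := e) (by omega) hu0 j (-t)
      have h6 := W_nbr he hN hu0 hu' (-t)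
      rw [gtInd_neg, gtInd_of_le ht] at h6
      rw [h, mW_eq (lastMin_neg.1 h2).1] at h5
      change W e y j (-l₂) < W e y j (-t)
      omega)
  exact ⟨x, E_of_coR hx1, E_of_coR hx2⟩

theorem coE_braid (he : 3 ≤ e) (hN : Nbr i j) {y : Set ℤ} (hy : IsMaya y) (hu : E e i u y)
    (hv : E e j v y) (h : mW e u j = mW e y j - 1) (h' : mW e v i = mW e y i - 1) :
    ∃ u₁ u₂ v₁ v₂ x, E e j u₁ u ∧ E e j u₂ u₁ ∧ E e i x u₂ ∧ E e i v₁ v ∧ E e i v₂ v₁ ∧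
      E e j x v₂ := by
  have hu0 := hu.isMaya.2 hy
  have hv0 := hv.isMaya.2 hy
  have key : ∀ {i j l₁ l₂ u}, Nbr i j → IsMaya u → Moved e i (-l₁ - 1) u y →
      LastMin (fun t => W e y j (-t)) l₂ →
      mW e u j = mW e y j - 1 → ∃ t ≤ l₁, W e y j (-t) = W e y j (-l₂) := by
    intro i j l₁ l₂ u hN hu0 hu' h2 h
    obtain ⟨t, ht⟩ := exists_W_eq_mW (e := e) (by omega) hu0 j
    have h6 := W_nbr he hN hu0 hu' t
    have h7 := gtInd_neg l₁ (-t)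
    rw [neg_neg] at h7
    rw [h, mW_eq (lastMin_neg.1 h2).1] at ht
    have h3 := h2.1 (-t)
    simp only [neg_neg] at h3
    rcases gtInd_cases l₁ (-t) with ⟨h5, h8⟩ | ⟨h5, h8⟩
    · omega
    · exact ⟨-t, h5, by rw [neg_neg]; omega⟩
  obtain ⟨l₁, h1, hu'⟩ := coE_data (by omega) hy hu
  obtain ⟨l₂, h2, hv'⟩ := coE_data (by omega) hy hv
  obtain ⟨u₁, u₂, v₁, v₂, x, a1, a2, a3, b1, b2, b3, -⟩ :=
    (cocrystalSystem e he).braid hN hy hu0 hv0 h1 (moved_iff_back.1 hu') h2 (moved_iff_back.1 hv')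
      (key hN hu0 hu' h2 h) (key hN.symm hv0 hv' h1 h')
  exact ⟨u₁, u₂, v₁, v₂, x, E_of_coR a1, E_of_coR a2, E_of_coR a3, E_of_coR b1, E_of_coR b2,
    E_of_coR b3⟩

/-- Residues that are neither equal nor neighbours. -/
def Far (e : ℕ) (i j : ℤ) : Prop :=
  ¬ (e : ℤ) ∣ j - i ∧ ¬ (e : ℤ) ∣ j - i + 1 ∧ ¬ (e : ℤ) ∣ j - i - 1

theorem Far.symm (h : Far e i j) : Far e j i := by
  refine ⟨fun h' => h.1 ?_, fun h' => h.2.2 ?_, fun h' => h.2.1 ?_⟩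
  · rw [show j - i = -(i - j) by ring]; exact dvd_neg.2 h'
  · rw [show j - i - 1 = -(i - j + 1) by ring]; exact dvd_neg.2 h'
  · rw [show j - i + 1 = -(i - j - 1) by ring]; exact dvd_neg.2 h'

theorem Far.neg (h : Far e i j) : Far e (-i) (-j) := by
  refine ⟨fun h' => h.1 ?_, fun h' => h.2.2 ?_, fun h' => h.2.1 ?_⟩
  · rw [show j - i = -(-j - -i) by ring]; exact dvd_neg.2 h'
  · rw [show j - i - 1 = -(-j - -i + 1) by ring]; exact dvd_neg.2 h'
  · rw [show j - i + 1 = -(-j - -i - 1) by ring]; exact dvd_neg.2 h'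

theorem W_far {x : ℤ} (hF : Far e i j) (h : Moved e i x X u) : W e u j = W e X j :=
  W_other h hF.1 hF.2.1 hF.2.2

theorem E_commute_far (he : 2 ≤ e) (hF : Far e i j) (hX : IsMaya X) (hu : E e i X u)
    (hv : E e j X v) : ∃ y, E e j u y ∧ E e i v y := by
  have hu0 := hu.isMaya.1 hX
  obtain ⟨l₁, h1, hu'⟩ := hu
  obtain ⟨l₂, h2, hv'⟩ := hv
  rw [← W_far hF hu'] at h2
  rw [← W_far hF.symm hv'] at h1
  obtain ⟨y, hy⟩ := exists_E_of_lastMin he hu0 h2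
  refine ⟨y, ⟨l₂, h2, hy⟩, ⟨l₁, h1, moved_iff.2 fun z => ?_⟩⟩
  have := moved_iff.1 hy z; have := moved_iff.1 hu' z; have := moved_iff.1 hv' z
  omega

theorem coE_commute_far (he : 2 ≤ e) (hF : Far e i j) {y : Set ℤ} (hy : IsMaya y) (hu : E e i u y)
    (hv : E e j v y) : ∃ x, E e j x u ∧ E e i x v := by
  have hu0 := hu.isMaya.2 hy
  have hv0 := hv.isMaya.2 hy
  obtain ⟨l₁, h1, hu'⟩ := (E_iff_firstMin he hu0).1 hu
  obtain ⟨l₂, h2, hv'⟩ := (E_iff_firstMin he hv0).1 hv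
  rw [W_far hF hu'] at h2
  rw [W_far hF.symm hv'] at h1
  have h3 := FirstMin.mem (hu0.rn (by omega) _) (hu0.rn (by omega) _) h2
  obtain ⟨x, hx⟩ := exists_moved_back (i := j) (Y := u) h3.1 h3.2
  have hx0 := hx.isMaya.2 hu0
  refine ⟨x, (E_iff_firstMin he hx0).2 ⟨l₂, h2, hx⟩,
    (E_iff_firstMin he hx0).2 ⟨l₁, h1, moved_iff.2 fun z => ?_⟩⟩
  have e1 := moved_iff.1 hx z
  have e2 := moved_iff.1 hu' z
  have e3 := moved_iff.1 hv' z
  omega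

end stembridge

/-! ### Path independence of the Mullineux map -/

theorem ch_of_Iio {A : Set ℤ} {p : ℤ} (h : ∀ t, t ∈ A ↔ t < p) : ch A = p := by
  have hA : IsMaya A := ⟨⟨p, fun x hx => (h x).2 hx⟩, ⟨p, fun x hx => fun h' => by
    have := (h x).1 h'; omega⟩⟩
  have h1 := bd_sub_gp hA p
  rw [gp_eq_zero fun u hu => (h u).2 hu, bd_eq_zero fun u hu h' => by
    have := (h u).1 h'; omega] at h1
  omega

theorem mem_rn_vac {e : ℕ} (he : 0 < e) (r t : ℤ) : t ∈ rn e vac r ↔ t < -(r / e) := by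
  have he' : (0 : ℤ) < e := by exact_mod_cast he
  have h1 := Int.emod_nonneg r he'.ne'
  have h2 := Int.emod_lt_of_pos r he'
  have h3 := Int.mul_ediv_add_emod r e
  rw [mem_rn]
  change r + e * t < 0 ↔ _
  constructor
  · intro h
    by_contra hc
    have : (e : ℤ) * (t + r / e) ≥ 0 := mul_nonneg he'.le (by omega)
    nlinarith
  · intro h
    have : (e : ℤ) * (t + r / e) ≤ e * (-1) := mul_le_mul_of_nonneg_left (by omega) he'.le
    nlinarith

theorem ch_vac {e : ℕ} (he : 0 < e) (r : ℤ) : ch (rn e vac r) = -(r / e) :=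
  ch_of_Iio (mem_rn_vac he r)

theorem ch_moved {e : ℕ} (he : 2 ≤ e) {i x : ℤ} {X Y : Set ℤ} (hX : IsMaya X) (h : Moved e i x X Y)
    (r : ℤ) : ch (rn e Y r) = ch (rn e X r) + (if (e : ℤ) ∣ r - (i - 1) then 1 else 0) -
      if (e : ℤ) ∣ r - i then 1 else 0 := by
  have hY := h.isMaya.1 hX
  have hn : ¬ (e : ℤ) ∣ 1 := not_dvd_of_pos_lt one_pos (by omega)
  by_cases h1 : (e : ℤ) ∣ r - (i - 1)
  · rw [if_pos h1, if_neg]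
    · obtain ⟨k, hk⟩ := h1
      obtain rfl : r = i - 1 + e * k := by linarith
      rw [ch_shift hX (by omega), ch_shift hY (by omega), (lower_counts he hX h).2.2]; ring
    · intro h2
      apply hn
      have := dvd_sub h1 h2
      rwa [show r - (i - 1) - (r - i) = 1 by ring] at this
  · rw [if_neg h1]
    by_cases h2 : (e : ℤ) ∣ r - i
    · rw [if_pos h2]
      obtain ⟨k, hk⟩ := h2
      obtain rfl : r = i + e * k := by linarith
      rw [ch_shift hX (by omega), ch_shift hY (by omega), (upper_counts he hX h).2.2]; ring
    · rw [if_neg h2, rn_other h h2 h1]; ring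

/-- An arrow `i` shifts one unit of charge from runner `i` to `i - 1`, and `r ↦ -1 - r` takes the
pair `(i - 1, i)` to `(-i, -i - 1)`. The constant 1 comes from the empty partition, where the charge
of `r` is `-(r / e)`. -/
theorem MK.charge {e n : ℕ} (he : 2 ≤ e) {X Y : Set ℤ} (h : MK e n X Y) (r : ℤ) :
    ch (rn e Y (-1 - r)) = 1 - ch (rn e X r) := by
  induction h with
  | vac =>
    rw [ch_vac (by omega), ch_vac (by omega)]
    have : (-1 - r) / (e : ℤ) = -1 - r / e := by
      have he' : (0 : ℤ) < e := by omega
      have h1 := Int.emod_nonneg r he'.ne'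
      have h2 := Int.emod_lt_of_pos r he'
      have h3 := Int.mul_ediv_add_emod r e
      rw [Int.ediv_eq_iff_of_pos he']
      constructor <;> nlinarith
    rw [this]; ring
  | @step n X Y X' Y' i h0 h1 h2 ih =>
    have hX := h1.isMaya.2 h0.isMaya.1
    have hY := h2.isMaya.2 h0.isMaya.2
    obtain ⟨x, -, h1⟩ := h1
    obtain ⟨y, -, h2⟩ := h2
    have e1 := ch_moved he hX h1 r
    have e2 := ch_moved he hY h2 (-1 - r)
    have c1 : (e : ℤ) ∣ -1 - r - (-i - 1) ↔ (e : ℤ) ∣ r - i := by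
      rw [← dvd_neg, show -(-1 - r - (-i - 1)) = r - i by ring]
    have c2 : (e : ℤ) ∣ -1 - r - -i ↔ (e : ℤ) ∣ r - (i - 1) := by
      rw [← dvd_neg, show -(-1 - r - -i) = r - (i - 1) by ring]
    simp only [c1, c2] at e2
    omega

/-- The simulation property: the Mullineux relation is compatible with the crystal operators. -/
def Sim (e n : ℕ) : Prop := ∀ X Y, MK e n X Y → ∀ i X', E e i X X' →
  ∃ Y', E e (-i) Y Y' ∧ ∃ m, n = m + 1 ∧ MK e m X' Y'

/-- While the operator applies, step down on both sides, which lowers both minima by one. When it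
applies on neither side, both minima equal the end values of the walks, and these agree by
`MK.charge`. -/
theorem mW_match {e n : ℕ} (he : 2 ≤ e) (hs : ∀ m ≤ n, Sim e m) {X Y : Set ℤ} (h : MK e n X Y)
    (i : ℤ) : mW e X i = mW e Y (-i) := by
  induction n generalizing X Y with
  | zero =>
    have hc1 := h.charge he i
    have hc2 := h.charge he (i - 1)
    rw [show -1 - i = -i - 1 by ring] at hc1
    rw [show -1 - (i - 1) = -i by ring] at hc2
    have hX := h.isMaya.1
    have hY := h.isMaya.2
    have h1 : mW e X i ≤ _ := walkMin_le_charge (hX.rn (by omega) _) (hX.rn (by omega) _)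
    have h2 : mW e Y (-i) ≤ _ := walkMin_le_charge (hY.rn (by omega) _) (hY.rn (by omega) _)
    have h3 : ¬ mW e X i < ch (rn e X i) - ch (rn e X (i - 1)) := by
      intro h0
      obtain ⟨X', hX'⟩ := exists_E he hX h0
      obtain ⟨Y', -, m, hm, -⟩ := hs 0 le_rfl X Y h i X' hX'
      omega
    have h4 : ¬ mW e Y (-i) < ch (rn e Y (-i)) - ch (rn e Y (-i - 1)) := by
      intro h0
      obtain ⟨Y', hY'⟩ := exists_E he hY h0
      obtain ⟨X', -, m, hm, -⟩ := hs 0 le_rfl Y X h.symm (-i) Y' hY'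
      omega
    omega
  | succ n ih =>
    have hc1 := h.charge he i
    have hc2 := h.charge he (i - 1)
    rw [show -1 - i = -i - 1 by ring] at hc1
    rw [show -1 - (i - 1) = -i by ring] at hc2
    have hX := h.isMaya.1
    have hY := h.isMaya.2
    have h1 : mW e X i ≤ _ := walkMin_le_charge (hX.rn (by omega) _) (hX.rn (by omega) _)
    have h2 : mW e Y (-i) ≤ _ := walkMin_le_charge (hY.rn (by omega) _) (hY.rn (by omega) _)
    by_cases h3 : mW e X i < ch (rn e X i) - ch (rn e X (i - 1))
    · obtain ⟨X', hX'⟩ := exists_E he hX h3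
      obtain ⟨Y', hY', m, hm, hm'⟩ := hs _ le_rfl X Y h i X' hX'
      obtain rfl : n = m := by omega
      have := ih (fun m hm => hs m (by omega)) hm'
      rw [hX'.mW_self he hX, hY'.mW_self he hY] at this
      omega
    · have h4 : ¬ mW e Y (-i) < ch (rn e Y (-i)) - ch (rn e Y (-i - 1)) := by
        intro h0
        obtain ⟨Y', hY'⟩ := exists_E he hY h0
        obtain ⟨X', hX', -⟩ := hs _ le_rfl Y X h.symm (-i) Y' hY'
        rw [neg_neg] at hX'
        exact h3 (hX'.mW_lt he hX)
      omega

theorem MK.extend {e n : ℕ} (he : 2 ≤ e) (hs : ∀ m ≤ n, Sim e m) {X Y X' : Set ℤ} {i : ℤ}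
    (h : MK e n X Y) (h' : E e i X' X) : ∃ Y', E e (-i) Y' Y ∧ MK e (n + 1) X' Y' := by
  have h1 := h'.mW_neg he (h'.isMaya.2 h.isMaya.1)
  rw [mW_match he hs h] at h1
  obtain ⟨Y', hY'⟩ := exists_F he h.isMaya.2 h1
  exact ⟨Y', hY', .step i h h' hY'⟩

/-- The two arrows out of `X` are completed to a closed diagram by the local relations. One side of
it is carried to the image downwards from `Y₀` by the induction hypothesis, the other climbs back by
`MK.extend`. Since `mW_match` transfers the minima, the inverse relations close the diagram on the
image side, and unique preimages show that it closes at `Y`. -/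
theorem sim_nbr {e m : ℕ} (he : 3 ≤ e) (hs : ∀ k ≤ m, Sim e k) {X₀ Y₀ X Y X' : Set ℤ} {i j : ℤ}
    (hN : Nbr i j) (h : MK e m X₀ Y₀) (hX : E e i X X₀) (hY : E e (-i) Y Y₀) (hj : E e j X X') :
    ∃ Y', E e (-j) Y Y' ∧ MK e m X' Y' := by
  have he2 : 2 ≤ e := by omega
  have mX := hX.isMaya.2 h.isMaya.1
  have mY := hY.isMaya.2 h.isMaya.2
  have mX' := hj.isMaya.1 mX
  rcases hX.mW_nbr he hN mX with hA | hA
  · rcases hj.mW_nbr he hN.symm mX with hB | hB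
    · obtain ⟨u₁, u₂, v₁, v₂, y, a1, a2, a3, b1, b2, b3, c1, c2⟩ := E_braid he hN mX hX hj hA hB
      have mu₁ := a1.isMaya.1 h.isMaya.1
      have mu₂ := a2.isMaya.1 mu₁
      have mv₁ := b1.isMaya.1 mX'
      have mv₂ := b2.isMaya.1 mv₁
      obtain ⟨U₁, A1, m, rfl, hm1⟩ := hs _ le_rfl _ _ h _ _ a1
      obtain ⟨U₂, A2, m, rfl, hm2⟩ := hs _ (by omega) _ _ hm1 _ _ a2
      obtain ⟨Z, A3, m, rfl, hm3⟩ := hs _ (by omega) _ _ hm2 _ _ a3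
      obtain ⟨V₂, B3, k1⟩ := hm3.extend he2 (fun k hk => hs k (by omega)) b3
      obtain ⟨V₁, B2, k2⟩ := k1.extend he2 (fun k hk => hs k (by omega)) b2
      obtain ⟨Y', B1, k3⟩ := k2.extend he2 (fun k hk => hs k (by omega)) b1
      have f1 := mW_match he2 (fun k hk => hs k (by omega)) hm2 j
      have f2 := mW_match he2 (fun k hk => hs k (by omega)) hm3 j
      have f3 := mW_match he2 (fun k hk => hs k (by omega)) k1 i
      have f4 := mW_match he2 (fun k hk => hs k (by omega)) hm3 i
      have g1 := a1.mW_self he2 h.isMaya.1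
      have g2 := a2.mW_self he2 mu₁
      have g3 := b3.mW_self he2 mv₂
      have g4 := b1.mW_self he2 mX'
      have g5 := b2.mW_self he2 mv₁
      have g6 := a3.mW_self he2 mu₂
      -- The two ascents from `Z` predicted by the inverse relation meet at `Q`; they retrace the
      -- known arrows one by one, so `Q` is `Y`.
      obtain ⟨U₁', U₂', V₁', V₂', Q, A1', A2', A3', B1', B2', B3'⟩ :=
        coE_braid he hN.neg hm3.isMaya.2 A3 B3 (by omega) (by omega)
      have mU₁ := hm1.isMaya.2
      obtain rfl : U₁ = U₁' := A2.det_back he2 mU₁ A1'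
      obtain rfl : Y₀ = U₂' := A1.det_back he2 h.isMaya.2 A2'
      obtain rfl : Y = Q := hY.det_back he2 mY A3'
      obtain rfl : V₁ = V₁' := B2.det_back he2 k2.isMaya.2 B1'
      obtain rfl : Y' = V₂' := B1.det_back he2 k3.isMaya.2 B2'
      exact ⟨Y', B3', k3⟩
    · obtain ⟨y, a1, a2, a3⟩ := E_commute he hN.symm mX hj hX hB
      obtain ⟨Z, A2, m, rfl, hm⟩ := hs _ le_rfl _ _ h _ _ a2
      obtain ⟨Y', A1, k1⟩ := hm.extend he2 (fun k hk => hs k (by omega)) a1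
      have f1 := mW_match he2 (fun k hk => hs k (by omega)) k1 j
      have f2 := mW_match he2 (fun k hk => hs k (by omega)) hm j
      have g1 := hj.mW_self he2 mX
      have g2 := a2.mW_self he2 h.isMaya.1
      obtain ⟨Q, hQ1, hQ2⟩ := coE_commute he hN.neg hm.isMaya.2 A1 A2 (by omega)
      obtain rfl : Y = Q := hY.det_back he2 mY hQ2
      exact ⟨Y', hQ1, k1⟩
  · obtain ⟨y, a1, a2, a3⟩ := E_commute he hN mX hX hj hA
    obtain ⟨Z, A1, m, rfl, hm⟩ := hs _ le_rfl _ _ h _ _ a1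
    obtain ⟨Y', A2, k1⟩ := hm.extend he2 (fun k hk => hs k (by omega)) a2
    have f1 := mW_match he2 (fun k hk => hs k (by omega)) h i
    have f2 := mW_match he2 (fun k hk => hs k (by omega)) hm i
    have g1 := hX.mW_self he2 mX
    have g2 := a2.mW_self he2 mX'
    obtain ⟨Q, hQ1, hQ2⟩ := coE_commute he hN.symm.neg hm.isMaya.2 A1 A2 (by omega)
    obtain rfl : Y = Q := hY.det_back he2 mY hQ1
    exact ⟨Y', hQ2, k1⟩

theorem sim_far {e m : ℕ} (he : 2 ≤ e) (hs : ∀ k ≤ m, Sim e k) {X₀ Y₀ X Y X' : Set ℤ} {i j : ℤ}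
    (hF : Far e i j) (h : MK e m X₀ Y₀) (hX : E e i X X₀) (hY : E e (-i) Y Y₀) (hj : E e j X X') :
    ∃ Y', E e (-j) Y Y' ∧ MK e m X' Y' := by
  obtain ⟨y, a1, a2⟩ := E_commute_far he hF (hX.isMaya.2 h.isMaya.1) hX hj
  obtain ⟨Z, A1, m, rfl, hm⟩ := hs _ le_rfl _ _ h _ _ a1
  obtain ⟨Y', A2, k1⟩ := hm.extend he (fun k hk => hs k (by omega)) a2
  obtain ⟨Q, hQ1, hQ2⟩ := coE_commute_far he hF.symm.neg hm.isMaya.2 A1 A2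
  obtain rfl : Y = Q := hY.det_back he (hY.isMaya.2 h.isMaya.2) hQ1
  exact ⟨Y', hQ2, k1⟩

theorem not_E_vac {e : ℕ} (he : 2 ≤ e) (i : ℤ) (X : Set ℤ) : ¬ E e i vac X := by
  rintro ⟨x, h1, h2⟩
  have h3 := LastMin.mem (vac_isMaya.rn (by omega) _) (vac_isMaya.rn (by omega) _) h1
  have h4 : i + e * x < 0 := h3.1
  have h5 : ¬ (i - 1 + e * x < 0) := h3.2
  omega

/-- Compare the new residue `j` with the residue `i` of the last arrow of the given path: equal,
adjacent, or far apart. -/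
theorem sim {e : ℕ} (he : 3 ≤ e) (n : ℕ) : Sim e n := by
  induction n using Nat.strong_induction_on with
  | _ n ih =>
    intro X Y h j X' hj
    cases h with
    | vac => exact absurd hj (not_E_vac (by omega) _ _)
    | @step m X₀ Y₀ _ _ i h h1 h2 =>
      have hs : ∀ k ≤ m, Sim e k := fun k hk => ih k (by omega)
      suffices ∃ Y', E e (-j) Y Y' ∧ MK e m X' Y' by
        obtain ⟨Y', a, b⟩ := this
        exact ⟨Y', a, m, rfl, b⟩
      by_cases c1 : (e : ℤ) ∣ j - i
      · obtain ⟨k, hk⟩ := c1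
        obtain rfl : j = i + e * k := by linarith
        rw [E_shift] at hj
        obtain rfl := h1.det hj
        refine ⟨Y₀, ?_, h⟩
        rw [show -(i + e * k) = -i + e * (-k) by ring, E_shift]
        exact h2
      by_cases c2 : (e : ℤ) ∣ j - i - 1
      · obtain ⟨k, hk⟩ := c2
        obtain rfl : j = (i + 1) + e * k := by linarith
        rw [E_shift] at hj
        rw [show -(i + 1 + e * k) = -(i + 1) + e * (-k) by ring]
        simp only [E_shift]
        exact sim_nbr he hs (Or.inl rfl) h h1 h2 hj
      by_cases c3 : (e : ℤ) ∣ j - i + 1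
      · obtain ⟨k, hk⟩ := c3
        obtain rfl : j = (i - 1) + e * k := by linarith
        rw [E_shift] at hj
        rw [show -(i - 1 + e * k) = -(i - 1) + e * (-k) by ring]
        simp only [E_shift]
        exact sim_nbr he hs (Or.inr (by ring)) h h1 h2 hj
      · exact sim_far (by omega) hs ⟨c1, c3, c2⟩ h h1 h2 hj

theorem MK.down {e n : ℕ} (he : 3 ≤ e) {X Y X' : Set ℤ} {i : ℤ} (h : MK e n X Y)
    (h' : E e i X X') : ∃ Y', E e (-i) Y Y' ∧ ∃ m, n = m + 1 ∧ MK e m X' Y' :=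
  sim he n X Y h i X' h'

theorem MK.up {e n : ℕ} (he : 3 ≤ e) {X Y X' : Set ℤ} {i : ℤ} (h : MK e n X Y)
    (h' : E e i X' X) : ∃ Y', E e (-i) Y' Y ∧ MK e (n + 1) X' Y' :=
  h.extend (by omega) (fun m _ => sim he m) h'

/-- For `e = 2` negation fixes every residue, so both paths follow the same arrows from the same
start. -/
theorem MK.eq_of_two {n : ℕ} {X Y : Set ℤ} (h : MK 2 n X Y) : X = Y := by
  induction h with
  | vac => rfl
  | @step n X Y X' Y' i h h1 h2 ih =>
    subst ih
    rw [show -i = i + (2 : ℕ) * (-i) by push_cast; ring, E_shift] at h2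
    exact h1.det_back le_rfl (h1.isMaya.2 h.isMaya.1) h2

theorem MK.length_eq {e n m : ℕ} (he : 3 ≤ e) {X Y Z : Set ℤ} (h : MK e n X Y) (h' : MK e m X Z) :
    n = m ∧ Y = Z := by
  induction n generalizing m X Y Z with
  | zero =>
    cases h with
    | vac =>
      cases h' with
      | vac => exact ⟨rfl, rfl⟩
      | step i a b c => exact absurd b (not_E_vac (by omega) _ _)
  | succ n ih =>
    cases h with
    | @step _ X₀ Y₀ _ _ i a b c =>
      obtain ⟨Z', hZ, m, rfl, hm⟩ := h'.down he b
      obtain ⟨rfl, rfl⟩ := ih a hm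
      exact ⟨rfl, c.det_back (by omega) (c.isMaya.2 a.isMaya.2) hZ⟩

theorem MK.unique {e n m : ℕ} (he : 2 ≤ e) {X Y Z : Set ℤ} (h : MK e n X Y) (h' : MK e m X Z) :
    Y = Z := by
  rcases he.eq_or_lt with rfl | he
  · rw [← h.eq_of_two, ← h'.eq_of_two]
  · exact (h.length_eq he h').2

/-! ### Young diagrams and their beta-sets -/

/-- The bead belonging to a row. -/
def rowBead (lam : YoungDiagram) (k : ℕ) : ℤ := (lam.rowLen k : ℤ) - (k + 1)

theorem mem_beta {lam : YoungDiagram} {x : ℤ} : x ∈ beta lam ↔ ∃ k, rowBead lam k = x := Iff.rfl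

theorem rowBead_lt {lam : YoungDiagram} {k l : ℕ} (h : k < l) : rowBead lam l < rowBead lam k := by
  have := lam.rowLen_anti k l h.le
  unfold rowBead; omega

theorem rowBead_strictAnti (lam : YoungDiagram) : StrictAnti (rowBead lam) :=
  fun _ _ h => rowBead_lt h

theorem rowBead_inj {lam : YoungDiagram} {k l : ℕ} : rowBead lam k = rowBead lam l ↔ k = l :=
  (rowBead_strictAnti lam).injective.eq_iff

theorem rowLen_eq_zero (lam : YoungDiagram) : ∃ N, ∀ k, N ≤ k → lam.rowLen k = 0 := by
  refine ⟨lam.colLen 0, fun k hk => ?_⟩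
  by_contra h
  have h1 : (k, 0) ∈ lam := YoungDiagram.mem_iff_lt_rowLen.2 (Nat.pos_of_ne_zero h)
  have h2 := YoungDiagram.mem_iff_lt_colLen.1 h1
  omega

theorem beta_isMaya (lam : YoungDiagram) : IsMaya (beta lam) := by
  obtain ⟨N, hN⟩ := rowLen_eq_zero lam
  refine ⟨⟨-N, fun x hx => mem_beta.2 ⟨(-x - 1).toNat, ?_⟩⟩, ⟨lam.rowLen 0, fun x hx hx' => ?_⟩⟩
  · unfold rowBead
    rw [hN _ (by omega)]; omega
  · obtain ⟨k, rfl⟩ := mem_beta.1 hx'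
    have := lam.rowLen_anti 0 k (Nat.zero_le k)
    unfold rowBead at hx; omega

theorem young_ext {lam mu : YoungDiagram} (h : ∀ k, lam.rowLen k = mu.rowLen k) : lam = mu := by
  ext ⟨i, j⟩
  rw [YoungDiagram.mem_cells, YoungDiagram.mem_cells, YoungDiagram.mem_iff_lt_rowLen,
    YoungDiagram.mem_iff_lt_rowLen, h]

theorem beta_injective : Function.Injective beta := by
  intro lam mu h
  have key : ∀ k, rowBead lam k = rowBead mu k := by
    intro k
    induction k using Nat.strong_induction_on with
    | _ k ih =>
      have aux : ∀ {lam mu : YoungDiagram}, beta lam = beta mu →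
          (∀ l < k, rowBead lam l = rowBead mu l) → rowBead lam k ≤ rowBead mu k := by
        intro lam mu h ih
        have h1 : rowBead lam k ∈ beta mu := h ▸ mem_beta.2 ⟨k, rfl⟩
        obtain ⟨l, hl⟩ := mem_beta.1 h1
        rcases lt_or_ge l k with h2 | h2
        · rw [← ih l h2, rowBead_inj] at hl; omega
        · rw [← hl]; exact (rowBead_strictAnti mu).antitone h2
      exact le_antisymm (aux h ih) (aux h.symm fun l hl => (ih l hl).symm)
  refine young_ext fun k => ?_
  have := key k
  unfold rowBead at this; omega

theorem beta_bot : beta ⊥ = vac := by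
  have h : ∀ k, (⊥ : YoungDiagram).rowLen k = 0 := by
    intro k
    by_contra h
    have h1 : (k, 0) ∈ (⊥ : YoungDiagram) := YoungDiagram.mem_iff_lt_rowLen.2 (Nat.pos_of_ne_zero h)
    simp at h1
  ext x
  rw [mem_beta]
  unfold rowBead
  simp only [h]
  change _ ↔ x < 0
  constructor
  · rintro ⟨k, rfl⟩; omega
  · intro hx; exact ⟨(-x - 1).toNat, by omega⟩

theorem exists_young (f : ℕ → ℕ) (hf : Antitone f) (N : ℕ) (hN : f N = 0) :
    ∃ mu : YoungDiagram, ∀ k, mu.rowLen k = f k := by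
  let mu : YoungDiagram :=
    { cells := (Finset.range N ×ˢ Finset.range (f 0)).filter fun p => p.2 < f p.1
      isLowerSet := by
        rintro ⟨a, b⟩ ⟨c, d⟩ ⟨h1, h2⟩ h3
        simp only [Finset.coe_filter, Finset.mem_product, Finset.mem_range, Set.mem_ofPred_eq]
          at h1 h2 h3 ⊢
        have := hf h1
        omega }
  refine ⟨mu, fun k => ?_⟩
  have key : ∀ j, j < mu.rowLen k ↔ j < f k := by
    intro j
    rw [← YoungDiagram.mem_iff_lt_rowLen, ← YoungDiagram.mem_cells]
    simp only [mu, Finset.mem_filter, Finset.mem_product, Finset.mem_range]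
    refine ⟨fun h => h.2, fun h => ⟨⟨?_, ?_⟩, h⟩⟩
    · by_contra hc
      have := hf (not_lt.1 hc)
      omega
    · have := hf (Nat.zero_le k)
      omega
  have h1 := key (mu.rowLen k)
  have h2 := key (f k)
  omega

theorem moved_iff_insert {e : ℕ} {i x : ℤ} {X Y : Set ℤ} (h1 : i + e * x ∈ X)
    (h2 : i + e * x - 1 ∉ X) : Moved e i x X Y ↔ Y = insert (i + e * x - 1) (X \ {i + e * x}) := by
  have key : Moved e i x X (insert (i + e * x - 1) (X \ {i + e * x})) := by
    intro z
    rw [show i - 1 + e * x = i + e * x - 1 by ring]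
    generalize i + e * x = y at *
    by_cases h3 : z = y - 1
    · rw [if_pos h3, if_neg (by omega), ind_mem (by simp [h3]), ind_notMem (h3 ▸ h2)]; rfl
    · by_cases h4 : z = y
      · rw [if_neg h3, if_pos h4, ind_notMem (by simp [h4]; omega), ind_mem (h4 ▸ h1)]; rfl
      · rw [if_neg h3, if_neg h4]
        rcases ind_cases X z with ⟨h5, h6⟩ | ⟨h5, h6⟩
        · rw [h6, ind_mem (by simp [h3, h4, h5])]; rfl
        · rw [h6, ind_notMem (by simp [h3, h5])]; rfl
  constructor
  · intro h
    exact ind_ext fun z => by rw [h, key]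
  · rintro rfl; exact key

theorem beta_update {lam mu : YoungDiagram} {k : ℕ} (h1 : mu.rowLen k + 1 = lam.rowLen k)
    (h2 : ∀ l, l ≠ k → mu.rowLen l = lam.rowLen l) :
    beta mu = insert (rowBead lam k - 1) (beta lam \ {rowBead lam k}) := by
  have e1 : rowBead mu k = rowBead lam k - 1 := by unfold rowBead; omega
  have e2 : ∀ l, l ≠ k → rowBead mu l = rowBead lam l := by
    intro l hl; unfold rowBead; rw [h2 l hl]
  ext x
  simp only [Set.mem_insert_iff, Set.mem_sdiff, Set.mem_singleton_iff, mem_beta]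
  constructor
  · rintro ⟨l, rfl⟩
    by_cases hl : l = k
    · subst hl; exact Or.inl e1
    · rw [e2 l hl, rowBead_inj]; exact Or.inr ⟨⟨l, rfl⟩, hl⟩
  · rintro (rfl | ⟨⟨l, rfl⟩, hx⟩)
    · exact ⟨k, e1⟩
    · exact ⟨l, e2 l fun h => hx (h ▸ rfl)⟩

theorem exists_remove {lam : YoungDiagram} {x : ℤ} (h1 : x ∈ beta lam) (h2 : x - 1 ∉ beta lam) :
    ∃ mu, beta mu = insert (x - 1) (beta lam \ {x}) ∧ mu.card < lam.card := by
  obtain ⟨k, rfl⟩ := mem_beta.1 h1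
  have h3 : lam.rowLen (k + 1) < lam.rowLen k := by
    by_contra hc
    have := lam.rowLen_anti k (k + 1) (Nat.le_succ k)
    apply h2
    refine mem_beta.2 ⟨k + 1, ?_⟩
    unfold rowBead; push_cast; omega
  obtain ⟨N, hN⟩ := rowLen_eq_zero lam
  let f := Function.update lam.rowLen k (lam.rowLen k - 1)
  have hf1 : f k = lam.rowLen k - 1 := Function.update_self ..
  have hf2 : ∀ l, l ≠ k → f l = lam.rowLen l := fun l hl => Function.update_of_ne hl ..
  obtain ⟨mu, hmu⟩ := exists_young f (antitone_nat_of_succ_le fun l => by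
    have := lam.rowLen_anti l (l + 1) (Nat.le_succ l)
    by_cases a : l = k
    · subst a; rw [hf1, hf2 _ (by omega)]; omega
    · rw [hf2 _ a]
      by_cases b : l + 1 = k
      · subst b; rw [hf1]; omega
      · rw [hf2 _ b]; omega) (max N (k + 1)) (by
    rw [hf2 _ (by omega)]; exact hN _ (by omega))
  refine ⟨mu, beta_update (by rw [hmu, hf1]; omega) fun l hl => by rw [hmu, hf2 l hl], ?_⟩
  refine Finset.card_lt_card ⟨?_, fun hc => ?_⟩
  · rintro ⟨a, b⟩ hab
    have hab' := YoungDiagram.mem_iff_lt_rowLen.1 ((YoungDiagram.mem_cells _).1 hab)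
    refine (YoungDiagram.mem_cells _).2 (YoungDiagram.mem_iff_lt_rowLen.2 ?_)
    rw [hmu] at hab'
    by_cases c : a = k
    · subst c; rw [hf1] at hab'; omega
    · rwa [hf2 a c] at hab'
  · have h4 : (k, lam.rowLen k - 1) ∈ lam := YoungDiagram.mem_iff_lt_rowLen.2 (by omega)
    have h5 := YoungDiagram.mem_iff_lt_rowLen.1 ((YoungDiagram.mem_cells _).1
      (hc ((YoungDiagram.mem_cells _).2 h4)))
    rw [hmu, hf1] at h5; omega

theorem exists_add {mu : YoungDiagram} {x : ℤ} (h1 : x - 1 ∈ beta mu) (h2 : x ∉ beta mu) :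
    ∃ lam, beta mu = insert (x - 1) (beta lam \ {x}) ∧ x ∈ beta lam ∧ x - 1 ∉ beta lam := by
  obtain ⟨k, hk⟩ := mem_beta.1 h1
  have h3 : ∀ l, l + 1 = k → mu.rowLen k < mu.rowLen l := by
    rintro l rfl
    by_contra hc
    have := mu.rowLen_anti l (l + 1) (Nat.le_succ l)
    apply h2
    refine mem_beta.2 ⟨l, ?_⟩
    unfold rowBead at hk ⊢; push_cast at hk; omega
  obtain ⟨N, hN⟩ := rowLen_eq_zero mu
  let f := Function.update mu.rowLen k (mu.rowLen k + 1)
  have hf1 : f k = mu.rowLen k + 1 := Function.update_self ..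
  have hf2 : ∀ l, l ≠ k → f l = mu.rowLen l := fun l hl => Function.update_of_ne hl ..
  obtain ⟨lam, hlam⟩ := exists_young f (antitone_nat_of_succ_le fun l => by
    have := mu.rowLen_anti l (l + 1) (Nat.le_succ l)
    by_cases a : l = k
    · subst a; rw [hf1, hf2 _ (by omega)]; omega
    · rw [hf2 _ a]
      by_cases b : l + 1 = k
      · have := h3 l b; subst b; rw [hf1]; omega
      · rw [hf2 _ b]; omega) (max N (k + 1)) (by
    rw [hf2 _ (by omega)]; exact hN _ (by omega))
  have e1 : rowBead lam k = x := by
    unfold rowBead at hk ⊢; rw [hlam, hf1]; push_cast; omega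
  refine ⟨lam, ?_, mem_beta.2 ⟨k, e1⟩, fun hc => ?_⟩
  · have := beta_update (lam := lam) (mu := mu) (k := k) (by rw [hlam, hf1])
      fun l hl => by rw [hlam, hf2 l hl]
    rwa [e1] at this
  · obtain ⟨l, hl⟩ := mem_beta.1 hc
    by_cases a : l = k
    · subst a; omega
    · have : rowBead mu l = rowBead lam l := by unfold rowBead; rw [hlam, hf2 l a]
      rw [← this, ← hk, rowBead_inj] at hl
      exact a hl

/-! ### Normal beads in terms of walks -/

theorem ncard_residue_step {e : ℕ} (he : 0 < e) (i x y : ℤ) (hxy : x ≤ y) (p : ℤ → Prop)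
    [DecidablePred p] :
    {t : ℤ | i + e * x < t ∧ t ≤ i + e * (y + 1) ∧ t ≡ i + e * x [ZMOD e] ∧ p t}.ncard =
      {t : ℤ | i + e * x < t ∧ t ≤ i + e * y ∧ t ≡ i + e * x [ZMOD e] ∧ p t}.ncard +
        if p (i + e * (y + 1)) then 1 else 0 := by
  have he' : (0 : ℤ) < e := by exact_mod_cast he
  have hmul : (e : ℤ) * (y + 1) = e * y + e := by ring
  have hle : (e : ℤ) * x ≤ e * y := mul_le_mul_of_nonneg_left hxy he'.le
  have key : ∀ t : ℤ, i + e * y < t → t ≤ i + e * (y + 1) → t ≡ i + e * x [ZMOD e] →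
      t = i + e * (y + 1) := by
    intro t h1 h2 h3
    obtain ⟨k, hk⟩ := h3.dvd
    obtain rfl : t = i + e * (x - k) := by linarith
    have h4 : y < x - k := by
      by_contra hc
      have := mul_le_mul_of_nonneg_left (not_lt.1 hc) he'.le
      omega
    have h5 : x - k ≤ y + 1 := by
      by_contra hc
      have : y + 1 + 1 ≤ x - k := by omega
      have := mul_le_mul_of_nonneg_left this he'.le
      have h6 : (e : ℤ) * (y + 1 + 1) = e * y + e + e := by ring
      omega
    rw [show x - k = y + 1 by omega]
  split_ifs with hp
  · have : {t : ℤ | i + e * x < t ∧ t ≤ i + e * (y + 1) ∧ t ≡ i + e * x [ZMOD e] ∧ p t} =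
        insert (i + e * (y + 1))
          {t : ℤ | i + e * x < t ∧ t ≤ i + e * y ∧ t ≡ i + e * x [ZMOD e] ∧ p t} := by
      ext t
      simp only [Set.mem_ofPred_eq, Set.mem_insert_iff]
      constructor
      · rintro ⟨h1, h2, h3, h4⟩
        rcases le_or_gt t (i + e * y) with h5 | h5
        · exact Or.inr ⟨h1, h5, h3, h4⟩
        · exact Or.inl (key t h5 h2 h3)
      · rintro (rfl | ⟨h1, h2, h3, h4⟩)
        · refine ⟨by omega, le_rfl, ?_, hp⟩
          exact (Int.modEq_iff_dvd.2 ⟨x - (y + 1), by ring⟩)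
        · exact ⟨h1, by omega, h3, h4⟩
    rw [this, Set.ncard_insert_of_notMem (by simp only [Set.mem_ofPred_eq]; omega)
      ((Set.finite_Ioc (i + e * x) (i + e * y)).subset fun t ht => ⟨ht.1, ht.2.1⟩)]
  · rw [add_zero]
    congr 1
    ext t
    simp only [Set.mem_ofPred_eq]
    constructor
    · rintro ⟨h1, h2, h3, h4⟩
      refine ⟨h1, ?_, h3, h4⟩
      by_contra h5
      exact hp (key t (by omega) h2 h3 ▸ h4)
    · rintro ⟨h1, h2, h3, h4⟩
      exact ⟨h1, by omega, h3, h4⟩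

-- Passing one level, the walk rises at a removable bead, falls at an addable position and is
-- otherwise constant.
open Classical in
theorem W_sub_eq_count {e : ℕ} (he : 2 ≤ e) {X : Set ℤ} (hX : IsMaya X) (i x y : ℤ) (hxy : x ≤ y) :
    W e X i (y + 1) - W e X i (x + 1) =
      ({t : ℤ | i + e * x < t ∧ t ≤ i + e * y ∧ t ≡ i + e * x [ZMOD e] ∧ t ∈ X ∧ t - 1 ∉ X}.ncard : ℤ) -
      ({t : ℤ | i + e * x < t ∧ t ≤ i + e * y ∧ t ≡ i + e * x [ZMOD e] ∧ t ∉ X ∧ t - 1 ∈ X}.ncard : ℤ) := by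
  induction y, hxy using Int.leInduction with
  | base =>
    have : ∀ p : ℤ → Prop, {t : ℤ | i + e * x < t ∧ t ≤ i + e * x ∧ t ≡ i + e * x [ZMOD e] ∧ p t} = ∅ := by
      intro p
      ext t
      simp only [Set.mem_ofPred_eq, Set.mem_empty_iff_false, iff_false]
      omega
    rw [this fun t => t ∈ X ∧ t - 1 ∉ X, this fun t => t ∉ X ∧ t - 1 ∈ X]
    simp
  | succ y hy ih =>
    rw [ncard_residue_step (by omega) i x y hy fun t => t ∈ X ∧ t - 1 ∉ X,
      ncard_residue_step (by omega) i x y hy fun t => t ∉ X ∧ t - 1 ∈ X]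
    have h1 : W e X i (y + 1 + 1) = _ := walk_succ (hX.rn (by omega) _) (hX.rn (by omega) _) (y + 1)
    change _ = W e X i (y + 1) + _ - _ at h1
    rw [h1, ind_rn, ind_rn, show i - 1 + e * (y + 1) = i + e * (y + 1) - 1 by ring]
    rcases ind_cases X (i + e * (y + 1)) with ⟨h3, h4⟩ | ⟨h3, h4⟩ <;>
      rcases ind_cases X (i + e * (y + 1) - 1) with ⟨h5, h6⟩ | ⟨h5, h6⟩ <;>
      simp only [h3, h4, h5, h6, not_true_eq_false, not_false_eq_true, and_self, and_true, and_false,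
        if_true, if_false] <;> push_cast <;> omega

/-- A removable bead contributes the first rise, and the counting condition says that the walk never
falls below the value reached after it. -/
theorem isNormal_iff {e : ℕ} (he : 2 ≤ e) {lam : YoungDiagram} (i x : ℤ) :
    IsNormal e lam (i + e * x) ↔ ∀ u, x < u → W e (beta lam) i x < W e (beta lam) i u := by
  have he' : (2 : ℤ) ≤ e := by exact_mod_cast he
  have hX := beta_isMaya lam
  have h1 : W e (beta lam) i (x + 1) = _ :=
    walk_succ (hX.rn (by omega) (i - 1)) (hX.rn (by omega) i) x
  change _ = W e (beta lam) i x + _ - _ at h1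
  rw [ind_rn, ind_rn, show i - 1 + e * x = i + e * x - 1 by ring] at h1
  constructor
  · rintro ⟨⟨h2, h3⟩, h4⟩ u hu
    rw [ind_mem h2, ind_notMem h3] at h1
    obtain ⟨y, rfl⟩ : ∃ y, u = y + 1 := ⟨u - 1, by ring⟩
    have h5 := W_sub_eq_count he hX i x y (by omega)
    rcases (show x ≤ y by omega).eq_or_lt with rfl | hxy
    · omega
    · have h6 := h4 (i + e * y) (by nlinarith) (Int.modEq_iff_dvd.2 ⟨x - y, by ring⟩)
      omega
  · intro h
    have h2 := h (x + 1) (by omega)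
    refine ⟨?_, fun y' hy' hmod => ?_⟩
    · rcases ind_cases (beta lam) (i + e * x) with ⟨h3, h4⟩ | ⟨h3, h4⟩ <;>
        rcases ind_cases (beta lam) (i + e * x - 1) with ⟨h5, h6⟩ | ⟨h5, h6⟩ <;>
        first | omega | exact ⟨h3, h5⟩
    · obtain ⟨k, hk⟩ := hmod.dvd
      obtain rfl : y' = i + e * (x - k) := by linarith
      have hlt : x < x - k := by
        by_contra hc
        have := mul_le_mul_of_nonneg_left (not_lt.1 hc) (by omega : (0 : ℤ) ≤ e)
        omega
      have h3 := W_sub_eq_count he hX i x (x - k) hlt.le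
      have h4 := h (x - k + 1) (by omega)
      have h5 := W_step_le he hX i x
      omega

/-- Normal positions are those after which the walk stays strictly higher. The last minimum is one
of them, and none comes earlier, since the walk would later return to its minimum. -/
theorem crystalArrow_iff {e : ℕ} (he : 2 ≤ e) {i : ℤ} {mu lam : YoungDiagram} :
    CrystalArrow e i mu lam ↔ E e i (beta lam) (beta mu) := by
  have he' : (2 : ℤ) ≤ e := by exact_mod_cast he
  have hX := beta_isMaya lam
  constructor
  · rintro ⟨x', hx, h1, h2, h3⟩
    obtain ⟨k, hk⟩ := hx.dvd
    obtain ⟨x, rfl⟩ : ∃ x, x' = i + e * x := ⟨-k, by linarith⟩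
    have h4 := (isNormal_iff he i x).1 h1
    refine ⟨x, ⟨fun t => ?_, h4⟩, (moved_iff_insert h1.1.1 h1.1.2).2 h3⟩
    obtain ⟨l, hl, hlast⟩ := exists_last (P := fun t => W e (beta lam) i t = mW e (beta lam) i) x
      (fun z hz => by
        by_contra hc
        have := h4 z (by omega)
        have := mW_le he hX i x
        omega) (exists_W_eq_mW he hX i)
    have hn : IsNormal e lam (i + e * l) := by
      rw [isNormal_iff he]
      intro u hu
      have := mW_le he hX i u
      have := hlast u
      omega
    have h5 := h2 (i + e * l) (Int.modEq_iff_dvd.2 ⟨-l, by ring⟩) hn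
    have h6 : x ≤ l := by
      by_contra hc
      have : l + 1 ≤ x := by omega
      have := mul_le_mul_of_nonneg_left this (by omega : (0 : ℤ) ≤ e)
      have h7 : (e : ℤ) * (l + 1) = e * l + e := by ring
      omega
    rcases h6.eq_or_lt with rfl | h6
    · rw [hl]; exact mW_le he hX i t
    · have := h4 l h6
      have := mW_le he hX i x
      omega
  · rintro ⟨x, h1, h2⟩
    have hn := (isNormal_iff he i x).2 h1.2
    refine ⟨i + e * x, Int.modEq_iff_dvd.2 ⟨-x, by ring⟩, hn, fun y hy hn' => ?_,
      (moved_iff_insert hn.1.1 hn.1.2).1 h2⟩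
    obtain ⟨k, hk⟩ := hy.dvd
    obtain ⟨l, rfl⟩ : ∃ x, y = i + e * x := ⟨-k, by linarith⟩
    have h3 := (isNormal_iff he i l).1 hn'
    have h4 : x ≤ l := by
      by_contra hc
      have := h3 x (by omega)
      have := h1.1 l
      omega
    have := mul_le_mul_of_nonneg_left h4 (by omega : (0 : ℤ) ≤ e)
    omega

theorem E.exists_beta {e : ℕ} (he : 2 ≤ e) {i : ℤ} {lam : YoungDiagram} {Y : Set ℤ}
    (h : E e i (beta lam) Y) : ∃ mu, Y = beta mu ∧ mu.card < lam.card := by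
  obtain ⟨x, h1, h2⟩ := h
  have hn := (isNormal_iff he i x).2 h1.2
  obtain ⟨mu, hmu, hc⟩ := exists_remove hn.1.1 hn.1.2
  exact ⟨mu, by rw [(moved_iff_insert hn.1.1 hn.1.2).1 h2, hmu], hc⟩

theorem E.exists_beta_back {e : ℕ} (he : 2 ≤ e) {i : ℤ} {mu : YoungDiagram} {X : Set ℤ}
    (h : E e i X (beta mu)) : ∃ lam, X = beta lam := by
  have hX := h.isMaya.2 (beta_isMaya mu)
  obtain ⟨x, h1, h2⟩ := h
  have h3 := LastMin.mem (hX.rn (by omega) _) (hX.rn (by omega) _) h1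
  have e1 := h2 (i + e * x)
  have e2 := h2 (i - 1 + e * x)
  rw [if_neg (by omega), if_pos rfl, ind_mem (A := X) (show i + e * x ∈ X from h3.1)] at e1
  rw [if_pos rfl, if_neg (by omega),
    ind_notMem (A := X) (show i - 1 + e * x ∉ X from h3.2)] at e2
  have e3 : i + e * x ∉ beta mu := ind_eq_zero.1 (by omega)
  have e4 : i + e * x - 1 ∈ beta mu := by
    rw [show i + e * x - 1 = i - 1 + e * x by ring]; exact ind_eq_one.1 (by omega)
  obtain ⟨lam, a, b, c⟩ := exists_add e4 e3
  refine ⟨lam, ind_ext fun z => ?_⟩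
  have := (moved_iff_insert b c).2 a z
  have := h2 z
  omega

theorem MullineuxKleshchev.toMK {e : ℕ} (he : 2 ≤ e) {lam mu : YoungDiagram}
    (h : MullineuxKleshchev e lam mu) : ∃ n, MK e n (beta lam) (beta mu) := by
  induction h with
  | empty => exact ⟨0, by rw [beta_bot]; exact .vac⟩
  | step i _ h1 h2 ih =>
    obtain ⟨n, hn⟩ := ih
    exact ⟨n + 1, .step i hn ((crystalArrow_iff he).1 h1) ((crystalArrow_iff he).1 h2)⟩

theorem MK.toMullineuxKleshchev {e n : ℕ} (he : 2 ≤ e) {lam : YoungDiagram} {Y : Set ℤ}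
    (h : MK e n (beta lam) Y) : ∃ mu, Y = beta mu ∧ MullineuxKleshchev e lam mu := by
  induction n generalizing lam Y with
  | zero =>
    generalize hX : beta lam = X at h
    cases h
    rw [← beta_bot] at hX ⊢
    obtain rfl := beta_injective hX
    exact ⟨⊥, rfl, .empty⟩
  | succ n ih =>
    generalize hX : beta lam = X at h
    cases h with
    | step i h h1 h2 =>
      subst hX
      obtain ⟨lam', rfl, -⟩ := h1.exists_beta he
      obtain ⟨mu', rfl, hmu'⟩ := ih h
      obtain ⟨mu, rfl⟩ := h2.exists_beta_back he
      exact ⟨mu, rfl, .step i hmu' ((crystalArrow_iff he).2 h1) ((crystalArrow_iff he).2 h2)⟩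

/-! ### Regular diagrams -/

/-- A set of beads is `e`-regular if no gap is followed by `e` beads. -/
def Reg (e : ℕ) (X : Set ℤ) : Prop := ∀ g, g ∉ X → ∃ k, 1 ≤ k ∧ k ≤ (e : ℤ) ∧ g + k ∉ X

/-- Consecutive beads are equal parts. The parts of a run preceded by a gap are nonzero, because the
beads of zero parts have no gap before them. -/
theorem IsRegular.reg {e : ℕ} {lam : YoungDiagram} (he : 2 ≤ e) (h : IsRegular e lam) :
    Reg e (beta lam) := by
  intro g hg
  by_contra hc
  push Not at hc
  apply h
  obtain ⟨i, hi⟩ := mem_beta.1 (hc e (by omega) le_rfl)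
  have key : ∀ j : ℕ, j < e → rowBead lam (i + j) = g + e - j := by
    intro j
    induction j with
    | zero => intro _; simpa using hi
    | succ j ih =>
      intro hj
      have h1 := ih (by omega)
      obtain ⟨l, hl⟩ := mem_beta.1 (hc (e - (j + 1)) (by omega) (by omega))
      have h2 : i + j < l := by
        by_contra hc
        have := (rowBead_strictAnti lam).antitone (not_lt.1 hc)
        omega
      have h3 := (rowBead_strictAnti lam).antitone (show i + j + 1 ≤ l by omega)
      have h4 := rowBead_lt (lam := lam) (show i + j < i + j + 1 by omega)
      rw [← add_assoc]; push_cast; omega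
  refine ⟨i, fun h0 => ?_, fun j hj => ?_⟩
  · apply hg
    have h1 := lam.rowLen_anti i (i + e) (by omega)
    refine mem_beta.2 ⟨i + e, ?_⟩
    unfold rowBead at hi ⊢
    push_cast; omega
  · have h1 := key j hj
    unfold rowBead at h1 hi
    push_cast at h1; omega

/-- By regularity the final block of beads has length less than `e`. Its first bead is normal: the
only addable position after it lies just behind the block, too close to have the same residue. -/
theorem Reg.exists_E {e : ℕ} (he : 2 ≤ e) {lam : YoungDiagram} (h : Reg e (beta lam))
    (hne : lam ≠ ⊥) : ∃ i Y, E e i (beta lam) Y := by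
  have hX := beta_isMaya lam
  have hgap : ∃ g, g ∉ beta lam ∧ g < rowBead lam 0 := by
    by_contra hc
    push Not at hc
    apply hne
    apply beta_injective
    obtain ⟨N, hN⟩ := rowLen_eq_zero lam
    have h0 : rowBead lam N ≤ rowBead lam 0 := (rowBead_strictAnti lam).antitone (Nat.zero_le _)
    have key : ∀ k, rowBead lam k = rowBead lam 0 - k := by
      intro k
      induction k with
      | zero => simp
      | succ k ih =>
        have h1 : rowBead lam 0 - (k + 1) ∈ beta lam := by
          by_contra h1
          have := hc _ h1
          omega
        obtain ⟨l, hl⟩ := mem_beta.1 h1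
        have h2 : k < l := by
          by_contra hc
          have := (rowBead_strictAnti lam).antitone (not_lt.1 hc)
          omega
        have h3 := (rowBead_strictAnti lam).antitone (show k + 1 ≤ l by omega)
        have h4 := rowBead_lt (lam := lam) (show k < k + 1 by omega)
        push_cast; omega
    have h1 := key N
    have h2 : rowBead lam N = -(N + 1) := by unfold rowBead; rw [hN N le_rfl]; push_cast; ring
    congr 1
    refine young_ext fun k => ?_
    have h3 := key k
    have h4 : (⊥ : YoungDiagram).rowLen k = 0 := by
      by_contra h
      have h1 : (k, 0) ∈ (⊥ : YoungDiagram) :=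
        YoungDiagram.mem_iff_lt_rowLen.2 (Nat.pos_of_ne_zero h)
      simp at h1
    unfold rowBead at h1 h2 h3
    omega
  obtain ⟨g, ⟨hg, hg'⟩, hlast⟩ := exists_last (P := fun g => g ∉ beta lam ∧ g < rowBead lam 0)
    (rowBead lam 0) (fun z hz => hz.2.le) hgap
  have hbeads : ∀ z, g < z → z ≤ rowBead lam 0 → z ∈ beta lam := by
    intro z h1 h2
    rcases h2.eq_or_lt with rfl | h2
    · exact mem_beta.2 ⟨0, rfl⟩
    · by_contra hc
      have := hlast z ⟨hc, h2⟩
      omega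
  have habove : ∀ z, rowBead lam 0 < z → z ∉ beta lam := by
    intro z hz hz'
    obtain ⟨k, rfl⟩ := mem_beta.1 hz'
    have := (rowBead_strictAnti lam).antitone (Nat.zero_le k)
    omega
  obtain ⟨k, hk1, hk2, hk⟩ := h g hg
  have hk3 : rowBead lam 0 < g + k := by
    by_contra hc
    exact hk (hbeads _ (by omega) (by omega))
  have hn : IsNormal e lam (g + 1) := by
    refine ⟨⟨hbeads _ (by omega) (by omega), by rwa [add_sub_cancel_right]⟩, fun y hy _ => ?_⟩
    have : {t : ℤ | g + 1 < t ∧ t ≤ y ∧ t ≡ g + 1 [ZMOD e] ∧ t ∉ beta lam ∧ t - 1 ∈ beta lam} = ∅ := by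
      ext t
      simp only [Set.mem_ofPred_eq, Set.mem_empty_iff_false, iff_false]
      rintro ⟨h1, -, h3, h4, h5⟩
      have h6 : rowBead lam 0 < t := by
        by_contra hc
        exact h4 (hbeads _ (by omega) (by omega))
      have h7 : t - 1 ≤ rowBead lam 0 := by
        by_contra hc
        exact habove _ (by omega) h5
      have h8 : (e : ℤ) ∣ t - (g + 1) := h3.symm.dvd
      exact not_dvd_of_pos_lt (sub_pos.2 h1) (by omega) h8
    rw [this]; simp
  have hn' : ∀ u, 0 < u → W e (beta lam) (g + 1) 0 < W e (beta lam) (g + 1) u :=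
    (isNormal_iff he (g + 1) 0).1 (by simpa using hn)
  have hlt : mW e (beta lam) (g + 1) < ch (rn e (beta lam) (g + 1)) -
      ch (rn e (beta lam) (g + 1 - 1)) := by
    obtain ⟨N, hN⟩ := walk_right (hX.rn (e := e) (by omega) (g + 1 - 1))
      (hX.rn (e := e) (by omega) (g + 1))
    rw [← hN (max N 1) (le_max_left _ _)]
    exact lt_of_le_of_lt (mW_le he hX _ 0) (hn' _ (by omega))
  obtain ⟨Y, hY⟩ := Abacus.exists_E he hX hlt
  exact ⟨_, Y, hY⟩

/-- A forbidden run in `Y` would either give one in `X` shifted by one, or end exactly at the new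
position of the moved bead. -/
theorem Reg.of_E {e : ℕ} (he : 2 ≤ e) {i : ℤ} {X Y : Set ℤ} (hX : IsMaya X) (h : Reg e X)
    (hE : E e i X Y) : Reg e Y := by
  obtain ⟨x, h1, h2⟩ := hE
  have h3 := LastMin.mem (hX.rn (by omega) _) (hX.rn (by omega) _) h1
  have hb : i + e * x ∈ X := h3.1
  have hg : i - 1 + e * x ∉ X := h3.2
  have key : ∀ z, z ≠ i - 1 + e * x → z ∈ Y → z ∈ X := by
    intro z hz hzY
    have := h2 z
    rw [if_neg hz, ind_mem hzY] at this
    rcases ind_cases X z with ⟨h, _⟩ | ⟨_, h'⟩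
    · exact h
    · split_ifs at this <;> omega
  have key' : ∀ z, z ≠ i + e * x → z ∉ Y → z ∉ X := by
    intro z hz hzY hzX
    have := h2 z
    rw [if_neg hz, ind_notMem hzY, ind_mem hzX] at this
    split_ifs at this <;> omega
  have hxY : i + e * x ∉ Y := by
    intro hc
    have := h2 (i + e * x)
    rw [if_neg (by omega), if_pos rfl, ind_mem hc, ind_mem hb] at this
    omega
  intro g hgY
  by_contra hc
  push Not at hc
  by_cases c1 : g = i + e * x
  · obtain ⟨k, hk1, hk2, hk3⟩ := h _ hg
    apply hk3
    rcases hk1.eq_or_lt with rfl | hk1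
    · rwa [show i - 1 + e * x + 1 = i + e * x by ring]
    · refine key _ (by omega) ?_
      rw [show i - 1 + e * x + k = g + (k - 1) by omega]
      exact hc (k - 1) (by omega) (by omega)
  · have hgX := key' g c1 hgY
    obtain ⟨k, hk1, hk2, hk3⟩ := h g hgX
    have c2 : g + k = i - 1 + e * x := by
      by_contra c2
      exact hk3 (key _ c2 (hc k hk1 hk2))
    have c3 : k = e := by
      by_contra c3
      have := hc (k + 1) (by omega) (by omega)
      rw [show g + (k + 1) = i + e * x by omega] at this
      exact hxY this
    subst c3
    -- In the remaining case the walk rises from `x - 1` to `x`, so its value at `x` is not minimal.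
    have hg1 : i - 1 + e * (x - 1) ∉ X := by
      rwa [show i - 1 + e * (x - 1) = g by linarith]
    have hb1 : i + e * (x - 1) ∈ X := by
      rw [show i + e * (x - 1) = g + 1 by linarith]
      exact key _ (by omega) (hc 1 le_rfl (by omega))
    have h4 : W e X i (x - 1 + 1) = _ :=
      walk_succ (hX.rn (by omega) (i - 1)) (hX.rn (by omega) i) (x - 1)
    change _ = W e X i (x - 1) + _ - _ at h4
    rw [ind_rn, ind_rn, ind_mem hb1, ind_notMem hg1, sub_add_cancel] at h4
    have := h1.1 (x - 1)
    omega

theorem Reg.exists_MK {e : ℕ} (he : 2 ≤ e) {lam : YoungDiagram} (h : Reg e (beta lam)) :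
    ∃ n Y, MK e n (beta lam) Y := by
  induction hc : lam.card using Nat.strong_induction_on generalizing lam with
  | _ c ih =>
    by_cases hne : lam = ⊥
    · subst hne; exact ⟨0, vac, by rw [beta_bot]; exact .vac⟩
    · obtain ⟨i, Y, hY⟩ := h.exists_E he hne
      have hr := h.of_E he (beta_isMaya lam) hY
      obtain ⟨mu, rfl, hmu⟩ := hY.exists_beta he
      obtain ⟨n, Z, hZ⟩ := ih _ (hc ▸ hmu) hr rfl
      rcases he.eq_or_lt with rfl | he
      · obtain rfl := hZ.eq_of_two
        refine ⟨n + 1, beta lam, .step i hZ hY ?_⟩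
        rwa [show -i = i + (2 : ℕ) * (-i) by push_cast; ring, E_shift]
      · obtain ⟨Z', -, hZ'⟩ := hZ.up he hY
        exact ⟨n + 1, Z', hZ'⟩

/-! ### Movements on a pair of adjacent runners -/

/-- The number of bead movements on a runner starting at level `t`. -/
noncomputable def mult (A : Set ℤ) (t : ℤ) : ℤ := min (gp A t) (bd A t)

theorem mult_nonneg (A : Set ℤ) (t : ℤ) : 0 ≤ mult A t := le_min (gp_nonneg A t) (bd_nonneg A t)

theorem mult_pos_iff {A : Set ℤ} {t : ℤ} : 0 < mult A t ↔ 0 < gp A t ∧ 0 < bd A t := lt_min_iff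

/-- The second runner has no ascent at the starting levels of the first one. -/
def NoAscent (A B : Set ℤ) : Prop := ∀ t, 0 < mult A t → ind B t ≤ ind B (t - 1)

open Classical in
/-- The number of movements on the first runner starting at `t`, if the second runner has a descent
there. -/
noncomputable def dropMult (A B : Set ℤ) (t : ℤ) : ℤ :=
  if t - 1 ∈ B ∧ t ∉ B then mult A t else 0

theorem gp_pos_of_notMem {A : Set ℤ} (hA : IsMaya A) {u t : ℤ} (h : u ∉ A) (hu : u < t) :
    0 < gp A t := (gp_pos_iff hA t).2 ⟨u, hu, h⟩

theorem bd_pos_of_mem {A : Set ℤ} (hA : IsMaya A) {u t : ℤ} (h : u ∈ A) (hu : t ≤ u) :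
    0 < bd A t := (bd_pos_iff hA t).2 ⟨u, hu, h⟩

/-- Between the first gap and the last bead of `A` every level is a start, so there `B` consists of
beads followed by gaps and has at most one descent. -/
theorem NoAscent.anti {A B : Set ℤ} (hA : IsMaya A) (h : NoAscent A B) {s t : ℤ} (hst : s ≤ t)
    (hs : 0 < gp A (s + 1)) (ht : 0 < bd A t) : ind B t ≤ ind B s := by
  induction t, hst using Int.leInduction with
  | base => exact le_rfl
  | succ t hst ih =>
    have h1 := bd_anti hA (show t ≤ t + 1 by omega)
    have h2 := gp_mono hA (show s + 1 ≤ t + 1 by omega)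
    have h3 := h (t + 1) (mult_pos_iff.2 ⟨by omega, ht⟩)
    rw [add_sub_cancel_right] at h3
    have := ih (by omega)
    omega

theorem walk_eq_bd {A B : Set ℤ} (hA : IsMaya A) (hB : IsMaya B) (t : ℤ) :
    walk A B t = bd A t - bd B t + (ch B - ch A) := by
  have h1 := bd_sub_gp hA t
  have h2 := bd_sub_gp hB t
  unfold walk; omega

theorem gp_eq_of_beads {B : Set ℤ} (hB : IsMaya B) {s t : ℤ} (hst : s ≤ t)
    (h : ∀ u, s ≤ u → u < t → u ∈ B) : gp B t = gp B s := by
  induction t, hst using Int.leInduction with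
  | base => rfl
  | succ t hst ih =>
    rw [gp_succ hB, ind_mem (h t hst (by omega)), ih fun u h1 h2 => h u h1 (by omega)]; ring

theorem bd_eq_of_gaps {B : Set ℤ} (hB : IsMaya B) {s t : ℤ} (hst : s ≤ t)
    (h : ∀ u, s ≤ u → u < t → u ∉ B) : bd B t = bd B s := by
  induction t, hst using Int.leInduction with
  | base => rfl
  | succ t hst ih =>
    rw [bd_succ hB, ind_notMem (h t hst (by omega)), ih fun u h1 h2 => h u h1 (by omega)]; ring

/-- The first gap of a Maya diagram. -/
theorem IsMaya.exists_first_gap {A : Set ℤ} (hA : IsMaya A) :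
    ∃ v, v ∉ A ∧ gp A v = 0 := by
  obtain ⟨N, hN⟩ := hA.1
  obtain ⟨M, hM⟩ := hA.2
  obtain ⟨v, h1, h2⟩ := exists_first (P := fun v => v ∉ A) N
    (fun z hz => by by_contra hc; exact hz (hN z (by omega))) ⟨M, hM M le_rfl⟩
  refine ⟨v, h1, gp_eq_zero fun u hu => ?_⟩
  by_contra hc
  have := h2 u hc
  omega

/-- The last bead of a Maya diagram. -/
theorem IsMaya.exists_last_bead {A : Set ℤ} (hA : IsMaya A) :
    ∃ v, v ∈ A ∧ bd A (v + 1) = 0 := by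
  obtain ⟨N, hN⟩ := hA.1
  obtain ⟨M, hM⟩ := hA.2
  obtain ⟨v, h1, h2⟩ := exists_last (P := fun v => v ∈ A) M
    (fun z hz => by by_contra hc; exact hM z (by omega) hz) ⟨N - 1, hN _ (by omega)⟩
  refine ⟨v, h1, bd_eq_zero fun u hu hc => ?_⟩
  have := h2 u hc
  omega

/-! ### A single crystal step preserves the absence of ascents and the multiplicity at the descent.
-/

section Step

variable {A B A' B' : Set ℤ} {x : ℤ}

/-- The pair `(A', B')` arises from `(A, B)` by moving the bead at level `x` from `B` to `A`, where
`x` is the last minimum of the walk. -/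
structure PairStep (A B A' B' : Set ℤ) (x : ℤ) : Prop where
  maya₁ : IsMaya A
  maya₂ : IsMaya B
  gp₁ : ∀ t, gp A' t = gp A t - gtInd x t
  bd₁ : ∀ t, bd A' t = bd A t + (1 - gtInd x t)
  bd₂ : ∀ t, bd B' t = bd B t - (1 - gtInd x t)
  ind₂ : ∀ t, ind B' t = ind B t + if t = x then -1 else 0
  min : LastMin (walk A B) x

theorem PairStep.mem_of (h : PairStep A B A' B' x) {t : ℤ} (ht : t ≠ x) : t ∈ B' ↔ t ∈ B := by
  have := h.ind₂ t
  rw [if_neg ht, add_zero] at this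
  rw [← ind_eq_one, ← ind_eq_one, this]

theorem PairStep.notMem (h : PairStep A B A' B' x) : x ∉ B' := by
  have := h.ind₂ x
  rw [if_pos rfl, ind_mem (LastMin.mem h.maya₁ h.maya₂ h.min).1] at this
  rw [← ind_eq_zero, this]; rfl

theorem walk_lt_of_beads (hA : IsMaya A) (hB : IsMaya B) {v t : ℤ} (hv : v ∉ A) (hvt : v < t)
    (h : ∀ u, v ≤ u → u < t → u ∈ B) : walk A B v < walk A B t := by
  unfold walk
  have h1 := gp_eq_of_beads hB hvt.le h
  have h2 := gp_succ hA v
  rw [ind_notMem hv] at h2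
  have h3 := gp_mono hA (show v + 1 ≤ t by omega)
  omega

theorem walk_le_of_bd_eq_zero (hA : IsMaya A) (hB : IsMaya B) {s t : ℤ} (h : bd A s = 0)
    (hst : s ≤ t) : walk A B s ≤ walk A B t := by
  rw [walk_eq_bd hA hB, walk_eq_bd hA hB]
  have h1 := bd_anti hB hst
  have h2 := bd_nonneg A t
  omega

/-- A new ascent at `x + 1` would have an earlier gap of `A` facing a block of beads of `B` that
reaches `x`, where the walk would be lower. An old ascent could become relevant only beyond the last
bead of `A`; but then the walk rises there and never falls again, so its minimum is not at `x`. -/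
theorem PairStep.noAscent (h : PairStep A B A' B' x) (hC : NoAscent A B) : NoAscent A' B' := by
  obtain ⟨hA, hB⟩ := And.intro h.maya₁ h.maya₂
  obtain ⟨hxB, hxA⟩ := LastMin.mem hA hB h.min
  intro t ht
  obtain ⟨ht1, ht2⟩ := mult_pos_iff.1 ht
  rw [h.gp₁] at ht1
  rw [h.bd₁] at ht2
  by_contra hc
  rcases ind_cases B' t with ⟨h1, h1'⟩ | ⟨h1, h1'⟩ <;>
  rcases ind_cases B' (t - 1) with ⟨h2, h2'⟩ | ⟨h2, h2'⟩ <;> try omega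
  have htx : t ≠ x := by rintro rfl; exact h.notMem h1
  rw [h.mem_of htx] at h1
  by_cases ht1x : t - 1 = x
  · obtain rfl : t = x + 1 := by omega
    rw [gtInd_of_lt (by omega)] at ht1 ht2
    rw [gp_succ hA, ind_notMem hxA] at ht1
    obtain ⟨v, hv, hv'⟩ := (gp_pos_iff hA x).1 (by omega)
    have h3 := h.min.1 v
    have h4 := walk_lt_of_beads hA hB hv' hv fun u h4 h5 => by
      have := hC.anti hA (s := u) (t := x + 1) (by omega)
        (gp_pos_of_notMem hA hv' (by omega)) (by omega)
      rw [ind_mem h1] at this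
      rcases ind_cases B u with ⟨h6, _⟩ | ⟨_, h6⟩
      · exact h6
      · omega
    omega
  · rw [h.mem_of ht1x] at h2
    rcases (bd_nonneg A t).eq_or_lt with h3 | h3
    · rcases gtInd_cases x t with ⟨h4, h4'⟩ | ⟨h4, h4'⟩
      · omega
      · have h5 := h.min.1 t
        have h6 := walk_succ hA hB t
        have h7 : t ∉ A := fun hc => by have := bd_pos_of_mem hA hc le_rfl; omega
        rw [ind_notMem h7, ind_mem h1] at h6
        have h8 := bd_succ hA t
        rw [ind_notMem h7] at h8
        have h9 := walk_le_of_bd_eq_zero hA hB (s := t + 1) (t := x) (by omega) (by omega)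
        omega
    · have h4 : 0 < gp A t := by
        rcases gtInd_cases x t with ⟨_, h4⟩ | ⟨_, h4⟩ <;> omega
      have h5 := hC t (mult_pos_iff.2 ⟨h4, h3⟩)
      rw [ind_mem h1, ind_notMem h2] at h5
      omega

/-- For `t = x`, the missing ascents in `B'` force gaps of `B` up to the last bead of `A`, so the
walk comes back down after `x`. For `t ≠ x`, the level `t` stopped being a start, so `x` was the
only gap of `A` before `t`, and the gap of `B` at `t - 1` makes the walk too small at `t`. -/
theorem PairStep.noAscent_back (h : PairStep A B A' B' x) (hA' : IsMaya A')
    (hC : NoAscent A' B') : NoAscent A B := by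
  obtain ⟨hA, hB⟩ := And.intro h.maya₁ h.maya₂
  obtain ⟨hxB, hxA⟩ := LastMin.mem hA hB h.min
  intro t ht
  obtain ⟨ht1, ht2⟩ := mult_pos_iff.1 ht
  by_contra hc
  rcases ind_cases B t with ⟨h1, h1'⟩ | ⟨h1, h1'⟩ <;>
  rcases ind_cases B (t - 1) with ⟨h2, h2'⟩ | ⟨h2, h2'⟩ <;> try omega
  have h3 : t - 1 ∉ B' := by
    rw [h.mem_of]
    · exact h2
    · rintro h4; exact h2 (h4 ▸ hxB)
  by_cases htx : t = x
  · subst htx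
    obtain ⟨v, hv, hv'⟩ := hA.exists_last_bead
    have hvt : t < v + 1 := by
      by_contra hc
      have := bd_anti hA (show v + 1 ≤ t by omega)
      omega
    have h4 := bd_succ hA t
    rw [ind_notMem hxA] at h4
    have h5 : bd B (v + 1) = bd B (t + 1) := bd_eq_of_gaps hB (by omega) fun u h5 h6 => by
      have h7 := hC.anti hA' (s := t - 1) (t := u) (by omega)
        (by rw [h.gp₁, sub_add_cancel, gtInd_of_le le_rfl]; omega)
        (by rw [h.bd₁, gtInd_of_lt (by omega)]
            have := bd_pos_of_mem hA hv (t := u) (by omega); omega)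
      rw [ind_notMem h3] at h7
      rw [← h.mem_of (by omega)]
      rcases ind_cases B' u with ⟨_, h8⟩ | ⟨h8, _⟩
      · omega
      · exact h8
    have h6 := h.min.2 (v + 1) hvt
    have h7 := walk_succ hA hB t
    rw [ind_notMem hxA, ind_mem h1] at h7
    have h8 := walk_eq_bd hA hB (v + 1)
    have h9 := walk_eq_bd hA hB (t + 1)
    omega
  · rw [← h.mem_of htx] at h1
    have h4 : ¬ 0 < mult A' t := fun h4 => by
      have := hC t h4
      rw [ind_mem h1, ind_notMem h3] at this
      omega
    rw [mult_pos_iff, h.gp₁, h.bd₁] at h4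
    rcases gtInd_cases x t with ⟨h5, h5'⟩ | ⟨h5, h5'⟩
    · have hx1 : x ≠ t - 1 := by rintro rfl; exact h2 hxB
      have h6 := gp_succ hA x
      rw [ind_notMem hxA] at h6
      have h7 := gp_mono hA (show x + 1 ≤ t - 1 by omega)
      have h8 := gp_mono hA (show t - 1 ≤ t by omega)
      have h9 := gp_nonneg A x
      have h10 := gp_mono (A := B) hB (show x + 1 ≤ t - 1 by omega)
      have h11 := gp_succ hB (t - 1)
      rw [ind_notMem h2, sub_add_cancel] at h11
      have h12 := gp_succ hB x
      rw [ind_mem hxB] at h12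
      have h13 := h.min.2 t h5
      unfold walk at h13
      omega
    · omega

/-- Around a descent `B` has beads from the first gap of `A` to `t`, and gaps from `t` to the last
bead of `A`. If `x < t`, minimality gives more gaps than beads of `A`, and the step removes a
surplus gap; if `t ≤ x`, there are at least as many beads as gaps, and the step adds a surplus bead.
The minimum of the two numbers stays. -/
theorem PairStep.dropMult_eq (h : PairStep A B A' B' x) (hC : NoAscent A B) (t : ℤ) :
    dropMult A' B' t = dropMult A B t := by
  obtain ⟨hA, hB⟩ := And.intro h.maya₁ h.maya₂
  obtain ⟨hxB, hxA⟩ := LastMin.mem hA hB h.min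
  have fwd : t - 1 ∈ B → t ∉ B → 0 < mult A t →
      t - 1 ∈ B' ∧ t ∉ B' ∧ mult A' t = mult A t := by
    intro h1 h2 h3
    obtain ⟨h4, h5⟩ := mult_pos_iff.1 h3
    have htx : t ≠ x := by rintro rfl; exact h2 hxB
    obtain ⟨v, hv, hv0⟩ := hA.exists_first_gap
    obtain ⟨z, hz, hz0⟩ := hA.exists_last_bead
    have hvt : v < t := by
      by_contra hc
      have := gp_mono hA (show t ≤ v by omega)
      omega
    have hzt : t ≤ z := by
      by_contra hc
      have := bd_anti hA (show z + 1 ≤ t by omega)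
      omega
    have hlow : ∀ u, v ≤ u → u < t → u ∈ B := fun u h6 h7 => by
      have := hC.anti hA (s := u) (t := t - 1) (by omega)
        (gp_pos_of_notMem hA hv (by omega)) (bd_pos_of_mem hA hz (by omega))
      rw [ind_mem h1] at this
      rcases ind_cases B u with ⟨h6, _⟩ | ⟨_, h6⟩
      · exact h6
      · omega
    have hhigh : ∀ u, t ≤ u → u < z + 1 → u ∉ B := fun u h6 h7 => by
      have := hC.anti hA (s := t) (t := u) h6
        (gp_pos_of_notMem hA hv (by omega)) (bd_pos_of_mem hA hz (by omega))
      rw [ind_notMem h2] at this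
      rcases ind_cases B u with ⟨_, h6⟩ | ⟨h6, _⟩
      · omega
      · exact h6
    have hgB := gp_eq_of_beads hB hvt.le hlow
    have hbB := bd_eq_of_gaps hB (by omega) hhigh
    have w1 : walk A B t = walk A B v + gp A t := by unfold walk; omega
    have w2 := walk_eq_bd hA hB t
    have w3 := walk_eq_bd hA hB (z + 1)
    have w4 := h.min.1 v
    rcases lt_or_ge x t with h6 | h6
    · have hvx : v ≤ x := by
        by_contra hc
        have := gp_pos_of_notMem hA hxA (show x < v by omega)
        omega
      have w5 : walk A B x = walk A B v + gp A x := by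
        unfold walk
        have := gp_eq_of_beads hB hvx fun u h7 h8 => hlow u h7 (by omega)
        omega
      have w6 := h.min.2 (z + 1) (by omega)
      have w7 := gp_nonneg A x
      have h7 : t - 1 ≠ x := by
        intro h7
        obtain rfl : t = x + 1 := by omega
        have := gp_succ hA x
        rw [ind_notMem hxA] at this
        omega
      refine ⟨(h.mem_of h7).2 h1, fun hc => h2 ((h.mem_of htx).1 hc), ?_⟩
      unfold mult
      rw [h.gp₁, h.bd₁, gtInd_of_lt h6, min_eq_right (by omega), min_eq_right (by omega)]
      ring
    · have h8 : z + 1 ≤ x := by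
        by_contra hc
        exact hhigh x h6 (by omega) hxB
      have w5 := walk_le_of_bd_eq_zero hA hB hz0 h8
      refine ⟨(h.mem_of (by omega)).2 h1, fun hc => h2 ((h.mem_of htx).1 hc), ?_⟩
      unfold mult
      rw [h.gp₁, h.bd₁, gtInd_of_le h6, min_eq_left (by omega), min_eq_left (by omega)]
      ring
  have bwd : t - 1 ∈ B' → t ∉ B' → 0 < mult A' t → t - 1 ∈ B ∧ t ∉ B ∧ 0 < mult A t := by
    intro h1 h2 h3
    rw [mult_pos_iff, h.gp₁, h.bd₁] at h3
    obtain ⟨h4, h5⟩ := h3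
    have h6 : t - 1 ≠ x := by rintro rfl; exact h.notMem h1
    rw [h.mem_of h6] at h1
    have h7 : 0 < gp A t := by
      rcases gtInd_cases x t with ⟨_, h7⟩ | ⟨_, h7⟩ <;> omega
    have key : t ≤ x → walk A B t ≤ walk A B x → False := by
      intro h8 h9
      rcases (bd_nonneg A (t - 1)).eq_or_lt with h10 | h10
      · have h11 : t - 1 ∉ A := fun hc => by have := bd_pos_of_mem hA hc le_rfl; omega
        have h12 := walk_succ hA hB (t - 1)
        rw [ind_notMem h11, ind_mem h1, sub_add_cancel] at h12
        have := h.min.1 (t - 1)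
        omega
      · obtain ⟨v, hv, hv'⟩ := (gp_pos_iff hA t).1 h7
        have h11 := walk_lt_of_beads hA hB hv' hv fun u h6 h7 => by
          have := hC.anti hA (s := u) (t := t - 1) (by omega)
            (gp_pos_of_notMem hA hv' (by omega)) h10
          rw [ind_mem h1] at this
          rcases ind_cases B u with ⟨h6, _⟩ | ⟨_, h6⟩
          · exact h6
          · omega
        have := h.min.1 v
        omega
    have htx : t ≠ x := by rintro rfl; exact key le_rfl le_rfl
    refine ⟨h1, fun hc => h2 ((h.mem_of htx).2 hc), mult_pos_iff.2 ⟨h7, ?_⟩⟩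
    by_contra h8
    have h9 := bd_nonneg A t
    rcases gtInd_cases x t with ⟨h10, h10'⟩ | ⟨h10, h10'⟩
    · omega
    · exact key h10 (walk_le_of_bd_eq_zero hA hB (by omega) h10)
  have n1 := mult_nonneg A t
  have n2 := mult_nonneg A' t
  unfold dropMult
  by_cases h1 : t - 1 ∈ B ∧ t ∉ B
  · rw [if_pos h1]
    rcases n1.eq_or_lt with h2 | h2
    · rw [← h2]
      split_ifs with h3
      · by_contra h4
        have := (bwd h3.1 h3.2 (by omega)).2.2
        omega
      · rfl
    · obtain ⟨h3, h4, h5⟩ := fwd h1.1 h1.2 h2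
      rw [if_pos ⟨h3, h4⟩, h5]
  · rw [if_neg h1]
    split_ifs with h3
    · by_contra h4
      have := bwd h3.1 h3.2 (by omega)
      exact h1 ⟨this.1, this.2.1⟩
    · rfl

end Step

theorem mult_eq {A : Set ℤ} (hA : IsMaya A) (t : ℤ) : mult A t = bd A t - max (ch A - t) 0 := by
  have := bd_sub_gp hA t
  unfold mult
  rcases le_total (gp A t) (bd A t) with h | h
  · rw [min_eq_left h, max_eq_left (by omega)]; omega
  · rw [min_eq_right h, max_eq_right (by omega)]; omega

theorem E.pairStep {e : ℕ} (he : 2 ≤ e) {i : ℤ} {X Y : Set ℤ} (hX : IsMaya X) (h : E e i X Y) :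
    ∃ x, PairStep (rn e X (i - 1)) (rn e X i) (rn e Y (i - 1)) (rn e Y i) x := by
  obtain ⟨x, h1, h2⟩ := h
  obtain ⟨a1, a2, -⟩ := lower_counts he hX h2
  obtain ⟨-, b2, -⟩ := upper_counts he hX h2
  exact ⟨x, hX.rn (by omega) _, hX.rn (by omega) _, a1, a2, b2, ind_rn_upper he h2, h1⟩

/-! ### Arm lengths and weighted counts of movements -/

theorem sum_window_succ (f : ℤ → ℤ) (a : ℤ) (n : ℕ) :
    ∑ j ∈ Finset.range n, f (a + 1 + j) = ∑ j ∈ Finset.range n, f (a + j) + f (a + n) - f a := by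
  induction n with
  | zero => simp
  | succ n ih =>
    rw [Finset.sum_range_succ, Finset.sum_range_succ, ih]
    push_cast
    rw [show a + 1 + (n : ℤ) = a + (n + 1) by ring]; ring

theorem sum_window_ite (a c : ℤ) (n : ℕ) :
    ∑ j ∈ Finset.range n, (if a + j = c then (1 : ℤ) else 0) =
      if a ≤ c ∧ c < a + n then 1 else 0 := by
  induction n with
  | zero => rw [Finset.sum_range_zero, if_neg (by push_cast; omega)]
  | succ n ih =>
    rw [Finset.sum_range_succ, ih]
    push_cast
    split_ifs <;> omega

/-- The number of gaps in `(q - e, q]`. -/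
noncomputable def arm (e : ℕ) (X : Set ℤ) (q : ℤ) : ℤ :=
  ∑ j ∈ Finset.range e, (1 - ind X (q - e + 1 + j))

theorem arm_pred (e : ℕ) (X : Set ℤ) (q : ℤ) :
    arm e X (q - 1) = arm e X q + ind X q - ind X (q - e) := by
  have := sum_window_succ (fun z => 1 - ind X z) (q - e) e
  unfold arm
  rw [show q - 1 - (e : ℤ) + 1 = q - e by ring]
  rw [sub_add_cancel] at this
  linarith

theorem arm_nonneg (e : ℕ) (X : Set ℤ) (q : ℤ) : 0 ≤ arm e X q :=
  Finset.sum_nonneg fun j _ => by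
    rcases ind_cases X (q - e + 1 + j) with ⟨_, h⟩ | ⟨_, h⟩ <;> omega

theorem arm_le (e : ℕ) (X : Set ℤ) (q : ℤ) : arm e X q ≤ e := by
  have : arm e X q ≤ ∑ _j ∈ Finset.range e, (1 : ℤ) :=
    Finset.sum_le_sum fun j _ => by
      rcases ind_cases X (q - e + 1 + j) with ⟨_, h⟩ | ⟨_, h⟩ <;> omega
  simpa using this

/-- The window `(q - e, q]` contains both the old and the new position of the bead, or neither,
unless one of its ends separates them; that requires `q` to lie on runner `i - 1`. -/
theorem Moved.arm_eq {e : ℕ} {i x : ℤ} {X Y : Set ℤ} (h : Moved e i x X Y) {q : ℤ}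
    (hq : ¬ (e : ℤ) ∣ q - (i - 1)) : arm e Y q = arm e X q := by
  have key : arm e Y q = arm e X q -
      ∑ j ∈ Finset.range e, (if q - e + 1 + j = i - 1 + e * x then (1 : ℤ) else 0) +
      ∑ j ∈ Finset.range e, (if q - e + 1 + j = i + e * x then (1 : ℤ) else 0) := by
    unfold arm
    rw [← Finset.sum_sub_distrib, ← Finset.sum_add_distrib]
    exact Finset.sum_congr rfl fun j _ => by rw [h]; ring
  rw [key, sum_window_ite, sum_window_ite]
  have h1 : q ≠ i - 1 + e * x := fun h1 => hq ⟨x, by rw [h1]; ring⟩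
  have h2 : q - e ≠ i - 1 + e * x := fun h1 => hq ⟨x + 1, by linarith⟩
  split_ifs <;> omega

/-- The number of movements starting at `q`. -/
noncomputable def mu (e : ℕ) (X : Set ℤ) (q : ℤ) : ℤ := mult (rn e X q) 0

theorem mu_level (e : ℕ) (X : Set ℤ) (r t : ℤ) : mu e X (r + e * t) = mult (rn e X r) t := by
  unfold mu mult
  rw [gp_shift, bd_shift, zero_add]

theorem mu_self (e : ℕ) (X : Set ℤ) (r : ℤ) : mu e X r = mult (rn e X r) 0 := rfl

theorem mu_nonneg (e : ℕ) (X : Set ℤ) (q : ℤ) : 0 ≤ mu e X q := mult_nonneg _ _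

theorem mu_finite {e : ℕ} (he : 0 < e) {X : Set ℤ} (hX : IsMaya X) :
    (Function.support (mu e X)).Finite := by
  have he' : (0 : ℤ) < e := by exact_mod_cast he
  obtain ⟨N, hN⟩ := hX.1
  obtain ⟨M, hM⟩ := hX.2
  refine (Set.finite_Icc N M).subset fun q hq => ?_
  have h1 : 0 < mu e X q := lt_of_le_of_ne (mu_nonneg e X q) (Ne.symm hq)
  obtain ⟨h2, h3⟩ := mult_pos_iff.1 h1
  obtain ⟨u, hu, hu'⟩ := (gp_pos_iff (hX.rn he q) 0).1 h2
  obtain ⟨v, hv, hv'⟩ := (bd_pos_iff (hX.rn he q) 0).1 h3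
  constructor
  · by_contra hc
    exact hu' (hN _ (by nlinarith))
  · by_contra hc
    exact hM (q + e * v) (by nlinarith) hv'

/-- The sum of `f (arm q)` over all movements, `q` being the start of the movement. -/
noncomputable def wsum (e : ℕ) (f : ℤ → ℤ) (X : Set ℤ) : ℤ := ∑ᶠ q, mu e X q * f (arm e X q)

open Classical in
theorem finsum_split {e : ℕ} (he : 2 ≤ e) (i : ℤ) {h : ℤ → ℤ} (hf : (Function.support h).Finite) :
    ∑ᶠ q, h q = (∑ᶠ q, if (e : ℤ) ∣ q - i ∨ (e : ℤ) ∣ q - (i - 1) then 0 else h q) +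
      ∑ᶠ t : ℤ, (h (i - 1 + e * t) + h (i + e * t)) := by
  have he' : (2 : ℤ) ≤ e := by exact_mod_cast he
  have inj : ∀ a : ℤ, Function.Injective fun t : ℤ => a + e * t := fun a s t hst => by
    have h1 : (e : ℤ) * s = e * t := by simpa using hst
    exact mul_left_cancel₀ (by omega) h1
  have hfin : ∀ a : ℤ, (Function.support fun t : ℤ => h (a + e * t)).Finite := fun a =>
    hf.preimage (f := fun t : ℤ => a + e * t) ((inj a).injOn)
  have hrange : ∀ a : ℤ, ∑ᶠ t : ℤ, h (a + e * t) = ∑ᶠ q, if (e : ℤ) ∣ q - a then h q else 0 := by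
    intro a
    rw [← finsum_mem_range (f := h) (inj a), finsum_mem_def]
    refine finsum_congr fun q => ?_
    have : (q ∈ Set.range fun t : ℤ => a + e * t) ↔ (e : ℤ) ∣ q - a := by
      constructor
      · rintro ⟨t, rfl⟩; exact ⟨t, by ring⟩
      · rintro ⟨t, ht⟩; exact ⟨t, by simp only; omega⟩
    by_cases hd : (e : ℤ) ∣ q - a
    · rw [Set.indicator_of_mem (this.2 hd), if_pos hd]
    · rw [Set.indicator_of_notMem fun hc => hd (this.1 hc), if_neg hd]
  have hsub : ∀ (p : ℤ → Prop) [DecidablePred p], (Function.support fun q => if p q then h q else 0).Finite := fun p _ =>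
    hf.subset fun q hq => by
      simp only [Function.mem_support] at hq ⊢
      intro hc; apply hq; simp [hc]
  have hsub' : (Function.support fun q => if (e : ℤ) ∣ q - i ∨ (e : ℤ) ∣ q - (i - 1) then 0
      else h q).Finite :=
    hf.subset fun q hq => by
      simp only [Function.mem_support] at hq ⊢
      intro hc; apply hq; simp [hc]
  have hp := hsub fun q => (e : ℤ) ∣ q - (i - 1)
  have hq := hsub fun q => (e : ℤ) ∣ q - i
  rw [finsum_add_distrib (hfin _) (hfin _), hrange, hrange, ← finsum_add_distrib hp hq,
    ← finsum_add_distrib hsub' ((hp.union hq).subset (Function.support_add _ _))]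
  refine finsum_congr fun q => ?_
  by_cases h1 : (e : ℤ) ∣ q - i <;> by_cases h2 : (e : ℤ) ∣ q - (i - 1)
  · exfalso
    have := dvd_sub h2 h1
    rw [show q - (i - 1) - (q - i) = 1 by ring] at this
    exact not_dvd_of_pos_lt one_pos (by omega) this
  all_goals simp [h1, h2]

theorem wsum_split {e : ℕ} (he : 2 ≤ e) (i : ℤ) (f : ℤ → ℤ) {X : Set ℤ} (hX : IsMaya X) :
    wsum e f X = (∑ᶠ q, open Classical in if (e : ℤ) ∣ q - i ∨ (e : ℤ) ∣ q - (i - 1) then 0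
        else mu e X q * f (arm e X q)) +
      ∑ᶠ t : ℤ, (mult (rn e X (i - 1)) t * f (arm e X (i - 1 + e * t)) +
        mult (rn e X i) t * f (arm e X (i + e * t))) := by
  unfold wsum
  rw [finsum_split he i ((mu_finite (e := e) (by omega) hX).subset fun q hq => by
    simp only [Function.mem_support] at hq ⊢
    intro hc; apply hq; rw [hc, zero_mul])]
  simp only [mu_level]

/-- Arm lengths increase along the starting positions. -/
def Inc (e : ℕ) (X : Set ℤ) : Prop :=
  ∀ q q', q < q' → 0 < mu e X q → 0 < mu e X q' → arm e X q ≤ arm e X q'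

theorem arm_lower (e : ℕ) (X : Set ℤ) (i t : ℤ) :
    arm e X (i - 1 + e * t) = arm e X (i + e * t) + ind (rn e X i) t - ind (rn e X i) (t - 1) := by
  have := arm_pred e X (i + e * t)
  rw [ind_rn, ind_rn, show i - 1 + e * t = i + e * t - 1 by ring, this,
    show i + e * (t - 1) = i + e * t - e by ring]

/-- At an ascent of runner `i` the position on that runner is itself a start, and its arm length is
one less than that of the start just before it. -/
theorem Inc.noAscent {e : ℕ} (he : 2 ≤ e) {X : Set ℤ} (hX : IsMaya X) (h : Inc e X) (i : ℤ) :
    NoAscent (rn e X (i - 1)) (rn e X i) := by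
  have hB := hX.rn (e := e) (by omega) i
  intro t ht
  rcases ind_cases (rn e X i) t with ⟨h1, h1'⟩ | ⟨h1, h1'⟩ <;>
  rcases ind_cases (rn e X i) (t - 1) with ⟨h2, h2'⟩ | ⟨h2, h2'⟩ <;> try omega
  have h3 : 0 < mult (rn e X i) t := mult_pos_iff.2
    ⟨gp_pos_of_notMem hB h2 (by omega), bd_pos_of_mem hB h1 le_rfl⟩
  have h4 := h (i - 1 + e * t) (i + e * t) (by omega) (by rwa [mu_level]) (by rwa [mu_level])
  rw [arm_lower] at h4
  omega

/-- Two abaci which differ by movements between the runners `i - 1` and `i` that respect the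
structure of the starting positions. -/
structure PairRel (e : ℕ) (i : ℤ) (X Y : Set ℤ) : Prop where
  maya : IsMaya X
  maya' : IsMaya Y
  other : ∀ r, ¬ (e : ℤ) ∣ r - i → ¬ (e : ℤ) ∣ r - (i - 1) → rn e Y r = rn e X r
  arm_eq : ∀ q, ¬ (e : ℤ) ∣ q - (i - 1) → arm e Y q = arm e X q
  bd_eq : ∀ t, bd (rn e Y (i - 1)) t + bd (rn e Y i) t = bd (rn e X (i - 1)) t + bd (rn e X i) t
  noAscent : NoAscent (rn e X (i - 1)) (rn e X i) ↔ NoAscent (rn e Y (i - 1)) (rn e Y i)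
  drop : NoAscent (rn e X (i - 1)) (rn e X i) →
    ∀ t, dropMult (rn e Y (i - 1)) (rn e Y i) t = dropMult (rn e X (i - 1)) (rn e X i) t

theorem PairRel.refl {e : ℕ} {i : ℤ} {X : Set ℤ} (hX : IsMaya X) : PairRel e i X X :=
  ⟨hX, hX, fun _ _ _ => rfl, fun _ _ => rfl, fun _ => rfl, Iff.rfl, fun _ _ => rfl⟩

theorem PairRel.symm {e : ℕ} {i : ℤ} {X Y : Set ℤ} (h : PairRel e i X Y) : PairRel e i Y X :=
  ⟨h.maya', h.maya, fun r a b => (h.other r a b).symm, fun q a => (h.arm_eq q a).symm,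
    fun t => (h.bd_eq t).symm, h.noAscent.symm, fun a t => (h.drop (h.noAscent.2 a) t).symm⟩

theorem PairRel.trans {e : ℕ} {i : ℤ} {X Y Z : Set ℤ} (h : PairRel e i X Y)
    (h' : PairRel e i Y Z) : PairRel e i X Z :=
  ⟨h.maya, h'.maya', fun r a b => (h'.other r a b).trans (h.other r a b),
    fun q a => (h'.arm_eq q a).trans (h.arm_eq q a), fun t => (h'.bd_eq t).trans (h.bd_eq t),
    h.noAscent.trans h'.noAscent,
    fun a t => (h'.drop (h.noAscent.1 a) t).trans (h.drop a t)⟩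

theorem E.pairRel {e : ℕ} (he : 2 ≤ e) {i : ℤ} {X Y : Set ℤ} (hX : IsMaya X) (h : E e i X Y) :
    PairRel e i X Y := by
  obtain ⟨x, hs⟩ := h.pairStep he hX
  have hY := h.isMaya.1 hX
  refine ⟨hX, hY, ?_, ?_, fun t => ?_, ⟨hs.noAscent, hs.noAscent_back (hY.rn (by omega) _)⟩,
    hs.dropMult_eq⟩
  · obtain ⟨x, -, hm⟩ := h
    exact fun r a b => rn_other hm a b
  · obtain ⟨x, -, hm⟩ := h
    exact fun q a => hm.arm_eq a
  · rw [hs.bd₁, hs.bd₂]; ring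

/-- The starting positions of level `t`: value and multiplicity. -/
theorem level_sum {e : ℕ} {i : ℤ} {X : Set ℤ}
    (h : NoAscent (rn e X (i - 1)) (rn e X i)) (f : ℤ → ℤ) (t : ℤ) :
    mult (rn e X (i - 1)) t * f (arm e X (i - 1 + e * t)) +
        mult (rn e X i) t * f (arm e X (i + e * t)) =
      (mult (rn e X (i - 1)) t + mult (rn e X i) t) * f (arm e X (i + e * t)) +
      dropMult (rn e X (i - 1)) (rn e X i) t *
        (f (arm e X (i + e * t) - 1) - f (arm e X (i + e * t))) := by
  rw [arm_lower]
  unfold dropMult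
  have hn := mult_nonneg (rn e X (i - 1)) t
  have h1 := h t
  rcases ind_cases (rn e X i) t with ⟨h2, h2'⟩ | ⟨h2, h2'⟩ <;>
  rcases ind_cases (rn e X i) (t - 1) with ⟨h3, h3'⟩ | ⟨h3, h3'⟩
  · rw [if_neg fun hc => hc.2 h2, h2', h3']; ring_nf
  · rw [if_neg fun hc => hc.2 h2]
    have : mult (rn e X (i - 1)) t = 0 := by
      by_contra hc
      have := h1 (by omega)
      omega
    rw [this]; ring
  · rw [if_pos ⟨h3, h2⟩, h2', h3', add_zero]; ring
  · rw [if_neg fun hc => h3 hc.1, h2', h3']; ring_nf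

/-- By `level_sum`, the contribution of a level depends only on the arm length on runner `i`, the
total multiplicity and the multiplicity at a descent. -/
theorem PairRel.wsum_eq {e : ℕ} (he : 2 ≤ e) {i : ℤ} {X Y : Set ℤ} (h : PairRel e i X Y)
    (hasc : NoAscent (rn e X (i - 1)) (rn e X i))
    (hN : ∀ t, mult (rn e Y (i - 1)) t + mult (rn e Y i) t =
      mult (rn e X (i - 1)) t + mult (rn e X i) t) (f : ℤ → ℤ) : wsum e f Y = wsum e f X := by
  rw [wsum_split he i f h.maya, wsum_split he i f h.maya']
  congr 1
  · refine finsum_congr fun q => ?_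
    split_ifs with h1
    · rfl
    · rw [not_or] at h1
      rw [h.arm_eq q h1.2, mu_self, mu_self, h.other q h1.1 h1.2]
  · refine finsum_congr fun t => ?_
    have h1 : ¬ (e : ℤ) ∣ i + e * t - (i - 1) := by
      rw [show i + e * t - (i - 1) = 1 + e * t by ring, dvd_add_left (dvd_mul_right (e : ℤ) t)]
      exact not_dvd_of_pos_lt one_pos (by omega)
    rw [level_sum hasc, level_sum (h.noAscent.1 hasc), hN, h.drop hasc,
      h.arm_eq _ h1]

/-- In `mult_eq` the bead counts of the two runners enter through their sum, and the correction
terms depend only on the unordered pair of charges. -/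
theorem PairRel.mult_eq_of_swap {e : ℕ} (he : 2 ≤ e) {i : ℤ} {X Y : Set ℤ} (h : PairRel e i X Y)
    (h1 : ch (rn e Y (i - 1)) = ch (rn e X i)) (h2 : ch (rn e Y i) = ch (rn e X (i - 1))) (t : ℤ) :
    mult (rn e Y (i - 1)) t + mult (rn e Y i) t =
      mult (rn e X (i - 1)) t + mult (rn e X i) t := by
  have a := h.maya.rn (e := e) (by omega)
  have b := h.maya'.rn (e := e) (by omega)
  rw [mult_eq (a _), mult_eq (a _), mult_eq (b _), mult_eq (b _), h1, h2]
  have := h.bd_eq t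
  omega

/-! ### Reflections -/

theorem dvd_shift {e : ℕ} {a t : ℤ} : (e : ℤ) ∣ a + e * t ↔ (e : ℤ) ∣ a :=
  dvd_add_left (dvd_mul_right (e : ℤ) t)

theorem exists_level {e : ℕ} {q i : ℤ} (h : (e : ℤ) ∣ q - i) : ∃ t, q = i + e * t := by
  obtain ⟨t, ht⟩ := h
  exact ⟨t, by omega⟩

theorem PairRel.exists_start {e : ℕ} (he : 2 ≤ e) {i : ℤ} {X Y : Set ℤ} (h : PairRel e i X Y)
    (hasc : NoAscent (rn e X (i - 1)) (rn e X i))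
    (hN : ∀ t, mult (rn e Y (i - 1)) t + mult (rn e Y i) t =
      mult (rn e X (i - 1)) t + mult (rn e X i) t) {t : ℤ} {q : ℤ}
    (hq : q = i - 1 + e * t ∨ q = i + e * t) (hmu : 0 < mu e Y q) :
    ∃ p, (p = i - 1 + e * t ∨ p = i + e * t) ∧ 0 < mu e X p ∧ arm e X p = arm e Y q := by
  have hasc' := h.noAscent.1 hasc
  have h0 := hN t
  have h1 := h.drop hasc t
  have h2 := h.arm_eq (i + e * t) (by
    rw [show i + e * t - (i - 1) = 1 + e * t by ring, dvd_shift]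
    exact not_dvd_of_pos_lt one_pos (by omega))
  have h3 := arm_lower e X i t
  have h4 := arm_lower e Y i t
  have n1 := mult_nonneg (rn e X (i - 1)) t
  have n2 := mult_nonneg (rn e X i) t
  have n3 := mult_nonneg (rn e Y (i - 1)) t
  have n4 := mult_nonneg (rn e Y i) t
  have m1 := mu_level e X (i - 1) t
  have m2 := mu_level e X i t
  have m3 := mu_level e Y (i - 1) t
  have m4 := mu_level e Y i t
  have a1 := hasc t
  have a2 := hasc' t
  have lower : 0 < mult (rn e X (i - 1)) t → arm e X (i - 1 + e * t) = arm e Y q →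
      ∃ p, (p = i - 1 + e * t ∨ p = i + e * t) ∧ 0 < mu e X p ∧ arm e X p = arm e Y q :=
    fun h h' => ⟨_, Or.inl rfl, by rwa [m1], h'⟩
  have upper : 0 < mult (rn e X i) t → arm e X (i + e * t) = arm e Y q →
      ∃ p, (p = i - 1 + e * t ∨ p = i + e * t) ∧ 0 < mu e X p ∧ arm e X p = arm e Y q :=
    fun h h' => ⟨_, Or.inr rfl, by rwa [m2], h'⟩
  unfold dropMult at h1
  by_cases dX : t - 1 ∈ rn e X i ∧ t ∉ rn e X i <;> by_cases dY : t - 1 ∈ rn e Y i ∧ t ∉ rn e Y i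
  · rw [if_pos dX, if_pos dY] at h1
    rw [ind_mem dX.1, ind_notMem dX.2] at h3
    rw [ind_mem dY.1, ind_notMem dY.2] at h4
    rcases hq with rfl | rfl
    · exact lower (by omega) (by omega)
    · exact upper (by omega) (by omega)
  · rw [if_pos dX, if_neg dY] at h1
    have : arm e Y q = arm e X (i + e * t) := by
      rcases hq with rfl | rfl
      · have := a2 (by omega)
        rcases ind_cases (rn e Y i) t with ⟨h5, h5'⟩ | ⟨h5, h5'⟩ <;>
        rcases ind_cases (rn e Y i) (t - 1) with ⟨h6, h6'⟩ | ⟨h6, h6'⟩ <;> try omega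
        exact absurd ⟨h6, h5⟩ dY
      · exact h2
    refine upper ?_ this.symm
    rcases hq with rfl | rfl <;> omega
  · rw [if_neg dX, if_pos dY] at h1
    rw [ind_mem dY.1, ind_notMem dY.2] at h4
    rcases hq with rfl | rfl
    · omega
    · rcases n2.eq_or_lt with h5 | h5
      · refine lower (by omega) ?_
        have := a1 (by omega)
        rcases ind_cases (rn e X i) t with ⟨h5, h5'⟩ | ⟨h5, h5'⟩ <;>
        rcases ind_cases (rn e X i) (t - 1) with ⟨h6, h6'⟩ | ⟨h6, h6'⟩ <;> try omega
        exact absurd ⟨h6, h5⟩ dX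
      · exact upper h5 h2.symm
  · have : arm e Y q = arm e X (i + e * t) := by
      rcases hq with rfl | rfl
      · have := a2 (by omega)
        rcases ind_cases (rn e Y i) t with ⟨h5, h5'⟩ | ⟨h5, h5'⟩ <;>
        rcases ind_cases (rn e Y i) (t - 1) with ⟨h6, h6'⟩ | ⟨h6, h6'⟩ <;> try omega
        exact absurd ⟨h6, h5⟩ dY
      · exact h2
    rcases n2.eq_or_lt with h5 | h5
    · have h6 : 0 < mult (rn e X (i - 1)) t := by rcases hq with rfl | rfl <;> omega
      refine lower h6 ?_
      have := a1 (by omega)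
      rcases ind_cases (rn e X i) t with ⟨h5, h5'⟩ | ⟨h5, h5'⟩ <;>
      rcases ind_cases (rn e X i) (t - 1) with ⟨h6, h6'⟩ | ⟨h6, h6'⟩ <;> try omega
      exact absurd ⟨h6, h5⟩ dX
    · exact upper h5 this.symm

/-- Starts correspond level by level with equal arm lengths (`exists_start`), so only the comparison
of two starts of the same level is new, and this is what `NoAscent` says. -/
theorem PairRel.inc {e : ℕ} (he : 2 ≤ e) {i : ℤ} {X Y : Set ℤ} (h : PairRel e i X Y)
    (hN : ∀ t, mult (rn e Y (i - 1)) t + mult (rn e Y i) t =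
      mult (rn e X (i - 1)) t + mult (rn e X i) t) (hI : Inc e X) : Inc e Y := by
  have hasc := hI.noAscent he h.maya i
  have he' : (2 : ℤ) ≤ e := by exact_mod_cast he
  have blocks : ∀ q, (¬ (e : ℤ) ∣ q - i ∧ ¬ (e : ℤ) ∣ q - (i - 1)) ∨
      ∃ t, q = i - 1 + e * t ∨ q = i + e * t := by
    intro q
    by_cases h1 : (e : ℤ) ∣ q - i
    · obtain ⟨t, ht⟩ := exists_level h1; exact Or.inr ⟨t, Or.inr ht⟩
    · by_cases h2 : (e : ℤ) ∣ q - (i - 1)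
      · obtain ⟨t, ht⟩ := exists_level h2; exact Or.inr ⟨t, Or.inl ht⟩
      · exact Or.inl ⟨h1, h2⟩
  have apart : ∀ q t, ¬ (e : ℤ) ∣ q - i → ¬ (e : ℤ) ∣ q - (i - 1) →
      q ≠ i - 1 + e * t ∧ q ≠ i + e * t := fun q t h1 h2 =>
    ⟨fun hc => h2 ⟨t, by omega⟩, fun hc => h1 ⟨t, by omega⟩⟩
  have outside : ∀ q, ¬ (e : ℤ) ∣ q - i → ¬ (e : ℤ) ∣ q - (i - 1) → 0 < mu e Y q →
      0 < mu e X q ∧ arm e X q = arm e Y q := fun q h1 h2 h3 =>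
    ⟨by rwa [mu_self, ← h.other q h1 h2], (h.arm_eq q h2).symm⟩
  intro q q' hqq hq hq'
  rcases blocks q with ⟨h1, h2⟩ | ⟨t, ht⟩ <;> rcases blocks q' with ⟨h1', h2'⟩ | ⟨t', ht'⟩
  · obtain ⟨h3, h4⟩ := outside q h1 h2 hq
    obtain ⟨h3', h4'⟩ := outside q' h1' h2' hq'
    rw [← h4, ← h4']; exact hI q q' hqq h3 h3'
  · obtain ⟨h3, h4⟩ := outside q h1 h2 hq
    obtain ⟨p', hp', h3', h4'⟩ := h.exists_start he hasc hN ht' hq'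
    have := apart q t' h1 h2
    rw [← h4, ← h4']; exact hI q p' (by omega) h3 h3'
  · obtain ⟨h3', h4'⟩ := outside q' h1' h2' hq'
    obtain ⟨p, hp, h3, h4⟩ := h.exists_start he hasc hN ht hq
    have := apart q' t h1' h2'
    rw [← h4, ← h4']; exact hI p q' (by omega) h3 h3'
  · obtain ⟨p, hp, h3, h4⟩ := h.exists_start he hasc hN ht hq
    obtain ⟨p', hp', h3', h4'⟩ := h.exists_start he hasc hN ht' hq'
    rcases lt_trichotomy t t' with h5 | rfl | h5
    · have : (e : ℤ) * (t + 1) ≤ e * t' := mul_le_mul_of_nonneg_left (by omega) (by omega)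
      rw [mul_add] at this
      rw [← h4, ← h4']; exact hI p p' (by omega) h3 h3'
    · obtain rfl : q = i - 1 + e * t := by omega
      obtain rfl : q' = i + e * t := by omega
      rw [mu_level] at hq
      have h6 := h.noAscent.1 hasc t hq
      rw [arm_lower]
      omega
    · have : (e : ℤ) * (t' + 1) ≤ e * t := mul_le_mul_of_nonneg_left (by omega) (by omega)
      rw [mul_add] at this
      omega

/-- Repeated application of a crystal operator. -/
def Eiter (e : ℕ) (i : ℤ) : ℕ → Set ℤ → Set ℤ → Prop
  | 0, X, Y => X = Y
  | d + 1, X, Y => ∃ Z, E e i X Z ∧ Eiter e i d Z Y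

theorem Eiter.snoc {e : ℕ} {i : ℤ} {d : ℕ} {X Y Z : Set ℤ} (h : Eiter e i d X Z) (h' : E e i Z Y) :
    Eiter e i (d + 1) X Y := by
  induction d generalizing X with
  | zero => obtain rfl : X = Z := h; exact ⟨Y, h', rfl⟩
  | succ d ih =>
    obtain ⟨V, h1, h2⟩ := h
    exact ⟨V, h1, ih h2⟩

theorem Eiter.pairRel {e : ℕ} (he : 2 ≤ e) {i : ℤ} {d : ℕ} {X Y : Set ℤ} (hX : IsMaya X)
    (h : Eiter e i d X Y) : PairRel e i X Y := by
  induction d generalizing X with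
  | zero => obtain rfl : X = Y := h; exact .refl hX
  | succ d ih =>
    obtain ⟨Z, h1, h2⟩ := h
    exact (h1.pairRel he hX).trans (ih (h1.isMaya.1 hX) h2)

theorem Eiter.charge {e : ℕ} (he : 2 ≤ e) {i : ℤ} {d : ℕ} {X Y : Set ℤ} (hX : IsMaya X)
    (h : Eiter e i d X Y) (r : ℤ) : ch (rn e Y r) = ch (rn e X r) +
      d * ((if (e : ℤ) ∣ r - (i - 1) then 1 else 0) - if (e : ℤ) ∣ r - i then 1 else 0) := by
  induction d generalizing X with
  | zero => obtain rfl : X = Y := h; simp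
  | succ d ih =>
    obtain ⟨Z, h1, h2⟩ := h
    rw [ih (h1.isMaya.1 hX) h2]
    obtain ⟨x, -, hm⟩ := h1
    rw [ch_moved he hX hm]; push_cast; ring

theorem E.ch_lower {e : ℕ} (he : 2 ≤ e) {i : ℤ} {X Y : Set ℤ} (hX : IsMaya X) (h : E e i X Y) :
    ch (rn e Y (i - 1)) = ch (rn e X (i - 1)) + 1 := by
  obtain ⟨x, -, hm⟩ := h; exact (lower_counts he hX hm).2.2

theorem E.ch_upper {e : ℕ} (he : 2 ≤ e) {i : ℤ} {X Y : Set ℤ} (hX : IsMaya X) (h : E e i X Y) :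
    ch (rn e Y i) = ch (rn e X i) - 1 := by
  obtain ⟨x, -, hm⟩ := h; exact (upper_counts he hX hm).2.2

theorem exists_Eiter {e : ℕ} (he : 2 ≤ e) {i : ℤ} (d : ℕ) {X : Set ℤ} (hX : IsMaya X)
    (h : mW e X i + d ≤ ch (rn e X i) - ch (rn e X (i - 1))) : ∃ Y, Eiter e i d X Y := by
  induction d generalizing X with
  | zero => exact ⟨X, rfl⟩
  | succ d ih =>
    push_cast at h
    obtain ⟨Z, hZ⟩ := exists_E he hX (i := i) (by omega)
    have h1 := hZ.mW_self he hX
    have h2 := hZ.ch_lower he hX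
    have h3 := hZ.ch_upper he hX
    obtain ⟨Y, hY⟩ := ih (hZ.isMaya.1 hX) (by omega)
    exact ⟨Y, Z, hZ, hY⟩

theorem exists_Fiter {e : ℕ} (he : 2 ≤ e) {i : ℤ} (d : ℕ) {Y : Set ℤ} (hY : IsMaya Y)
    (h : mW e Y i + d ≤ 0) : ∃ X, Eiter e i d X Y := by
  induction d generalizing Y with
  | zero => exact ⟨Y, rfl⟩
  | succ d ih =>
    push_cast at h
    obtain ⟨Z, hZ⟩ := exists_F he hY (i := i) (by omega)
    have h0 := hZ.isMaya.2 hY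
    have h1 := hZ.mW_self he h0
    obtain ⟨X, hX⟩ := ih h0 (by omega)
    exact ⟨X, hX.snoc hZ⟩

theorem MK.down_iter {e : ℕ} (he : 3 ≤ e) {i : ℤ} {d n : ℕ} {X Y X' : Set ℤ} (h : MK e n X Y)
    (h' : Eiter e i d X X') : ∃ m Y', Eiter e (-i) d Y Y' ∧ MK e m X' Y' := by
  induction d generalizing n X Y with
  | zero => obtain rfl : X = X' := h'; exact ⟨n, Y, rfl, h⟩
  | succ d ih =>
    obtain ⟨Z, h1, h2⟩ := h'
    obtain ⟨V, h3, m, -, h4⟩ := h.down he h1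
    obtain ⟨k, Y', h5, h6⟩ := ih h4 h2
    exact ⟨k, Y', ⟨V, h3, h5⟩, h6⟩

theorem MK.up_iter {e : ℕ} (he : 3 ≤ e) {i : ℤ} {d n : ℕ} {X Y X' : Set ℤ} (h : MK e n X Y)
    (h' : Eiter e i d X' X) : ∃ m Y', Eiter e (-i) d Y' Y ∧ MK e m X' Y' := by
  induction d generalizing X' with
  | zero => obtain rfl : X' = X := h'; exact ⟨n, Y, rfl, h⟩
  | succ d ih =>
    obtain ⟨Z, h1, h2⟩ := h'
    obtain ⟨m, V, h3, h4⟩ := ih h2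
    obtain ⟨Y', h5, h6⟩ := h4.up he h1
    exact ⟨_, Y', ⟨V, h5, h3⟩, h6⟩

/-- The action of a simple reflection on charges. -/
def sw (e : ℕ) (i : ℤ) (p : ℤ → ℤ) (r : ℤ) : ℤ :=
  if (e : ℤ) ∣ r - (i - 1) then p (r + 1) else if (e : ℤ) ∣ r - i then p (r - 1) else p r

/-- The minimum of the walk is at most 0 and at most its end value, so the operator, or its inverse,
applies at least as often as the charges differ. -/
theorem MK.exists_reflect {e n : ℕ} (he : 3 ≤ e) {X Y : Set ℤ} (h : MK e n X Y) (i : ℤ) :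
    ∃ m X' Y', MK e m X' Y' ∧ PairRel e i X X' ∧ PairRel e (-i) Y Y' ∧
      ∀ r, ch (rn e X' r) = sw e i (fun r => ch (rn e X r)) r := by
  have he2 : 2 ≤ e := by omega
  obtain ⟨hX, hY⟩ := h.isMaya
  have hmX : mW e X i ≤ 0 := walkMin_nonpos (hX.rn (by omega) _) (hX.rn (by omega) _)
  have hmX' : mW e X i ≤ ch (rn e X i) - ch (rn e X (i - 1)) :=
    walkMin_le_charge (hX.rn (by omega) _) (hX.rn (by omega) _)
  have hsw : ∀ X', (∀ r, ch (rn e X' r) = ch (rn e X r) +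
      (ch (rn e X i) - ch (rn e X (i - 1))) * ((if (e : ℤ) ∣ r - (i - 1) then 1 else 0) -
        if (e : ℤ) ∣ r - i then 1 else 0)) →
      ∀ r, ch (rn e X' r) = sw e i (fun r => ch (rn e X r)) r := by
    intro X' h1 r
    rw [h1]
    unfold sw
    beta_reduce
    by_cases h2 : (e : ℤ) ∣ r - (i - 1)
    · rw [if_pos h2, if_pos h2]
      obtain ⟨k, rfl⟩ := exists_level h2
      rw [if_neg (by
        rw [show i - 1 + e * k - i = -1 + e * k by ring, dvd_shift, dvd_neg]
        exact not_dvd_of_pos_lt one_pos (by omega))]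
      rw [show i - 1 + e * k + 1 = i + e * k by ring, ch_shift (e := e) hX (by omega), ch_shift (e := e) hX (by omega)]
      ring
    · rw [if_neg h2, if_neg h2]
      by_cases h3 : (e : ℤ) ∣ r - i
      · rw [if_pos h3, if_pos h3]
        obtain ⟨k, rfl⟩ := exists_level h3
        rw [show i + e * k - 1 = i - 1 + e * k by ring, ch_shift (e := e) hX (by omega),
          ch_shift (e := e) hX (by omega)]
        ring
      · rw [if_neg h3, if_neg h3]; ring
  rcases le_total 0 (ch (rn e X i) - ch (rn e X (i - 1))) with h0 | h0
  · obtain ⟨d, hd⟩ := Int.eq_ofNat_of_zero_le h0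
    obtain ⟨X', hX'⟩ := exists_Eiter he2 d hX (i := i) (by omega)
    obtain ⟨m, Y', h1, h2⟩ := h.down_iter he hX'
    refine ⟨m, X', Y', h2, hX'.pairRel he2 hX, h1.pairRel he2 hY, hsw X' fun r => ?_⟩
    rw [hX'.charge he2 hX, hd]
  · obtain ⟨d, hd⟩ := Int.eq_ofNat_of_zero_le (a := -(ch (rn e X i) - ch (rn e X (i - 1)))) (by omega)
    obtain ⟨X', hX'⟩ := exists_Fiter he2 d hX (i := i) (by omega)
    obtain ⟨m, Y', h1, h2⟩ := h.up_iter he hX'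
    obtain ⟨mX', mY'⟩ := h2.isMaya
    refine ⟨m, X', Y', h2, (hX'.pairRel he2 mX').symm, (h1.pairRel he2 mY').symm,
      hsw X' fun r => ?_⟩
    have := hX'.charge he2 mX' r
    have h3 : ch (rn e X i) - ch (rn e X (i - 1)) = -d := by omega
    rw [h3]
    linarith

/-- The number of movements whose starting position has arm length `v`. -/
noncomputable def cnt (e : ℕ) (X : Set ℤ) (v : ℤ) : ℤ := wsum e (fun a => if a = v then 1 else 0) X

/-- The claim for abaci with given charges and given numbers of movements of each arm length. -/
def Mirror (e : ℕ) (c p : ℤ → ℤ) : Prop :=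
  ∀ n X Y, MK e n X Y → (∀ r, ch (rn e X r) = p r) → Inc e X → (∀ v, cnt e X v = c v) →
    Inc e Y ∧ ∀ v, cnt e Y v = c (e - v)

theorem sw_lower {e : ℕ} (i : ℤ) (p : ℤ → ℤ) : sw e i p (i - 1) = p i := by
  unfold sw
  rw [sub_self, if_pos (dvd_zero _), sub_add_cancel]

theorem sw_upper {e : ℕ} (he : 2 ≤ e) (i : ℤ) (p : ℤ → ℤ) : sw e i p i = p (i - 1) := by
  unfold sw
  rw [if_neg, sub_self, if_pos (dvd_zero _)]
  rw [show i - (i - 1) = 1 by ring]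
  exact not_dvd_of_pos_lt one_pos (by omega)

theorem Mirror.of_sw {e : ℕ} (he : 3 ≤ e) {c p : ℤ → ℤ} (i : ℤ) (h : Mirror e c (sw e i p)) :
    Mirror e c p := by
  have he2 : 2 ≤ e := by omega
  intro n X Y hMK hp hI hc
  obtain ⟨m, X', Y', h1, h2, h3, h4⟩ := hMK.exists_reflect he i
  obtain rfl : (fun r => ch (rn e X r)) = p := funext hp
  have a1 := h4 (i - 1)
  have a2 := h4 i
  rw [sw_lower] at a1
  rw [sw_upper he2] at a2
  have hN := h2.mult_eq_of_swap he2 a1 a2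
  have hasc := hI.noAscent he2 h2.maya i
  obtain ⟨b1, b2⟩ := h m X' Y' h1 h4 (h2.inc he2 hN hI) fun v => by
    rw [← hc]; exact h2.wsum_eq he2 hasc hN _
  have h3' := h3.symm
  -- On the image side the charges are exchanged as well, since they are determined by `MK.charge`.
  have hN' := h3'.mult_eq_of_swap he2 (by
      have c1 := hMK.charge he2 i
      have c2 := h1.charge he2 (i - 1)
      rw [show -i - 1 = -1 - i by ring, c1]
      rw [show -1 - (i - 1) = -i by ring] at c2
      rw [c2, a1]) (by
      have c1 := hMK.charge he2 (i - 1)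
      have c2 := h1.charge he2 i
      rw [show -i - 1 = -1 - i by ring, c2]
      rw [show -1 - (i - 1) = -i by ring] at c1
      rw [c1, a2])
  refine ⟨h3'.inc he2 hN' b1, fun v => ?_⟩
  rw [← b2]
  exact h3'.wsum_eq he2 (b1.noAscent he2 h3'.maya _) hN' _

/-! ### Descent to the charges of the vacuum -/

theorem sum_periodic {e : ℕ} {g : ℤ → ℤ} (hg : ∀ r, g (r + e) = g r) (a : ℤ) :
    ∑ j ∈ Finset.range e, g (a + j) = ∑ j ∈ Finset.range e, g j := by
  have step : ∀ a : ℤ, ∑ j ∈ Finset.range e, g (a + 1 + j) = ∑ j ∈ Finset.range e, g (a + j) :=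
    fun a => by rw [sum_window_succ, hg]; ring
  induction a using Int.inductionOn' (b := 0) with
  | zero => simp
  | succ k _ ih => rw [step, ih]
  | pred k _ ih =>
    rw [← ih, ← step (k - 1)]
    simp

theorem sum_periodic_pair {e : ℕ} (he : 2 ≤ e) {h h' : ℤ → ℤ} (hh : ∀ r, h (r + e) = h r)
    (hh' : ∀ r, h' (r + e) = h' r) (i : ℤ)
    (heq : ∀ r, ¬ (e : ℤ) ∣ r - i → ¬ (e : ℤ) ∣ r - (i - 1) → h' r = h r) (G : ℤ → ℤ) :
    ∑ j ∈ Finset.range e, G (h' j) = ∑ j ∈ Finset.range e, G (h j) +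
      (G (h' (i - 1)) + G (h' i) - G (h (i - 1)) - G (h i)) := by
  rw [← sum_periodic (g := fun r => G (h r)) (fun r => by rw [hh]) (i - 1),
    ← sum_periodic (g := fun r => G (h' r)) (fun r => by rw [hh']) (i - 1)]
  obtain ⟨m, rfl⟩ : ∃ m, e = m + 2 := ⟨e - 2, by omega⟩
  rw [Finset.sum_range_succ', Finset.sum_range_succ', Finset.sum_range_succ',
    Finset.sum_range_succ']
  have : ∑ k ∈ Finset.range m, G (h' (i - 1 + ((k + 1 + 1 : ℕ) : ℤ))) =
      ∑ k ∈ Finset.range m, G (h (i - 1 + ((k + 1 + 1 : ℕ) : ℤ))) := by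
    refine Finset.sum_congr rfl fun k hk => ?_
    rw [Finset.mem_range] at hk
    rw [heq]
    · exact not_dvd_of_pos_lt (by push_cast; omega) (by push_cast; omega)
    · exact not_dvd_of_pos_lt (by push_cast; omega) (by push_cast; omega)
  rw [this]
  simp only [Nat.cast_add, Nat.cast_zero, Nat.cast_one, add_zero, zero_add, sub_add_cancel]
  ring

/-- The charges of an abacus: quasi-periodic functions of total sum zero. -/
structure Balanced (e : ℕ) (p : ℤ → ℤ) : Prop where
  shift : ∀ r, p (r + e) = p r - 1
  sum : ∑ j ∈ Finset.range e, p j = 0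

theorem height_periodic {e : ℕ} {p : ℤ → ℤ} (h : ∀ r, p (r + e) = p r - 1) (r : ℤ) :
    r + e + e * p (r + e) = r + e * p r := by
  rw [h]; ring

/-- Charges are only quasi-periodic; the periodic quantity is `r + e * p r`, to which the comparison
of sums over a period applies. -/
theorem sum_eq_of_pair {e : ℕ} (he : 2 ≤ e) {p p' : ℤ → ℤ} (h : ∀ r, p (r + e) = p r - 1)
    (h' : ∀ r, p' (r + e) = p' r - 1) (i : ℤ)
    (heq : ∀ r, ¬ (e : ℤ) ∣ r - i → ¬ (e : ℤ) ∣ r - (i - 1) → p' r = p r)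
    (hs : p' (i - 1) + p' i = p (i - 1) + p i) :
    ∑ j ∈ Finset.range e, p' j = ∑ j ∈ Finset.range e, p j := by
  have key := sum_periodic_pair he (h := fun r => r + e * p r) (h' := fun r => r + e * p' r)
    (height_periodic h) (height_periodic h') i (fun r a b => by rw [heq r a b]) id
  simp only [id, Finset.sum_add_distrib, ← Finset.mul_sum] at key
  have he' : (e : ℤ) ≠ 0 := by exact_mod_cast (show e ≠ 0 by omega)
  apply mul_left_cancel₀ he'
  have : (e : ℤ) * (p' (i - 1) + p' i) = e * (p (i - 1) + p i) := by rw [hs]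
  linarith

theorem sw_shift {e : ℕ} {p : ℤ → ℤ} (h : ∀ r, p (r + e) = p r - 1) (i r : ℤ) :
    sw e i p (r + e) = sw e i p r - 1 := by
  unfold sw
  have h1 : ∀ a : ℤ, (e : ℤ) ∣ r + e - a ↔ (e : ℤ) ∣ r - a := fun a => by
    rw [show r + e - a = r - a + e * 1 by ring, dvd_shift]
  simp only [h1]
  split_ifs
  · rw [← h]; ring_nf
  · rw [← h]; ring_nf
  · rw [h]

theorem sw_other {e : ℕ} {i r : ℤ} {p : ℤ → ℤ} (h1 : ¬ (e : ℤ) ∣ r - i)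
    (h2 : ¬ (e : ℤ) ∣ r - (i - 1)) : sw e i p r = p r := by
  unfold sw
  rw [if_neg h2, if_neg h1]

theorem Balanced.reflect {e : ℕ} (he : 2 ≤ e) {p : ℤ → ℤ} (h : Balanced e p) (i : ℤ) :
    Balanced e (sw e i p) := by
  refine ⟨sw_shift h.shift i, ?_⟩
  rw [← h.sum]
  refine sum_eq_of_pair he h.shift (sw_shift h.shift i) i (fun r => sw_other) ?_
  rw [sw_lower, sw_upper he]; ring

theorem sw_sw {e : ℕ} (he : 2 ≤ e) (i : ℤ) (p : ℤ → ℤ) : sw e i (sw e i p) = p := by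
  funext r
  have hn : ¬ (e : ℤ) ∣ 1 := not_dvd_of_pos_lt one_pos (by omega)
  unfold sw
  by_cases h1 : (e : ℤ) ∣ r - (i - 1)
  · have h2 : ¬ (e : ℤ) ∣ r + 1 - (i - 1) := fun h2 => hn (by
      have := dvd_sub h2 h1; ring_nf at this; exact this)
    rw [if_pos h1, if_neg h2, if_pos (by rwa [show r + 1 - i = r - (i - 1) by ring]),
      add_sub_cancel_right]
  · by_cases h2 : (e : ℤ) ∣ r - i
    · rw [if_neg h1, if_pos h2, if_pos (by rwa [show r - 1 - (i - 1) = r - i by ring]),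
        sub_add_cancel]
    · rw [if_neg h1, if_neg h2, if_neg h1, if_neg h2]

theorem quasi_shift {e : ℕ} {p : ℤ → ℤ} (h : ∀ r, p (r + e) = p r - 1) (r k : ℤ) :
    p (r + e * k) = p r - k := by
  induction k using Int.inductionOn' (b := 0) with
  | zero => simp
  | succ k _ ih => rw [mul_add, mul_one, ← add_assoc, h, ih]; ring
  | pred k _ ih =>
    have := h (r + e * (k - 1))
    rw [show r + e * (k - 1) + e = r + e * k by ring, ih] at this
    omega

/-- A nonincreasing charge function drops by one over a period, so on `0, ..., e - 1` it takes
values in `{p 0 - 1, p 0}`. These are all nonnegative or all nonpositive, and with sum zero they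
vanish. -/
theorem Balanced.eq_vac {e : ℕ} (he : 2 ≤ e) {p : ℤ → ℤ} (h : Balanced e p)
    (hd : ∀ i, p i ≤ p (i - 1)) : p = fun r : ℤ => -(r / (e : ℤ)) := by
  have hanti : ∀ a b, a ≤ b → p b ≤ p a := by
    intro a b hab
    induction b, hab using Int.leInduction with
    | base => exact le_rfl
    | succ b hab ih =>
      have := hd (b + 1)
      rw [add_sub_cancel_right] at this
      omega
  have hper := h.shift 0
  rw [zero_add] at hper
  have hj : ∀ j ∈ Finset.range e, p 0 - 1 ≤ p j ∧ p j ≤ p 0 := fun j hj => by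
    rw [Finset.mem_range] at hj
    have h1 := hanti 0 j (by omega)
    have h2 := hanti j e (by omega)
    omega
  have h0 : (0 : ℕ) ∈ Finset.range e := Finset.mem_range.2 (by omega)
  have hzero : ∀ j ∈ Finset.range e, p j = 0 := by
    rcases le_or_gt 1 (p 0) with h1 | h1
    · exact (Finset.sum_eq_zero_iff_of_nonneg fun j hj' => by have := hj j hj'; omega).1 h.sum
    · exact (Finset.sum_eq_zero_iff_of_nonpos fun j hj' => by have := hj j hj'; omega).1 h.sum
  funext r
  have he' : (0 : ℤ) < e := by exact_mod_cast (show 0 < e by omega)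
  have h1 := Int.emod_nonneg r he'.ne'
  have h2 := Int.emod_lt_of_pos r he'
  have h3 := quasi_shift h.shift (r % e) (r / e)
  rw [Int.emod_add_mul_ediv] at h3
  have h4 := hzero (r % e).toNat (Finset.mem_range.2 (by omega))
  rw [Int.toNat_of_nonneg h1] at h4
  rw [h3, h4, zero_sub]

/-- While some `p i > p (i - 1)`, the exchange lowers the sum of the squares of `j + e * p j` over a
period, by `2 * e * (p i - p (i - 1))`. When no exchange helps, the charges are those of the empty
partition. -/
theorem Balanced.descent {e : ℕ} (he : 2 ≤ e) {P : (ℤ → ℤ) → Prop}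
    (hP : ∀ i p, P (sw e i p) → P p) {p : ℤ → ℤ} (h : Balanced e p) :
    P p ↔ P fun r => -(r / e) := by
  have hP' : ∀ i p, P (sw e i p) ↔ P p := fun i p =>
    ⟨hP i p, fun h => hP i _ (by rwa [sw_sw he])⟩
  induction hn : (∑ j ∈ Finset.range e, (j + e * p j) ^ 2).toNat using Nat.strong_induction_on
    generalizing p with
  | _ n ih =>
    by_cases hd : ∀ i, p i ≤ p (i - 1)
    · rw [h.eq_vac he hd]
    · push Not at hd
      obtain ⟨i, hi⟩ := hd
      have h' := h.reflect he i
      have key := sum_periodic_pair he (h := fun r => r + e * p r)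
        (h' := fun r => r + e * sw e i p r) (height_periodic h.shift) (height_periodic h'.shift) i
        (fun r a b => by rw [sw_other a b]) (· ^ 2)
      beta_reduce at key
      rw [sw_lower, sw_upper he] at key
      have hpos : 0 ≤ ∑ j ∈ Finset.range e, ((j : ℤ) + e * sw e i p j) ^ 2 :=
        Finset.sum_nonneg fun j _ => sq_nonneg _
      have he' : (0 : ℤ) < e := by exact_mod_cast (show 0 < e by omega)
      have hdec : ∑ j ∈ Finset.range e, ((j : ℤ) + e * sw e i p j) ^ 2 <
          ∑ j ∈ Finset.range e, ((j : ℤ) + e * p j) ^ 2 := by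
        have h1 : 0 < (e : ℤ) * (p i - p (i - 1)) := mul_pos he' (by omega)
        rw [key]
        nlinarith
      rw [← hP' i p]
      exact ih _ (by omega) h' rfl

theorem MK.balanced {e n : ℕ} (he : 2 ≤ e) {X Y : Set ℤ} (h : MK e n X Y) :
    Balanced e fun r => ch (rn e X r) := by
  have hs : ∀ {X : Set ℤ}, IsMaya X → ∀ r, ch (rn e X (r + e)) = ch (rn e X r) - 1 := fun hX r => by
    have := ch_shift hX (e := e) (by omega) r 1
    rwa [mul_one] at this
  refine ⟨hs h.isMaya.1, ?_⟩
  induction h with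
  | vac =>
    refine Finset.sum_eq_zero fun j hj => ?_
    rw [Finset.mem_range] at hj
    rw [ch_vac (by omega), Int.ediv_eq_zero_of_lt (by omega) (by omega), neg_zero]
  | @step n X Y X' Y' i h1 h2 h3 ih =>
    rw [← ih]
    have hX := h1.isMaya.1
    have hX' := h2.isMaya.2 hX
    have c1 := h2.ch_lower he hX'
    have c2 := h2.ch_upper he hX'
    obtain ⟨x, -, hm⟩ := h2
    refine sum_eq_of_pair (p := fun r => ch (rn e X r)) (p' := fun r => ch (rn e X' r)) he (hs hX)
      (hs hX') i (fun r a b => ?_) ?_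
    · rw [rn_other hm a b]
    · omega

theorem Mirror.iff_of_balanced {e : ℕ} (he : 3 ≤ e) {c p q : ℤ → ℤ} (hp : Balanced e p)
    (hq : Balanced e q) : Mirror e c p ↔ Mirror e c q := by
  have := fun {p} (hp : Balanced e p) => hp.descent (by omega) (P := Mirror e c)
    fun i p => Mirror.of_sw he i
  rw [this hp, this hq]

/-! ### Totals -/

theorem wsum_eq_sum {e : ℕ} (he : 0 < e) {X : Set ℤ} (hX : IsMaya X) (f : ℤ → ℤ) :
    wsum e f X = ∑ q ∈ (mu_finite he hX).toFinset, mu e X q * f (arm e X q) := by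
  refine finsum_eq_sum_of_support_subset _ fun q hq => ?_
  simp only [Function.mem_support, Set.Finite.coe_toFinset] at hq ⊢
  intro hc; apply hq; rw [hc, zero_mul]

theorem cnt_nonneg {e : ℕ} (he : 0 < e) {X : Set ℤ} (hX : IsMaya X) (v : ℤ) : 0 ≤ cnt e X v := by
  unfold cnt
  rw [wsum_eq_sum he hX]
  refine Finset.sum_nonneg fun q _ => mul_nonneg (mu_nonneg _ _ _) ?_
  split_ifs <;> norm_num

theorem cnt_eq_zero_iff {e : ℕ} (he : 0 < e) {X : Set ℤ} (hX : IsMaya X) (v : ℤ) :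
    cnt e X v = 0 ↔ ∀ q, 0 < mu e X q → arm e X q ≠ v := by
  unfold cnt
  rw [wsum_eq_sum he hX, Finset.sum_eq_zero_iff_of_nonneg fun q _ =>
    mul_nonneg (mu_nonneg _ _ _) (by split_ifs <;> norm_num)]
  constructor
  · intro h q hq hv
    have := h q (by simp [hq.ne'])
    rw [if_pos hv] at this
    omega
  · intro h q hq
    have h1 : 0 < mu e X q := lt_of_le_of_ne (mu_nonneg _ _ _) (by
      simp only [Set.Finite.mem_toFinset, Function.mem_support] at hq
      exact Ne.symm hq)
    rw [if_neg (h q h1), mul_zero]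

/-- The weight: the total number of movements. -/
noncomputable def wtot (e : ℕ) (X : Set ℤ) : ℤ := wsum e (fun _ => 1) X

theorem wtot_eq_sum_cnt {e : ℕ} (he : 0 < e) {X : Set ℤ} (hX : IsMaya X) :
    wtot e X = ∑ v ∈ Finset.range (e + 1), cnt e X v := by
  unfold wtot cnt
  simp only [wsum_eq_sum he hX]
  rw [Finset.sum_comm]
  refine Finset.sum_congr rfl fun q _ => ?_
  rw [← Finset.mul_sum]
  have h1 := arm_nonneg e X q
  have h2 := arm_le e X q
  have : ∑ v ∈ Finset.range (e + 1), (if arm e X q = (v : ℤ) then (1 : ℤ) else 0) = 1 := by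
    rw [Finset.sum_eq_single (arm e X q).toNat]
    · rw [if_pos (by omega)]
    · intro b _ hb; rw [if_neg (by omega)]
    · intro hc; rw [Finset.mem_range] at hc; omega
  rw [this]

theorem card_le_wtot {e : ℕ} (he : 0 < e) {X : Set ℤ} (hX : IsMaya X) (T : Finset ℤ)
    (hT : ∀ q ∈ T, 0 < mu e X q) : (T.card : ℤ) ≤ wtot e X := by
  unfold wtot
  rw [wsum_eq_sum he hX]
  simp only [mul_one]
  calc (T.card : ℤ) = ∑ q ∈ T, 1 := by simp
    _ ≤ ∑ q ∈ T, mu e X q := Finset.sum_le_sum fun q hq => by have := hT q hq; omega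
    _ ≤ _ := Finset.sum_le_sum_of_subset_of_nonneg (fun q hq => by simp [(hT q hq).ne'])
      fun q _ _ => mu_nonneg _ _ _

theorem level_count_le {e : ℕ} (he : 0 < e) {X : Set ℤ} (hX : IsMaya X) (r a b : ℤ)
    (h : ∀ t, a ≤ t → t ≤ b → 0 < mult (rn e X r) t) : b + 1 - a ≤ wtot e X := by
  have inj : Function.Injective fun t : ℤ => r + e * t := fun s t hst => by
    have h1 : (e : ℤ) * s = e * t := by simpa using hst
    exact mul_left_cancel₀ (by omega) h1
  have h1 := card_le_wtot he hX ((Finset.Icc a b).map ⟨_, inj⟩) fun q hq => by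
    rw [Finset.mem_map] at hq
    obtain ⟨t, ht, rfl⟩ := hq
    rw [Finset.mem_Icc] at ht
    exact (mu_level e X r t).symm ▸ h t ht.1 ht.2
  rw [Finset.card_map, Int.card_Icc] at h1
  omega

/-- A gap this far before the charge would make every level from the next one up to the charge a
start, which is more movements than the weight allows. -/
theorem mem_of_lt_charge {e : ℕ} (he : 0 < e) {X : Set ℤ} (hX : IsMaya X) {r t : ℤ}
    (h : t < ch (rn e X r) - wtot e X) : t ∈ rn e X r := by
  by_contra hc
  have hr := hX.rn he r
  have h0 := bd_sub_gp hr (ch (rn e X r))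
  have hw : 0 ≤ wtot e X := by simpa using card_le_wtot he hX ∅ (by simp)
  have h1 := gp_pos_of_notMem hr hc (show t < ch (rn e X r) by omega)
  have := level_count_le he hX r (t + 1) (ch (rn e X r)) fun s hs hs' => by
    have h2 := bd_anti hr hs'
    exact mult_pos_iff.2 ⟨gp_pos_of_notMem hr hc (by omega), by omega⟩
  omega

theorem notMem_of_charge_le {e : ℕ} (he : 0 < e) {X : Set ℤ} (hX : IsMaya X) {r t : ℤ}
    (h : ch (rn e X r) + wtot e X ≤ t) : t ∉ rn e X r := by
  intro hc
  have hr := hX.rn he r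
  have h0 := bd_sub_gp hr (ch (rn e X r))
  have hw : 0 ≤ wtot e X := by simpa using card_le_wtot he hX ∅ (by simp)
  have h1 := bd_pos_of_mem hr hc (show ch (rn e X r) ≤ t by omega)
  have := level_count_le he hX r (ch (rn e X r)) t fun s hs hs' => by
    have h2 := gp_mono hr hs
    exact mult_pos_iff.2 ⟨by omega, bd_pos_of_mem hr hc (by omega)⟩
  omega

/-! ### A pair of runners far away from the others -/

/-- The window ending at `i + m + e * t` meets the runners `i - 1`, `i` and the first `m` later ones
at level `t`, and the remaining ones at level `t - 1`. -/
theorem arm_block {e : ℕ} (he : 2 ≤ e) (X : Set ℤ) (i t : ℤ) {m : ℕ} (hm : m ≤ e - 2) :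
    arm e X (i + m + e * t) = (1 - ind (rn e X (i - 1)) t) + (1 - ind (rn e X i) t) +
      ∑ j ∈ Finset.range (e - 2),
        (1 - ind X (i + 1 + j + e * (t - 1 + if j < m then 1 else 0))) := by
  induction m with
  | zero =>
    obtain ⟨k, rfl⟩ : ∃ k, e = k + 2 := ⟨e - 2, by omega⟩
    unfold arm
    rw [Finset.sum_range_succ, Finset.sum_range_succ, ind_rn, ind_rn, Nat.add_sub_cancel]
    have h1 : i + (0 : ℕ) + ((k + 2 : ℕ) : ℤ) * t - ((k + 2 : ℕ) : ℤ) + 1 + (k : ℕ) =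
        i - 1 + ((k + 2 : ℕ) : ℤ) * t := by push_cast; ring
    have h2 : i + (0 : ℕ) + ((k + 2 : ℕ) : ℤ) * t - ((k + 2 : ℕ) : ℤ) + 1 + (k + 1 : ℕ) =
        i + ((k + 2 : ℕ) : ℤ) * t := by push_cast; ring
    rw [h1, h2]
    have h3 : ∀ j ∈ Finset.range k, 1 - ind X (i + (0 : ℕ) + ((k + 2 : ℕ) : ℤ) * t -
        ((k + 2 : ℕ) : ℤ) + 1 + (j : ℕ)) = 1 - ind X (i + 1 + j + ((k + 2 : ℕ) : ℤ) *
          (t - 1 + if j < 0 then 1 else 0)) := fun j _ => by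
      rw [if_neg (by omega)]; congr 2; push_cast; ring
    rw [Finset.sum_congr rfl h3]; ring
  | succ m ih =>
    have h1 := arm_pred e X (i + (m + 1 : ℕ) + e * t)
    rw [show i + (m + 1 : ℕ) + e * t - 1 = i + m + e * t by push_cast; ring, ih (by omega)] at h1
    have h2 : ∑ j ∈ Finset.range (e - 2),
          (1 - ind X (i + 1 + j + e * (t - 1 + if j < m then 1 else 0))) -
        ∑ j ∈ Finset.range (e - 2),
          (1 - ind X (i + 1 + j + e * (t - 1 + if j < m + 1 then 1 else 0))) =
        ind X (i + 1 + m + e * t) - ind X (i + 1 + m + e * (t - 1)) := by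
      rw [← Finset.sum_sub_distrib, Finset.sum_eq_single m]
      · rw [if_neg (by omega), if_pos (by omega)]; ring_nf
      · intro b _ hb
        by_cases hbm : b < m
        · rw [if_pos hbm, if_pos (by omega), sub_self]
        · rw [if_neg hbm, if_neg (by omega), sub_self]
      · intro hc; exact absurd (Finset.mem_range.2 (by omega)) hc
    rw [show i + (m + 1 : ℕ) + e * t - e = i + 1 + m + e * (t - 1) by push_cast; ring] at h1
    rw [show i + (m + 1 : ℕ) + e * t = i + 1 + m + e * t by push_cast; ring] at h1 ⊢
    linarith

/-- The runners `i - 1` and `i` are ordinary outside the levels `[L, U)`, where the next `g`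
runners are empty and the remaining ones are full. -/
structure Env (e : ℕ) (i : ℤ) (g : ℕ) (L U : ℤ) (X : Set ℤ) : Prop where
  le : L ≤ U
  le_e : g ≤ e - 2
  low : ∀ j : ℕ, j < g → ∀ t, L ≤ t → i + 1 + j + e * t ∉ X
  high : ∀ j : ℕ, g ≤ j → j < e - 2 → ∀ t, t < U → i + 1 + j + e * t ∈ X
  mem₁ : ∀ t, t < L → t ∈ rn e X (i - 1)
  notMem₁ : ∀ t, U ≤ t → t ∉ rn e X (i - 1)
  mem₂ : ∀ t, t < L → t ∈ rn e X i
  notMem₂ : ∀ t, U ≤ t → t ∉ rn e X i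

theorem env_of_charges {e : ℕ} (he : 2 ≤ e) {X : Set ℤ} (hX : IsMaya X) {i a b w : ℤ} {g : ℕ}
    (hg : g ≤ e - 2) (hw : wtot e X ≤ w) (hab : a ≤ b)
    (h1 : a ≤ ch (rn e X (i - 1)) ∧ ch (rn e X (i - 1)) ≤ b)
    (h2 : a ≤ ch (rn e X i) ∧ ch (rn e X i) ≤ b)
    (hlow : ∀ j : ℕ, j < g → ch (rn e X (i + 1 + j)) + w ≤ a - w)
    (hhigh : ∀ j : ℕ, g ≤ j → j < e - 2 → b + w ≤ ch (rn e X (i + 1 + j)) - w) :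
    Env e i g (a - w) (b + w) X := by
  have he' : 0 < e := by omega
  have hw0 : 0 ≤ wtot e X := by simpa using card_le_wtot he' hX ∅ (by simp)
  exact ⟨by omega, hg,
    fun j hj t ht => notMem_of_charge_le (r := i + 1 + j) he' hX (by have := hlow j hj; omega),
    fun j hj hj' t ht => mem_of_lt_charge (r := i + 1 + j) he' hX
      (by have := hhigh j hj hj'; omega),
    fun t ht => mem_of_lt_charge he' hX (by omega),
    fun t ht => notMem_of_charge_le he' hX (by omega),
    fun t ht => mem_of_lt_charge he' hX (by omega),
    fun t ht => notMem_of_charge_le he' hX (by omega)⟩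

/-! ### Arm lengths when two adjacent runners are far from all the others. -/

section

variable {e : ℕ} {i : ℤ} {g : ℕ} {L U : ℤ} {X : Set ℤ}

theorem sum_ite_lt {g k : ℕ} (h : g ≤ k) :
    ∑ j ∈ Finset.range k, (if j < g then (1 : ℤ) else 0) = g := by
  rw [Finset.sum_ite, Finset.sum_const_zero, add_zero, Finset.sum_const, nsmul_eq_mul, mul_one]
  have : (Finset.range k).filter (· < g) = Finset.range g := by
    ext j; simp only [Finset.mem_filter, Finset.mem_range]; omega
  rw [this, Finset.card_range]

theorem Env.arm_upper (he : 2 ≤ e) (h : Env e i g L U X) {t : ℤ} (h1 : L < t) (h2 : t ≤ U) :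
    arm e X (i + e * t) = g + 2 - ind (rn e X (i - 1)) t - ind (rn e X i) t := by
  have := arm_block he X i t (Nat.zero_le _)
  rw [Nat.cast_zero, add_zero] at this
  rw [this]
  have h3 : ∑ j ∈ Finset.range (e - 2),
      (1 - ind X (i + 1 + j + e * (t - 1 + if j < 0 then 1 else 0))) = g := by
    rw [← sum_ite_lt h.le_e]
    refine Finset.sum_congr rfl fun j hj => ?_
    rw [if_neg (Nat.not_lt_zero _), add_zero]
    rw [Finset.mem_range] at hj
    split_ifs with h4
    · rw [ind_notMem (h.low j h4 _ (by omega)), sub_zero]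
    · rw [ind_mem (h.high j (by omega) hj _ (by omega)), sub_self]
  rw [h3]; ring

theorem Env.arm_lower (he : 2 ≤ e) (h : Env e i g L U X) {t : ℤ} (h1 : L < t) (h2 : t ≤ U) :
    arm e X (i - 1 + e * t) = g + 2 - ind (rn e X (i - 1)) t - ind (rn e X i) (t - 1) := by
  rw [Abacus.arm_lower, h.arm_upper he h1 h2]; ring

theorem Env.level₁ (he : 2 ≤ e) (hX : IsMaya X) (h : Env e i g L U X) {t : ℤ}
    (ht : 0 < mult (rn e X (i - 1)) t) : L < t ∧ t < U := by
  obtain ⟨h1, h2⟩ := mult_pos_iff.1 ht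
  obtain ⟨u, hu, hu'⟩ := (gp_pos_iff (hX.rn (by omega) _) t).1 h1
  obtain ⟨v, hv, hv'⟩ := (bd_pos_iff (hX.rn (by omega) _) t).1 h2
  constructor
  · by_contra hc; exact hu' (h.mem₁ u (by omega))
  · by_contra hc; exact h.notMem₁ v (by omega) hv'

theorem Env.level₂ (he : 2 ≤ e) (hX : IsMaya X) (h : Env e i g L U X) {t : ℤ}
    (ht : 0 < mult (rn e X i) t) : L < t ∧ t < U := by
  obtain ⟨h1, h2⟩ := mult_pos_iff.1 ht
  obtain ⟨u, hu, hu'⟩ := (gp_pos_iff (hX.rn (by omega) _) t).1 h1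
  obtain ⟨v, hv, hv'⟩ := (bd_pos_iff (hX.rn (by omega) _) t).1 h2
  constructor
  · by_contra hc; exact hu' (h.mem₂ u (by omega))
  · by_contra hc; exact h.notMem₂ v (by omega) hv'

/-- A movement on one of the first `g` runners starts below level `L`, where the pair and the later
runners are full; one on a later runner starts above level `U`, where the pair and the first `g`
runners are empty. So arm length `g + 1` occurs only on the pair. -/
theorem Env.outside (he : 2 ≤ e) (hX : IsMaya X) (h : Env e i g L U X) {q : ℤ}
    (h1 : ¬ (e : ℤ) ∣ q - i) (h2 : ¬ (e : ℤ) ∣ q - (i - 1)) (hq : 0 < mu e X q) :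
    (q < i - 1 + e * L ∧ arm e X q ≤ g) ∨ (i + e * U < q ∧ g + 2 ≤ arm e X q) := by
  have he' : (0 : ℤ) < e := by exact_mod_cast (show 0 < e by omega)
  obtain ⟨j, t, hj, rfl⟩ : ∃ (j : ℕ) (t : ℤ), j < e - 2 ∧ q = i + 1 + j + e * t := by
    have a1 := Int.emod_nonneg (q - (i + 1)) he'.ne'
    have a2 := Int.emod_lt_of_pos (q - (i + 1)) he'
    have a3 := Int.mul_ediv_add_emod (q - (i + 1)) e
    refine ⟨((q - (i + 1)) % e).toNat, (q - (i + 1)) / e, ?_, by omega⟩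
    by_contra hc
    rcases (show (q - (i + 1)) % e = e - 2 ∨ (q - (i + 1)) % e = e - 1 by omega) with a4 | a4
    · exact h2 ⟨(q - (i + 1)) / e + 1, by rw [mul_add, mul_one]; omega⟩
    · exact h1 ⟨(q - (i + 1)) / e + 1, by rw [mul_add, mul_one]; omega⟩
  rw [mu_level] at hq
  obtain ⟨h3, h4⟩ := mult_pos_iff.1 hq
  obtain ⟨u, hu, hu'⟩ := (gp_pos_iff (hX.rn (by omega) _) t).1 h3
  obtain ⟨v, hv, hv'⟩ := (bd_pos_iff (hX.rn (by omega) _) t).1 h4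
  have hb := arm_block he X i t (m := j + 1) (by omega)
  rw [show i + (j + 1 : ℕ) + e * t = i + 1 + j + e * t by push_cast; ring] at hb
  have hle := h.le
  rcases lt_or_ge j g with hjg | hjg
  · left
    have ht : t < L := by
      by_contra hc
      exact h.low j hjg v (by omega) hv'
    constructor
    · have : (e : ℤ) * (t + 1) ≤ e * L := mul_le_mul_of_nonneg_left (by omega) he'.le
      rw [mul_add, mul_one] at this
      omega
    · rw [hb, ind_mem (h.mem₁ t ht), ind_mem (h.mem₂ t ht)]
      have : ∑ k ∈ Finset.range (e - 2),
          (1 - ind X (i + 1 + k + e * (t - 1 + if k < j + 1 then 1 else 0))) ≤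
          ∑ k ∈ Finset.range (e - 2), (if k < g then (1 : ℤ) else 0) := by
        refine Finset.sum_le_sum fun k hk => ?_
        rw [Finset.mem_range] at hk
        by_cases hkg : k < g
        · rw [if_pos hkg]
          rcases ind_cases X (i + 1 + k + e * (t - 1 + if k < j + 1 then 1 else 0)) with
            ⟨_, h⟩ | ⟨_, h⟩ <;> omega
        · rw [if_neg hkg, ind_mem (h.high k (by omega) hk _ (by split_ifs <;> omega)), sub_self]
      rw [sum_ite_lt h.le_e] at this
      omega
  · right
    have ht : U < t := by
      by_contra hc
      exact hu' (h.high j hjg hj u (by omega))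
    constructor
    · have : (e : ℤ) * U ≤ e * t := mul_le_mul_of_nonneg_left (by omega) he'.le
      omega
    · rw [hb, ind_notMem (h.notMem₁ t (by omega)), ind_notMem (h.notMem₂ t (by omega))]
      have : ∑ k ∈ Finset.range (e - 2), (if k < g then (1 : ℤ) else 0) ≤
          ∑ k ∈ Finset.range (e - 2),
          (1 - ind X (i + 1 + k + e * (t - 1 + if k < j + 1 then 1 else 0))) := by
        refine Finset.sum_le_sum fun k hk => ?_
        by_cases hkg : k < g
        · rw [if_pos hkg, ind_notMem (h.low k hkg _ (by split_ifs <;> omega)), sub_zero]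
        · rw [if_neg hkg]
          rcases ind_cases X (i + 1 + k + e * (t - 1 + if k < j + 1 then 1 else 0)) with
            ⟨_, h⟩ | ⟨_, h⟩ <;> omega
      rw [sum_ite_lt h.le_e] at this
      omega

end

/-! ### Removing or adding all movements on a pair of runners -/

theorem finsum_ite_Icc (a b : ℤ) (h : a ≤ b + 1) :
    ∑ᶠ t : ℤ, (if a ≤ t ∧ t ≤ b then (1 : ℤ) else 0) = b + 1 - a := by
  rw [finsum_eq_sum_of_support_subset (s := Finset.Icc a b) _ fun t ht => by
    simp only [Function.mem_support] at ht
    rw [Finset.coe_Icc]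
    by_contra hc
    exact ht (if_neg hc)]
  rw [Finset.sum_congr rfl fun t ht => if_pos (Finset.mem_Icc.1 ht)]
  simp only [Finset.sum_const, Int.card_Icc, nsmul_eq_mul, mul_one]
  omega

theorem support_ite_Icc (a b c : ℤ) :
    (Function.support fun t : ℤ => if a ≤ t ∧ t ≤ b then c else 0).Finite :=
  (Set.finite_Icc a b).subset fun t ht => by
    by_contra hc
    exact ht (if_neg hc)

/-- The total leaves no room for an excess over the indicator of the interval. -/
theorem eq_ite_of_finsum {N : ℤ → ℤ} (hfin : (Function.support N).Finite) (h0 : ∀ t, 0 ≤ N t)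
    {a b : ℤ} (hab : a ≤ b + 1) (hs : ∑ᶠ t, N t = b + 1 - a) (h1 : ∀ t, a ≤ t → t ≤ b → 1 ≤ N t)
    (t : ℤ) : N t = if a ≤ t ∧ t ≤ b then 1 else 0 := by
  have hle : ∀ t, (if a ≤ t ∧ t ≤ b then (1 : ℤ) else 0) ≤ N t := fun t => by
    split_ifs with h
    · exact h1 t h.1 h.2
    · exact h0 t
  have key := finsum_sub_distrib hfin (support_ite_Icc a b 1)
  rw [finsum_ite_Icc a b hab, hs, sub_self] at key
  have hfin' : (Function.support fun t => N t - if a ≤ t ∧ t ≤ b then (1 : ℤ) else 0).Finite :=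
    (hfin.union (support_ite_Icc a b 1)).subset (Function.support_sub _ _)
  rw [finsum_eq_sum_of_support_subset (s := hfin'.toFinset) _ (by simp),
    Finset.sum_eq_zero_iff_of_nonneg fun t _ => by have := hle t; omega] at key
  by_contra hc
  have := key t (by simp only [Set.Finite.mem_toFinset, Function.mem_support]; omega)
  omega

theorem mult_finite {A : Set ℤ} (hA : IsMaya A) : (Function.support (mult A)).Finite := by
  obtain ⟨v, hv, hv0⟩ := hA.exists_first_gap
  obtain ⟨z, hz, hz0⟩ := hA.exists_last_bead
  refine (Set.finite_Icc v z).subset fun t ht => ?_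
  have h1 : 0 < mult A t := lt_of_le_of_ne (mult_nonneg A t) (Ne.symm ht)
  obtain ⟨h2, h3⟩ := mult_pos_iff.1 h1
  constructor
  · by_contra hc
    have := gp_mono hA (show t ≤ v by omega)
    omega
  · by_contra hc
    have := bd_anti hA (show z + 1 ≤ t by omega)
    omega

/-- If every starting level carries a bead, then there is a single gap before the last bead. -/
theorem single_gap {A : Set ℤ} (hA : IsMaya A) (h : ∀ t, 0 < mult A t → t ∈ A) {s : ℤ}
    (hs : 0 < mult A s) : ∃ v, v ∉ A ∧ v < s ∧ s ≤ ch A ∧ ch A ∈ A ∧ bd A (ch A + 1) = 0 ∧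
      (∀ t ≤ v, gp A t = 0) ∧ ∀ t, v < t → t ≤ ch A + 1 → gp A t = 1 := by
  obtain ⟨v, hv, hv0⟩ := hA.exists_first_gap
  obtain ⟨z, hz, hz0⟩ := hA.exists_last_bead
  obtain ⟨h2, h3⟩ := mult_pos_iff.1 hs
  have hvs : v < s := by
    by_contra hc
    have := gp_mono hA (show s ≤ v by omega)
    omega
  have hsz : s ≤ z := by
    by_contra hc
    have := bd_anti hA (show z + 1 ≤ s by omega)
    omega
  have hv1 := gp_succ hA v
  rw [ind_notMem hv] at hv1
  have key : ∀ t, v < t → t ≤ z + 1 → gp A t = 1 := fun t ht ht' => by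
    rw [gp_eq_of_beads hA (show v + 1 ≤ t by omega) fun u h4 h5 =>
      h u (mult_pos_iff.2 ⟨gp_pos_of_notMem hA hv (by omega), bd_pos_of_mem hA hz (by omega)⟩)]
    omega
  have h4 := bd_sub_gp hA (z + 1)
  rw [key (z + 1) (by omega) le_rfl] at h4
  obtain rfl : z = ch A := by omega
  refine ⟨v, hv, hvs, hsz, hz, hz0, fun t ht => ?_, key⟩
  have := gp_mono hA ht
  have := gp_nonneg A t
  omega

/-! ### Deleting and creating all movements of one arm length on a distinguished pair of runners. -/

section

variable {e : ℕ} {i : ℤ} {g : ℕ} {L U : ℤ} {X : Set ℤ}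

theorem finsum_outside_eq (f : ℤ → ℤ) {Y : Set ℤ}
    (h : PairRel e i X Y) :
    (∑ᶠ q, open Classical in if (e : ℤ) ∣ q - i ∨ (e : ℤ) ∣ q - (i - 1) then 0
        else mu e Y q * f (arm e Y q)) =
      ∑ᶠ q, open Classical in if (e : ℤ) ∣ q - i ∨ (e : ℤ) ∣ q - (i - 1) then 0
        else mu e X q * f (arm e X q) := by
  refine finsum_congr fun q => ?_
  split_ifs with h1
  · rfl
  · rw [not_or] at h1
    rw [h.arm_eq q h1.2, mu_self, mu_self, h.other q h1.1 h1.2]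

/-- The shape of a pair of runners all of whose movements have the arm length `g + 1`, their number
being one more than the difference of the charges. -/
theorem pair_shape {A B : Set ℤ} (hA : IsMaya A) (hB : IsMaya B)
    (sA : ∀ t, 0 < mult A t → ind A t + ind B (t - 1) = 1)
    (sB : ∀ t, 0 < mult B t → ind A t + ind B t = 1)
    (hN : ∑ᶠ t, (mult A t + mult B t) = ch A + 1 - ch B) (hpos : ch B ≤ ch A) :
    (∀ t, mult A t + mult B t = if ch B ≤ t ∧ t ≤ ch A then 1 else 0) ∧
      ch A ∈ B ∧ ch A ∉ A ∧ bd A (ch A + 1) = 0 ∧ bd B (ch A + 1) = 0 := by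
  have fA := mult_finite hA
  have fB := mult_finite hB
  have hfin : (Function.support fun t => mult A t + mult B t).Finite :=
    (fA.union fB).subset (Function.support_add _ _)
  -- If such a level had no movement, `A` would be full before it and `B` empty from it on. Then `B`
  -- has no movements and `A` a single gap at some `v ≥ t`, with at most one movement at each level
  -- of `(v, ch A]`: fewer than prescribed.
  have hge : ∀ t, ch B ≤ t → t ≤ ch A → 1 ≤ mult A t + mult B t := by
    intro t h1 h2
    by_contra hc
    have n1 := mult_nonneg A t
    have n2 := mult_nonneg B t
    have bA := bd_sub_gp hA t
    have bB := bd_sub_gp hB t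
    have a1 : gp A t = 0 := by
      have : mult A t = 0 := by omega
      rw [mult, min_eq_left (by omega)] at this
      exact this
    have b1 : bd B t = 0 := by
      have : mult B t = 0 := by omega
      rw [mult, min_eq_right (by omega)] at this
      exact this
    have noB : ∀ s, mult B s = 0 := by
      intro s
      by_contra hs
      have hs' : 0 < mult B s := by have := mult_nonneg B s; omega
      obtain ⟨z, hz, hz0⟩ := hB.exists_last_bead
      obtain ⟨h3, h4⟩ := mult_pos_iff.1 hs'
      have h5 : s ≤ z := by
        by_contra hc
        have := bd_anti hB (show z + 1 ≤ s by omega)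
        omega
      have h6 : z < t := by
        by_contra hc
        have := bd_pos_of_mem hB hz (show t ≤ z by omega)
        omega
      have h7 := gp_mono hB h5
      have h8 := sB z (mult_pos_iff.2 ⟨by omega, bd_pos_of_mem hB hz le_rfl⟩)
      rw [ind_mem hz] at h8
      rcases ind_cases A z with ⟨_, h9⟩ | ⟨h9, _⟩
      · omega
      · have := gp_pos_of_notMem hA h9 h6
        omega
    have gapB : ∀ s, t ≤ s → ind B s = 0 := fun s hs => ind_notMem fun hc => by
      have := bd_pos_of_mem hB hc hs
      omega
    have beadA : ∀ s, 0 < mult A s → s ∈ A := fun s hs => by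
      have h3 := sA s hs
      have h4 : t ≤ s - 1 := by
        by_contra h5
        have h6 := (mult_pos_iff.1 hs).1
        have h7 := gp_mono hA (show s ≤ t by omega)
        omega
      rw [gapB _ h4] at h3
      exact ind_eq_one.1 (by omega)
    have hsA : ∃ s, 0 < mult A s := by
      by_contra hc
      push Not at hc
      have : ∀ s, mult A s + mult B s = 0 := fun s => by
        have := hc s; have := mult_nonneg A s; have := noB s; omega
      simp only [this, finsum_zero] at hN
      omega
    obtain ⟨s, hs⟩ := hsA
    obtain ⟨v, hv, hvs, hsz, hz, hz0, g0, g1⟩ := single_gap hA beadA hs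
    have hvt : t ≤ v := by
      by_contra hc
      have := gp_pos_of_notMem hA hv (show v < t by omega)
      omega
    have hle : ∀ u, mult A u + mult B u ≤ if v + 1 ≤ u ∧ u ≤ ch A then 1 else 0 := fun u => by
      rw [noB, add_zero]
      have h3 : mult A u ≤ gp A u := min_le_left _ _
      have h4 : mult A u ≤ bd A u := min_le_right _ _
      split_ifs with h5
      · rw [g1 u (by omega) (by omega)] at h3; exact h3
      · rcases le_or_gt u v with h6 | h6
        · rw [g0 u h6] at h3; exact h3
        · have := bd_anti hA (show ch A + 1 ≤ u by omega)
          omega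
    have := finsum_le_finsum' hfin (support_ite_Icc (v + 1) (ch A) 1) hle
    rw [hN, finsum_ite_Icc _ _ (by omega)] at this
    omega
  have hNt := eq_ite_of_finsum hfin (fun t => add_nonneg (mult_nonneg A t) (mult_nonneg B t))
    (by omega) hN hge
  refine ⟨hNt, ?_⟩
  have top := hNt (ch A + 1)
  rw [if_neg (by omega)] at top
  have nA := mult_nonneg A (ch A + 1)
  have nB := mult_nonneg B (ch A + 1)
  have bA := bd_sub_gp hA (ch A + 1)
  have bB := bd_sub_gp hB (ch A + 1)
  have topA : bd A (ch A + 1) = 0 := by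
    have : mult A (ch A + 1) = 0 := by omega
    rw [mult, min_eq_right (by omega)] at this
    exact this
  have topB : bd B (ch A + 1) = 0 := by
    have : mult B (ch A + 1) = 0 := by omega
    rw [mult, min_eq_right (by omega)] at this
    exact this
  have here := hNt (ch A)
  rw [if_pos ⟨hpos, le_rfl⟩] at here
  have cA := bd_sub_gp hA (ch A)
  have cB := bd_sub_gp hB (ch A)
  have mA : mult A (ch A) = gp A (ch A) := min_eq_left (by omega)
  have mB : mult B (ch A) = bd B (ch A) := min_eq_right (by omega)
  have sA' := bd_succ hA (ch A)
  have sB' := bd_succ hB (ch A)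
  have hbB : bd B (ch A) = 1 := by
    by_contra hc
    have n1 := gp_nonneg A (ch A)
    have n2 := bd_nonneg B (ch A)
    -- Otherwise the single movement at the top level is on `A`. The shape conditions then propagate
    -- downwards that `B` is empty and `A` occupied, and this contradicts the charge of `B` at level
    -- `ch B - 1`.
    have chain : ∀ s, s ≤ ch A → ch B ≤ s → bd B s = 0 ∧ ind A s = 1 := by
      intro s hs
      induction s, hs using Int.leInductionDown with
      | base => exact fun _ => ⟨by omega, by omega⟩
      | pred s hs ih =>
        intro h1
        obtain ⟨h2, h3⟩ := ih (by omega)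
        have h4 := hNt s
        rw [if_pos (by omega)] at h4
        have h5 : mult B s ≤ bd B s := min_le_right _ _
        have h6 := mult_nonneg B s
        have h7 := sA s (by omega)
        have h8 := bd_succ hB (s - 1)
        rw [sub_add_cancel] at h8
        have h9 := hNt (s - 1)
        rw [if_pos (by omega)] at h9
        have h10 : mult B (s - 1) ≤ bd B (s - 1) := min_le_right _ _
        have h11 := mult_nonneg B (s - 1)
        have h12 := bd_sub_gp hA (s - 1)
        have h13 := bd_sub_gp hA s
        have h14 : mult A s = gp A s := min_eq_left (by omega)
        have h15 : mult A (s - 1) = gp A (s - 1) := min_eq_left (by omega)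
        have h16 := gp_succ hA (s - 1)
        rw [sub_add_cancel] at h16
        exact ⟨by omega, by omega⟩
    obtain ⟨h2, h3⟩ := chain (ch B) hpos le_rfl
    have h4 := hNt (ch B)
    rw [if_pos (by omega)] at h4
    have h5 : mult B (ch B) ≤ bd B (ch B) := min_le_right _ _
    have h6 := mult_nonneg B (ch B)
    have h7 := sA (ch B) (by omega)
    have h8 := bd_succ hB (ch B - 1)
    rw [sub_add_cancel] at h8
    have h9 := bd_sub_gp hB (ch B - 1)
    have h10 := gp_nonneg B (ch B - 1)
    omega
  have n1 := gp_nonneg A (ch A)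
  exact ⟨ind_eq_one.1 (by omega), ind_eq_zero.1 (by omega), topA, topB⟩

theorem not_dvd_upper (he : 2 ≤ e) (i t : ℤ) : ¬ (e : ℤ) ∣ i + e * t - (i - 1) := by
  rw [show i + e * t - (i - 1) = 1 + e * t by ring, dvd_shift]
  exact not_dvd_of_pos_lt one_pos (by omega)

theorem pair_or_outside (e : ℕ) (i q : ℤ) :
    (¬ (e : ℤ) ∣ q - i ∧ ¬ (e : ℤ) ∣ q - (i - 1)) ∨ (∃ t, q = i - 1 + e * t) ∨
      ∃ t, q = i + e * t := by
  by_cases h1 : (e : ℤ) ∣ q - i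
  · exact Or.inr (Or.inr (exists_level h1))
  · by_cases h2 : (e : ℤ) ∣ q - (i - 1)
    · exact Or.inr (Or.inl (exists_level h2))
    · exact Or.inl ⟨h1, h2⟩

/-- On each of the two runners the last bead, if it starts a movement, has arm length at most `g +
1`; by monotonicity and minimality all movements on the pair have exactly this arm length. Then
`pair_shape` applies, and the walk has a last minimum. -/
theorem Env.exists_remove (he : 2 ≤ e) (hX : IsMaya X) (h : Env e i g L U X) (hI : Inc e X)
    (hmin : ∀ q, 0 < mu e X q → (g : ℤ) + 1 ≤ arm e X q)
    (hn : cnt e X (g + 1) = ch (rn e X (i - 1)) + 1 - ch (rn e X i))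
    (hpos : 0 < cnt e X (g + 1)) :
    ∃ Y, E e i X Y ∧ Inc e Y ∧
      ∀ v, cnt e Y v = cnt e X v - if v = g + 1 then cnt e X (g + 1) else 0 := by
  have hA := hX.rn (e := e) (by omega) (i - 1)
  have hB := hX.rn (e := e) (by omega) i
  have armA : ∀ t, 0 < mult (rn e X (i - 1)) t → arm e X (i - 1 + e * t) = g + 1 := by
    intro t ht
    obtain ⟨z, hz, hz0⟩ := hA.exists_last_bead
    obtain ⟨h1, h2⟩ := mult_pos_iff.1 ht
    have h3 : t ≤ z := by
      by_contra hc
      have := bd_anti hA (show z + 1 ≤ t by omega)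
      omega
    have h4 := gp_mono hA h3
    have h5 : 0 < mult (rn e X (i - 1)) z := mult_pos_iff.2 ⟨by omega, bd_pos_of_mem hA hz le_rfl⟩
    have h6 := h.level₁ he hX h5
    have h7 := h.arm_lower he h6.1 h6.2.le
    rw [ind_mem hz] at h7
    have h8 : arm e X (i - 1 + e * t) ≤ arm e X (i - 1 + e * z) := by
      rcases h3.eq_or_lt with rfl | h3
      · exact le_rfl
      · refine hI _ _ ?_ (by rwa [mu_level]) (by rwa [mu_level])
        have : (e : ℤ) * t < e * z := mul_lt_mul_of_pos_left h3 (by omega)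
        omega
    have h9 := hmin _ ((mu_level e X (i - 1) t).symm ▸ ht)
    rcases ind_cases (rn e X i) (z - 1) with ⟨_, h10⟩ | ⟨_, h10⟩ <;> omega
  have armB : ∀ t, 0 < mult (rn e X i) t → arm e X (i + e * t) = g + 1 := by
    intro t ht
    obtain ⟨z, hz, hz0⟩ := hB.exists_last_bead
    obtain ⟨h1, h2⟩ := mult_pos_iff.1 ht
    have h3 : t ≤ z := by
      by_contra hc
      have := bd_anti hB (show z + 1 ≤ t by omega)
      omega
    have h4 := gp_mono hB h3
    have h5 : 0 < mult (rn e X i) z := mult_pos_iff.2 ⟨by omega, bd_pos_of_mem hB hz le_rfl⟩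
    have h6 := h.level₂ he hX h5
    have h7 := h.arm_upper he h6.1 h6.2.le
    rw [ind_mem hz] at h7
    have h8 : arm e X (i + e * t) ≤ arm e X (i + e * z) := by
      rcases h3.eq_or_lt with rfl | h3
      · exact le_rfl
      · refine hI _ _ ?_ (by rwa [mu_level]) (by rwa [mu_level])
        have : (e : ℤ) * t < e * z := mul_lt_mul_of_pos_left h3 (by omega)
        omega
    have h9 := hmin _ ((mu_level e X i t).symm ▸ ht)
    rcases ind_cases (rn e X (i - 1)) z with ⟨_, h10⟩ | ⟨_, h10⟩ <;> omega
  have hpair : ∀ v : ℤ, ∑ᶠ t : ℤ, (mult (rn e X (i - 1)) t *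
      (if arm e X (i - 1 + e * t) = v then 1 else 0) +
        mult (rn e X i) t * (if arm e X (i + e * t) = v then 1 else 0)) =
      if v = g + 1 then ∑ᶠ t, (mult (rn e X (i - 1)) t + mult (rn e X i) t) else 0 := by
    intro v
    have key : ∀ t : ℤ, mult (rn e X (i - 1)) t *
      (if arm e X (i - 1 + e * t) = v then 1 else 0) +
        mult (rn e X i) t * (if arm e X (i + e * t) = v then 1 else 0) =
        if v = g + 1 then mult (rn e X (i - 1)) t + mult (rn e X i) t else 0 := by
      intro t
      have h1 : mult (rn e X (i - 1)) t * (if arm e X (i - 1 + e * t) = v then 1 else 0) =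
          if v = g + 1 then mult (rn e X (i - 1)) t else 0 := by
        rcases (mult_nonneg (rn e X (i - 1)) t).eq_or_lt with h1 | h1
        · rw [← h1]; simp
        · rw [armA t h1]; simp [eq_comm]
      have h2 : mult (rn e X i) t * (if arm e X (i + e * t) = v then 1 else 0) =
          if v = g + 1 then mult (rn e X i) t else 0 := by
        rcases (mult_nonneg (rn e X i) t).eq_or_lt with h1 | h1
        · rw [← h1]; simp
        · rw [armB t h1]; simp [eq_comm]
      rw [h1, h2]
      split_ifs <;> simp
    rw [finsum_congr key]
    split_ifs with hv
    · rfl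
    · exact finsum_zero
  have houtside : (∑ᶠ q, open Classical in if (e : ℤ) ∣ q - i ∨ (e : ℤ) ∣ q - (i - 1) then 0
        else mu e X q * (if arm e X q = g + 1 then 1 else 0)) = 0 := by
    refine finsum_eq_zero_of_forall_eq_zero fun q => ?_
    split_ifs with h1 h2
    · rfl
    · rw [not_or] at h1
      rcases (mu_nonneg e X q).eq_or_lt with h3 | h3
      · rw [← h3, zero_mul]
      · have := h.outside he hX h1.1 h1.2 h3
        omega
    · rw [mul_zero]
  have hsum : ∑ᶠ t, (mult (rn e X (i - 1)) t + mult (rn e X i) t) = cnt e X (g + 1) := by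
    have := wsum_split he i (fun a => if a = (g : ℤ) + 1 then 1 else 0) hX
    beta_reduce at this
    rw [houtside, zero_add, hpair, if_pos rfl] at this
    exact this.symm
  obtain ⟨hN, s1, s2, s3, s4⟩ := pair_shape hA hB (fun t ht => by
      have h1 := h.level₁ he hX ht
      have h2 := h.arm_lower he h1.1 h1.2.le
      rw [armA t ht] at h2; omega) (fun t ht => by
      have h1 := h.level₂ he hX ht
      have h2 := h.arm_upper he h1.1 h1.2.le
      rw [armB t ht] at h2; omega) (hsum.trans hn) (by omega)
  obtain ⟨Y, hY⟩ := exists_E he hX (i := i) (by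
    have h1 := walk_succ hA hB (ch (rn e X (i - 1)))
    have h2 := walk_eq_bd hA hB (ch (rn e X (i - 1)) + 1)
    rw [ind_mem s1, ind_notMem s2] at h1
    have h3 : mW e X i ≤ walk (rn e X (i - 1)) (rn e X i) (ch (rn e X (i - 1))) := mW_le he hX i _
    omega)
  have hrel := hY.pairRel he hX
  have mY := hrel.maya'
  have hA' := mY.rn (e := e) (by omega) (i - 1)
  have hB' := mY.rn (e := e) (by omega) i
  -- Changing the charges by 1 and -1 lowers the total multiplicity by one exactly at the levels
  -- from `ch (rn e X i)` to `ch (rn e X (i - 1))`, which are all the levels having a movement.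
  have hN' : ∀ t, mult (rn e Y (i - 1)) t = 0 ∧ mult (rn e Y i) t = 0 := by
    intro t
    have h1 := mult_nonneg (rn e Y (i - 1)) t
    have h2 := mult_nonneg (rn e Y i) t
    have h3 := hN t
    rw [mult_eq hA, mult_eq hB] at h3
    have h4 := mult_eq hA' t
    have h5 := mult_eq hB' t
    rw [hY.ch_lower he hX] at h4
    rw [hY.ch_upper he hX] at h5
    have h6 := hrel.bd_eq t
    split_ifs at h3 <;> omega
  refine ⟨Y, hY, ?_, fun v => ?_⟩
  · have starts : ∀ q, 0 < mu e Y q → 0 < mu e X q ∧ arm e X q = arm e Y q := by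
      intro q hq
      rcases pair_or_outside e i q with ⟨h1, h2⟩ | ⟨t, rfl⟩ | ⟨t, rfl⟩
      · exact ⟨by rwa [mu_self, ← hrel.other q h1 h2], (hrel.arm_eq q h2).symm⟩
      · rw [mu_level, (hN' t).1] at hq; omega
      · rw [mu_level, (hN' t).2] at hq; omega
    intro q q' hqq hq hq'
    obtain ⟨h1, h2⟩ := starts q hq
    obtain ⟨h3, h4⟩ := starts q' hq'
    rw [← h2, ← h4]
    exact hI q q' hqq h1 h3
  · unfold cnt
    have hout := finsum_outside_eq (fun a => if a = v then 1 else 0) hrel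
    rw [wsum_split he i (fun a => if a = v then 1 else 0) hX, wsum_split he i _ mY]
    beta_reduce at hout ⊢
    rw [hpair, hsum, hout]
    simp only [hN', zero_mul, add_zero, finsum_zero]
    unfold cnt
    ring

/-- As arm length `g + 1` is missing, all movements on the pair have arm length `g`. This and the
difference of the charges force runner `i - 1` to have no movements. The inverse step moves its last
bead to runner `i`, where the new starts fill the `n` levels between the two charges, with arm
length `g + 1`. -/
theorem Env.inc_of_E (he : 2 ≤ e) (hX : IsMaya X) (h : Env e i g L U X) (hI : Inc e X)
    {n : ℕ} (hne : cnt e X (g + 1) = 0)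
    (hn : ch (rn e X (i - 1)) = ch (rn e X i) + n + 1) (hpos : 0 < n) {Y : Set ℤ}
    (hE : E e i Y X) :
    Inc e Y ∧ ∀ v, cnt e Y v = cnt e X v + if v = g + 1 then n else 0 := by
  have hA := hX.rn (e := e) (by omega) (i - 1)
  have hB := hX.rn (e := e) (by omega) i
  have hne' := (cnt_eq_zero_iff (by omega) hX _).1 hne
  have shapeA : ∀ t, 0 < mult (rn e X (i - 1)) t → arm e X (i - 1 + e * t) = g ∧
      t ∈ rn e X (i - 1) ∧ t - 1 ∈ rn e X i := by
    intro t ht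
    obtain ⟨z, hz, hz0⟩ := hA.exists_last_bead
    obtain ⟨h1, h2⟩ := mult_pos_iff.1 ht
    have h3 : t ≤ z := by
      by_contra hc
      have := bd_anti hA (show z + 1 ≤ t by omega)
      omega
    have h4 := gp_mono hA h3
    have h5 : 0 < mult (rn e X (i - 1)) z := mult_pos_iff.2 ⟨by omega, bd_pos_of_mem hA hz le_rfl⟩
    have h6 := h.level₁ he hX h5
    have h7 := h.arm_lower he h6.1 h6.2.le
    rw [ind_mem hz] at h7
    have h8 : arm e X (i - 1 + e * t) ≤ arm e X (i - 1 + e * z) := by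
      rcases h3.eq_or_lt with rfl | h3
      · exact le_rfl
      · refine hI _ _ ?_ (by rwa [mu_level]) (by rwa [mu_level])
        have : (e : ℤ) * t < e * z := mul_lt_mul_of_pos_left h3 (by omega)
        omega
    have h9 := hne' _ ((mu_level e X (i - 1) z).symm ▸ h5)
    have h10 := h.level₁ he hX ht
    have h11 := h.arm_lower he h10.1 h10.2.le
    rcases ind_cases (rn e X i) (z - 1) with ⟨_, h12⟩ | ⟨_, h12⟩ <;>
    rcases ind_cases (rn e X i) (t - 1) with ⟨h13, h14⟩ | ⟨h13, h14⟩ <;>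
    rcases ind_cases (rn e X (i - 1)) t with ⟨h15, h16⟩ | ⟨h15, h16⟩ <;>
    first
    | omega
    | exact ⟨by omega, h15, h13⟩
  have shapeB : ∀ t, 0 < mult (rn e X i) t → arm e X (i + e * t) = g ∧
      t ∈ rn e X (i - 1) ∧ t ∈ rn e X i := by
    intro t ht
    obtain ⟨z, hz, hz0⟩ := hB.exists_last_bead
    obtain ⟨h1, h2⟩ := mult_pos_iff.1 ht
    have h3 : t ≤ z := by
      by_contra hc
      have := bd_anti hB (show z + 1 ≤ t by omega)
      omega
    have h4 := gp_mono hB h3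
    have h5 : 0 < mult (rn e X i) z := mult_pos_iff.2 ⟨by omega, bd_pos_of_mem hB hz le_rfl⟩
    have h6 := h.level₂ he hX h5
    have h7 := h.arm_upper he h6.1 h6.2.le
    rw [ind_mem hz] at h7
    have h8 : arm e X (i + e * t) ≤ arm e X (i + e * z) := by
      rcases h3.eq_or_lt with rfl | h3
      · exact le_rfl
      · refine hI _ _ ?_ (by rwa [mu_level]) (by rwa [mu_level])
        have : (e : ℤ) * t < e * z := mul_lt_mul_of_pos_left h3 (by omega)
        omega
    have h9 := hne' _ ((mu_level e X i z).symm ▸ h5)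
    have h10 := h.level₂ he hX ht
    have h11 := h.arm_upper he h10.1 h10.2.le
    rcases ind_cases (rn e X (i - 1)) z with ⟨_, h12⟩ | ⟨_, h12⟩ <;>
    rcases ind_cases (rn e X i) t with ⟨h13, h14⟩ | ⟨h13, h14⟩ <;>
    rcases ind_cases (rn e X (i - 1)) t with ⟨h15, h16⟩ | ⟨h15, h16⟩ <;>
    first
    | omega
    | exact ⟨by omega, h15, h13⟩
  have topB : bd (rn e X i) (ch (rn e X i) + 1) = 0 := by
    by_contra hc
    have h1 := bd_sub_gp hB (ch (rn e X i) + 1)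
    have h2 := bd_nonneg (rn e X i) (ch (rn e X i) + 1)
    obtain ⟨v, -, -, h3, -⟩ := single_gap hB (fun t ht => (shapeB t ht).2.2)
      (s := ch (rn e X i) + 1) (mult_pos_iff.2 ⟨by omega, by omega⟩)
    omega
  have coreA : ∀ t, mult (rn e X (i - 1)) t = 0 := by
    intro t
    by_contra hc
    have ht : 0 < mult (rn e X (i - 1)) t := by
      have := mult_nonneg (rn e X (i - 1)) t; omega
    obtain ⟨v, h1, h2, h3, h4, -, -, h5⟩ := single_gap hA (fun t ht => (shapeA t ht).2.1) ht
    have h6 := (shapeA (ch (rn e X (i - 1))) (mult_pos_iff.2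
      ⟨by rw [h5 _ (by omega) (by omega)]; norm_num, bd_pos_of_mem hA h4 le_rfl⟩)).2.2
    have := bd_pos_of_mem hB h6 (t := ch (rn e X i) + 1) (by omega)
    omega
  set p := ch (rn e X (i - 1)) with hp
  set q := ch (rn e X i) with hq
  have cA := bd_sub_gp hA p
  have gpA : gp (rn e X (i - 1)) p = 0 := by
    have := coreA p
    rwa [mult, min_eq_left (by omega)] at this
  have beadA : ∀ t, t < p → t ∈ rn e X (i - 1) := fun t ht => by
    by_contra hc
    have := gp_pos_of_notMem hA hc ht
    omega
  have gapA : ∀ t, p ≤ t → t ∉ rn e X (i - 1) := fun t ht hc => by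
    have := bd_pos_of_mem hA hc ht
    omega
  have gpA0 : ∀ t, t ≤ p → gp (rn e X (i - 1)) t = 0 := fun t ht =>
    gp_eq_zero fun u hu => beadA u (by omega)
  have bdA0 : ∀ t, p ≤ t → bd (rn e X (i - 1)) t = 0 := fun t ht =>
    bd_eq_zero fun u hu => gapA u (by omega)
  have gapB : ∀ t, q < t → t ∉ rn e X i := fun t ht hc => by
    have := bd_pos_of_mem hB hc (t := q + 1) (by omega)
    omega
  have bdB0 : ∀ t, q < t → bd (rn e X i) t = 0 := fun t ht =>
    bd_eq_zero fun u hu => gapB u (by omega)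
  have mY := hE.isMaya.2 hX
  have hrel := hE.pairRel he mY
  obtain ⟨x, h1, h2⟩ := (E_iff_firstMin he mY).1 hE
  -- Up to `p` runner `i - 1` is full and the walk is minus the number of gaps of runner `i`. It
  -- falls at `p - 1` and is constant from `p` on, so its first minimum is `p`.
  obtain rfl : x = p - 1 := by
    have : FirstMin (W e X i) p := by
      have w1 : ∀ t, t ≤ p → W e X i t = -gp (rn e X i) t := fun t ht => by
        unfold W walk; rw [gpA0 t ht]; ring
      have w2 : W e X i p = W e X i (p - 1) - 1 := by
        have := walk_succ hA hB (p - 1)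
        rw [sub_add_cancel, ind_mem (beadA _ (by omega)), ind_notMem (gapB _ (by omega))] at this
        unfold W; omega
      have w3 : ∀ t, t < p → W e X i p < W e X i t := fun t ht => by
        have := gp_mono hB (show t ≤ p - 1 by omega)
        rw [w2, w1 t ht.le, w1 (p - 1) (by omega)]
        omega
      refine ⟨fun t => ?_, w3⟩
      rcases lt_or_ge t p with ht | ht
      · exact (w3 t ht).le
      · unfold W
        rw [walk_eq_bd hA hB, walk_eq_bd hA hB, bdA0 p le_rfl, bdA0 t ht, bdB0 p (by omega),
          bdB0 t (by omega)]
    have := h1.unique this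
    omega
  obtain ⟨a1, a2, -⟩ := lower_counts he mY h2
  obtain ⟨b1, b2, -⟩ := upper_counts he mY h2
  have multA : ∀ t, mult (rn e Y (i - 1)) t = 0 := fun t => by
    unfold mult
    have h3 := a1 t
    have h4 := a2 t
    have h5 := gp_nonneg (rn e Y (i - 1)) t
    have h6 := bd_nonneg (rn e Y (i - 1)) t
    rcases gtInd_cases (p - 1) t with ⟨h7, h8⟩ | ⟨h7, h8⟩
    · rw [bdA0 t (by omega)] at h4
      rw [min_eq_right (by omega)]; omega
    · rw [gpA0 t (by omega)] at h3
      rw [min_eq_left (by omega)]; omega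
  have multB : ∀ t, mult (rn e Y i) t = mult (rn e X i) t +
      if q + 1 ≤ t ∧ t ≤ p - 1 then 1 else 0 := fun t => by
    unfold mult
    have h3 := b1 t
    have h4 := b2 t
    have h5 := gp_nonneg (rn e Y i) t
    have h6 := bd_nonneg (rn e Y i) t
    have h9 := bd_sub_gp hB t
    rcases gtInd_cases (p - 1) t with ⟨h7, h8⟩ | ⟨h7, h8⟩
    · rw [if_neg (by omega)]
      rw [bdB0 t (by omega)] at h4 h9 ⊢
      rw [min_eq_right (by omega), min_eq_right (by omega)]
      omega
    · rcases le_or_gt t q with h10 | h10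
      · rw [if_neg (by omega), min_eq_left (by omega), min_eq_left (by omega)]
        omega
      · rw [if_pos (by omega)]
        rw [bdB0 t h10] at h4 h9 ⊢
        rw [min_eq_right (by omega), min_eq_right (by omega)]
        omega
  have armY : ∀ t, arm e Y (i + e * t) = arm e X (i + e * t) := fun t =>
    (hrel.arm_eq _ (not_dvd_upper he i t)).symm
  have boundU : p ≤ U := by
    by_contra hc
    exact h.notMem₁ (p - 1) (by omega) (beadA _ (by omega))
  have boundL : L ≤ q := by
    have h3 := bd_sub_gp hB (q + 1)
    rw [topB] at h3
    obtain ⟨u, hu, hu'⟩ := (gp_pos_iff hB (q + 1)).1 (by omega)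
    by_contra hc
    exact hu' (h.mem₂ u (by omega))
  have armNew : ∀ t, q + 1 ≤ t → t ≤ p - 1 → arm e X (i + e * t) = g + 1 := fun t h3 h4 => by
    rw [h.arm_upper he (by omega) (by omega), ind_mem (beadA t (by omega)),
      ind_notMem (gapB t (by omega))]
    ring
  constructor
  · have starts : ∀ s, 0 < mu e Y s →
        (0 < mu e X s ∧ arm e Y s = arm e X s ∧
          ((s < i - 1 + e * L ∧ arm e X s ≤ g) ∨ (i + e * U < s ∧ g + 2 ≤ arm e X s) ∨
            ∃ t, s = i + e * t ∧ t ≤ q ∧ arm e X s = g)) ∨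
        ∃ t, s = i + e * t ∧ q + 1 ≤ t ∧ t ≤ p - 1 ∧ arm e Y s = g + 1 := by
      intro s hs
      rcases pair_or_outside e i s with ⟨h3, h4⟩ | ⟨t, rfl⟩ | ⟨t, rfl⟩
      · have h5 : 0 < mu e X s := by rwa [mu_self, hrel.other s h3 h4]
        left
        refine ⟨h5, (hrel.arm_eq s h4).symm, ?_⟩
        rcases h.outside he hX h3 h4 h5 with h6 | h6
        · exact Or.inl h6
        · exact Or.inr (Or.inl h6)
      · rw [mu_level, multA] at hs; omega
      · rw [mu_level, multB] at hs
        split_ifs at hs with h3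
        · exact Or.inr ⟨t, rfl, h3.1, h3.2, by rw [armY, armNew t h3.1 h3.2]⟩
        · rw [add_zero] at hs
          refine Or.inl ⟨by rwa [mu_level], armY t, Or.inr (Or.inr ⟨t, rfl, ?_, (shapeB t hs).1⟩)⟩
          by_contra hc
          have := (mult_pos_iff.1 hs).2
          rw [bdB0 t (by omega)] at this
          omega
    have mono : ∀ s t : ℤ, s ≤ t → (e : ℤ) * s ≤ e * t := fun s t hst =>
      mul_le_mul_of_nonneg_left hst (by omega)
    intro s s' hss hs hs'
    rcases starts s hs with ⟨h3, h4, h5⟩ | ⟨t, h3, h4, h5, h6⟩ <;>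
    rcases starts s' hs' with ⟨h3', h4', h5'⟩ | ⟨t', h3', h4', h5', h6'⟩
    · rw [h4, h4']; exact hI s s' hss h3 h3'
    · rw [h4, h6']
      rcases h5 with ⟨-, h5⟩ | ⟨h5, -⟩ | ⟨t, -, -, h5⟩
      · omega
      · have := mono t' U (by omega); omega
      · omega
    · rw [h4', h6]
      rcases h5' with ⟨h7, -⟩ | ⟨-, h7⟩ | ⟨t', h7, h8, -⟩
      · have := mono L t (by omega); omega
      · omega
      · have := mono t' t (by omega); omega
    · omega
  · intro v
    unfold cnt
    have hout := finsum_outside_eq (fun a => if a = v then 1 else 0) hrel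
    rw [wsum_split he i _ hX, wsum_split he i _ mY]
    beta_reduce at hout ⊢
    rw [hout, add_assoc]
    congr 1
    have key : ∀ t : ℤ, mult (rn e Y (i - 1)) t * (if arm e Y (i - 1 + e * t) = v then 1 else 0) +
        mult (rn e Y i) t * (if arm e Y (i + e * t) = v then 1 else 0) =
        (mult (rn e X (i - 1)) t * (if arm e X (i - 1 + e * t) = v then 1 else 0) +
          mult (rn e X i) t * (if arm e X (i + e * t) = v then 1 else 0)) +
        if q + 1 ≤ t ∧ t ≤ p - 1 then (if v = g + 1 then 1 else 0) else 0 := by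
      intro t
      rw [multA, coreA, multB, armY, zero_mul, zero_mul, zero_add, zero_add, add_mul]
      congr 1
      split_ifs with h3 h4 h5 h5 <;> try simp
      · have := armNew t h3.1 h3.2; omega
      · have := armNew t h3.1 h3.2; omega
    rw [finsum_congr key, finsum_add_distrib _ (support_ite_Icc _ _ _)]
    · congr 1
      split_ifs with hv
      · rw [finsum_ite_Icc _ _ (by omega)]; omega
      · simp
    · refine (mult_finite hB).subset fun t ht => ?_
      simp only [Function.mem_support, coreA, zero_mul, zero_add] at ht ⊢
      intro hc; apply ht; rw [hc, zero_mul]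

end

/-! ### Induction on the weight -/

theorem mem_iff_lt_charge {A : Set ℤ} (hA : IsMaya A) (h : ∀ t, mult A t = 0) (t : ℤ) :
    t ∈ A ↔ t < ch A := by
  have h1 := bd_sub_gp hA (ch A)
  have h2 := h (ch A)
  rw [mult, min_eq_left (by omega)] at h2
  constructor
  · intro ht
    by_contra hc
    have := bd_pos_of_mem hA ht (show ch A ≤ t by omega)
    omega
  · intro ht
    by_contra hc
    have := gp_pos_of_notMem hA hc ht
    omega

theorem eq_vac_of_charge {e : ℕ} (he : 0 < e) {X : Set ℤ} (hX : IsMaya X)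
    (h : ∀ q, mu e X q = 0) (hc : ∀ r, ch (rn e X r) = -(r / e)) : X = vac := by
  ext z
  have h1 := mem_iff_lt_charge (hX.rn he z) (fun t => by rw [← mu_level, h]) 0
  rw [hc, mem_rn, mul_zero, add_zero] at h1
  rw [h1]
  have h2 : z / e < 0 ↔ z < 0 := by
    rw [Int.ediv_lt_iff_lt_mul (by exact_mod_cast he), zero_mul]
  rw [show z ∈ vac ↔ z < 0 from Iff.rfl, ← h2]
  omega

theorem mu_eq_zero_of_cnt {e : ℕ} (he : 0 < e) {X : Set ℤ} (hX : IsMaya X)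
    (h : ∀ v, cnt e X v = 0) (q : ℤ) : mu e X q = 0 := by
  by_contra hc
  have h1 : 0 < mu e X q := lt_of_le_of_ne (mu_nonneg _ _ _) (Ne.symm hc)
  exact (cnt_eq_zero_iff he hX _).1 (h (arm e X q)) q h1 rfl

theorem mu_vac {e : ℕ} (he : 0 < e) (q : ℤ) : mu e vac q = 0 := by
  by_contra hc
  have h1 : 0 < mu e vac q := lt_of_le_of_ne (mu_nonneg _ _ _) (Ne.symm hc)
  obtain ⟨h2, h3⟩ := mult_pos_iff.1 h1
  obtain ⟨u, hu, hu'⟩ := (gp_pos_iff (vac_isMaya.rn he q) 0).1 h2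
  obtain ⟨v, hv, hv'⟩ := (bd_pos_iff (vac_isMaya.rn he q) 0).1 h3
  rw [mem_rn_vac he] at hu' hv'
  omega

/-- With the charges of the empty partition and no movements, the abacus is that of the empty
partition, which is its own image. -/
theorem mirror_zero {e : ℕ} (he : 3 ≤ e) {c p : ℤ → ℤ} (hc : ∀ v, c v = 0) (hp : Balanced e p) :
    Mirror e c p := by
  rw [hp.descent (by omega) (P := Mirror e c) fun i p => Mirror.of_sw he i]
  intro n X Y h hch _ hcnt
  have h0 := mu_eq_zero_of_cnt (e := e) (by omega) h.isMaya.1 (fun v => by rw [hcnt, hc])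
  obtain rfl := eq_vac_of_charge (by omega) h.isMaya.1 h0 hch
  obtain rfl := h.unique (e := e) (by omega) .vac
  refine ⟨fun q q' _ hq _ => ?_, fun v => ?_⟩
  · rw [mu_vac (by omega)] at hq; omega
  · rw [hcnt, hc, hc]

/-- Charges for which the runners `0` and `1` have charges `a + n - 1` and `a`, the next `g` runners
lie far before them and the remaining ones far after them. -/
theorem exists_far_charges {e : ℕ} (he : 3 ≤ e) {g : ℕ} {n K : ℤ} (hn : 0 < n)
    (hK : n ≤ K) : ∃ (p : ℤ → ℤ) (a : ℤ), Balanced e p ∧ p 0 = a + n - 1 ∧ p 1 = a ∧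
      (∀ j : ℕ, j < g → j < e - 2 → p (2 + j) ≤ a - K) ∧
      ∀ j : ℕ, g ≤ j → j < e - 2 → a + K ≤ p (2 + j) := by
  obtain ⟨m, rfl⟩ : ∃ m, e = m + 3 := ⟨e - 3, by omega⟩
  -- Runner 2 must be far after the pair if `g = 0` and far before it otherwise. The sign of `a` is
  -- chosen so that the charge balancing the total falls on the required side.
  obtain ⟨a, b, hab⟩ : ∃ a b : ℤ, (g = 0 ∧ a = -K ∧ b = 0) ∨ (0 < g ∧ a = K ∧ b = 2 * K) := by
    rcases Nat.eq_zero_or_pos g with h | h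
    · exact ⟨_, _, Or.inl ⟨h, rfl, rfl⟩⟩
    · exact ⟨_, _, Or.inr ⟨h, rfl, rfl⟩⟩
  let F : ℕ → ℤ := fun j => if j + 1 < g then 0 else b
  let s : ℤ := -(∑ j ∈ Finset.range m, F j + 2 * a + n - 1)
  let f : ℕ → ℤ := fun j => match j with
    | 0 => a + n - 1
    | 1 => a
    | 2 => s
    | j + 3 => F j
  have hE : (0 : ℤ) < (m + 3 : ℕ) := by push_cast; omega
  let p : ℤ → ℤ := fun r => f (r % (m + 3 : ℕ)).toNat - r / (m + 3 : ℕ)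
  have hpf : ∀ j : ℕ, j < m + 3 → p j = f j := fun j hj => by
    have h1 : (j : ℤ) % (m + 3 : ℕ) = j := Int.emod_eq_of_lt (by omega) (by omega)
    have h2 : (j : ℤ) / (m + 3 : ℕ) = 0 := Int.ediv_eq_zero_of_lt (by omega) (by omega)
    simp only [p]
    rw [h1, h2, sub_zero, Int.toNat_natCast]
  have hF : 0 ≤ ∑ j ∈ Finset.range m, F j := Finset.sum_nonneg fun j _ => by
    simp only [F]; split_ifs <;> omega
  have hF0 : g = 0 → ∑ j ∈ Finset.range m, F j = 0 := fun hg => Finset.sum_eq_zero fun j _ => by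
    simp only [F]; rw [if_neg (by omega)]; omega
  have hs : p 2 = s := hpf 2 (by omega)
  have hpF : ∀ j : ℕ, j < m → p (2 + (j + 1 : ℕ)) = F j := fun j hj => by
    have := hpf (j + 3) (by omega)
    rw [show (2 : ℤ) + (j + 1 : ℕ) = (j + 3 : ℕ) by push_cast; ring, this]
  refine ⟨p, a, ⟨fun r => ?_, ?_⟩, hpf 0 (by omega), hpf 1 (by omega), fun j hj hj' => ?_,
    fun j hj hj' => ?_⟩
  · simp only [p]
    rw [Int.add_emod_right, Int.add_ediv_of_dvd_right (dvd_refl _), Int.ediv_self hE.ne']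
    ring
  · rw [Finset.sum_congr rfl fun j hj => hpf j (Finset.mem_range.1 hj), Finset.sum_range_succ',
      Finset.sum_range_succ', Finset.sum_range_succ']
    simp only [s]
    ring
  · rcases j with _ | j
    · rw [Nat.cast_zero, add_zero, hs]
      simp only [s]; omega
    · rw [hpF j (by omega)]
      simp only [F]; rw [if_pos hj]; omega
  · rcases j with _ | j
    · rw [Nat.cast_zero, add_zero, hs]
      have := hF0 (by omega)
      simp only [s]; omega
    · rw [hpF j (by omega)]
      simp only [F]; rw [if_neg (by omega)]; omega

/-- Induction on the weight, after moving to charges for which the movements of least arm length can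
all be deleted at once. -/
theorem mirror_of_balanced {e : ℕ} (he : 3 ≤ e) (w : ℕ) {c p : ℤ → ℤ} (hp : Balanced e p)
    (hc0 : ∀ v, 0 ≤ c v) (hc1 : ∀ v, c v ≠ 0 → 1 ≤ v ∧ v ≤ e - 1)
    (hw : ∑ v ∈ Finset.range (e + 1), c v = w) : Mirror e c p := by
  induction w using Nat.strong_induction_on generalizing c p with
  | _ w ih =>
    have he2 : 2 ≤ e := by omega
    by_cases hz : ∀ v, c v = 0
    · exact mirror_zero he hz hp
    push Not at hz
    obtain ⟨k, hk, hmin⟩ := exists_first (P := fun v => c v ≠ 0) 1 (fun v hv => (hc1 v hv).1) hz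
    obtain ⟨hk1, hk2⟩ := hc1 k hk
    obtain ⟨g, rfl⟩ : ∃ g : ℕ, k = g + 1 := ⟨(k - 1).toNat, by omega⟩
    have hn : 0 < c (g + 1) := lt_of_le_of_ne (hc0 _) (Ne.symm hk)
    set n := c (g + 1) with hn_def
    have hg : g ≤ e - 2 := by omega
    have hnw : n ≤ w := by
      rw [← hw]
      have := Finset.single_le_sum (f := fun v : ℕ => c v) (s := Finset.range (e + 1))
        (fun v _ => hc0 v) (a := g + 1) (Finset.mem_range.2 (by omega))
      simpa using this
    -- The distance must exceed twice the weight, since both the pair and the other runners deviate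
    -- from their charges by up to the weight. The rest covers the difference `n - 1` of the pair
    -- for `X` and `n + 1` for `V`, where `n ≤ w`.
    obtain ⟨ps, a, hps, p0, p1, plow, phigh⟩ :=
      exists_far_charges he (g := g) (n := n) (K := 3 * w + 3) hn (by omega)
    rw [Mirror.iff_of_balanced he hp hps]
    intro m X Y h hch hI hcnt
    obtain ⟨hX, hY⟩ := h.isMaya
    have tX : wtot e X = w := by
      rw [wtot_eq_sum_cnt (by omega) hX, ← hw]
      exact Finset.sum_congr rfl fun v _ => hcnt v
    have ch0 : ch (rn e X (1 - 1)) = a + n - 1 := by rw [sub_self, hch, p0]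
    have ch1 : ch (rn e X 1) = a := by rw [hch, p1]
    have env : Env e 1 g (a - w) (a + n - 1 + w) X := by
      refine env_of_charges he2 hX hg tX.le (by omega) (by omega) (by omega) (fun j hj => ?_)
        fun j hj hj' => ?_
      · have := plow j hj (by omega)
        rw [hch, show (1 : ℤ) + 1 + j = 2 + j by ring]; omega
      · have := phigh j hj hj'
        rw [hch, show (1 : ℤ) + 1 + j = 2 + j by ring]; omega
    obtain ⟨Z, hZ, hIZ, hcZ⟩ := env.exists_remove he2 hX hI (fun q hq => by
        apply hmin
        rw [← hcnt, Ne, cnt_eq_zero_iff (by omega) hX]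
        push Not
        exact ⟨q, hq, rfl⟩) (by rw [hcnt, ch0, ch1]; omega) (by rw [hcnt]; exact hn)
    simp only [hcnt, ← hn_def] at hcZ
    obtain ⟨V, hV, m', -, hMK⟩ := h.down he hZ
    obtain ⟨mZ, mV⟩ := hMK.isMaya
    set c' : ℤ → ℤ := fun v => c v - if v = g + 1 then n else 0 with hc'
    have sum' : ∑ v ∈ Finset.range (e + 1), c' v = w - n := by
      simp only [hc', Finset.sum_sub_distrib]
      rw [hw, Finset.sum_eq_single (g + 1)]
      · rw [if_pos (by push_cast; ring)]
      · intro b _ hb; rw [if_neg (by omega)]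
      · intro hb; exact absurd (Finset.mem_range.2 (by omega)) hb
    obtain ⟨hIV, hcV⟩ := ih (w - n).toNat (by omega) (c := c') (hMK.balanced he2)
      (fun v => by
        simp only [hc']
        have := hc0 v
        split_ifs with hv
        · subst hv; omega
        · omega)
      (fun v hv => hc1 v fun hv' => hv (by
        simp only [hc']
        rw [if_neg fun hv'' => by subst hv''; omega, hv', sub_zero]))
      (by rw [sum']; omega) m' Z V hMK (fun r => rfl) hIZ hcZ
    have tV : wtot e V ≤ w := by
      rw [wtot_eq_sum_cnt (by omega) mV]
      have h1 := Finset.sum_range_reflect (fun j : ℕ => c' j) (e + 1)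
      rw [sum'] at h1
      have h2 : ∑ v ∈ Finset.range (e + 1), cnt e V v = w - n := by
        rw [← h1]
        refine Finset.sum_congr rfl fun v hv => ?_
        rw [Finset.mem_range] at hv
        rw [hcV]
        congr 1
        omega
      omega
    have hZ0 := hZ.ch_lower he2 hX
    have hZ1 := hZ.ch_upper he2 hX
    have cV0 : ch (rn e V (-1 - 1)) = 2 - a := by
      rw [hMK.charge he2, hZ1, ch1]; ring
    have cV1 : ch (rn e V (-1)) = -(a + n - 1) := by
      have := hMK.charge he2 0
      rw [sub_zero] at this
      rw [this, show (0 : ℤ) = 1 - 1 by ring, hZ0, ch0]; ring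
    have cVj : ∀ j : ℕ, j < e - 2 → ch (rn e V (-1 + 1 + j)) = -ps (2 + (e - 3 - j : ℕ)) := by
      intro j hj
      have h1 := hMK.charge he2 (-1 - j)
      rw [show -1 - (-1 - (j : ℤ)) = -1 + 1 + j by ring] at h1
      have h2 := ch_shift mZ (e := e) (by omega) (-1 - j) 1
      rw [mul_one] at h2
      have h3 := hZ.pairRel he2 hX |>.other (-1 - j + e)
        (not_dvd_of_pos_lt (by omega) (by omega)) (by
          intro hd
          have := not_dvd_of_pos_lt (e := e) (a := -1 - j + e - (1 - 1)) (by omega) (by omega)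
          exact this hd)
      rw [h3, hch] at h2
      rw [h1, show (2 : ℤ) + (e - 3 - j : ℕ) = -1 - j + e by omega]
      omega
    -- Negating the charges exchanges the runners far before and far after the pair, so `g` becomes
    -- `e - 2 - g`, and the arm length `g + 1` becomes `e - (g + 1)`.
    have envV : Env e (-1) (e - 2 - g) (-(a + n - 1) - w) (2 - a + w) V := by
      refine env_of_charges he2 mV (by omega) tV (by omega) (by omega) (by omega) (fun j hj => ?_)
        fun j hj hj' => ?_
      · have := phigh (e - 3 - j) (by omega) (by omega)
        rw [cVj j (by omega)]; omega
      · have := plow (e - 3 - j) (by omega) (by omega)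
        rw [cVj j (by omega)]; omega
    obtain ⟨r1, r2⟩ := envV.inc_of_E he2 mV hIV (n := n.toNat) (by
        rw [hcV, show (e : ℤ) - (((e - 2 - g : ℕ) : ℤ) + 1) = g + 1 by omega]
        simp only [hc', if_true]; omega) (by rw [cV0, cV1]; omega) (by omega) hV
    refine ⟨r1, fun v => ?_⟩
    rw [r2, hcV]
    simp only [hc']
    split_ifs <;> omega

/-! ### Bead movements of partitions -/

theorem armLength_eq (e : ℕ) (lam : YoungDiagram) (q : ℤ) :
    (armLength e lam q : ℤ) = arm e (beta lam) q := by
  classical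
  have inj : Function.Injective fun j : ℕ => q - e + 1 + (j : ℤ) := fun a b hab => by
    simpa using hab
  have : Set.Ioc (q - e) q \ beta lam =
      (((Finset.range e).filter fun j : ℕ => q - e + 1 + (j : ℤ) ∉ beta lam).map ⟨_, inj⟩ :
        Finset ℤ) := by
    ext z
    simp only [Set.mem_sdiff, Set.mem_Ioc, Finset.coe_map, Function.Embedding.coeFn_mk,
      Set.mem_image, Finset.mem_coe, Finset.mem_filter, Finset.mem_range]
    constructor
    · rintro ⟨⟨h1, h2⟩, h3⟩
      refine ⟨(z - (q - e + 1)).toNat, ⟨by omega, ?_⟩, by omega⟩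
      rwa [show q - e + 1 + ((z - (q - e + 1)).toNat : ℤ) = z by omega]
    · rintro ⟨j, ⟨h1, h2⟩, rfl⟩
      exact ⟨⟨by omega, by omega⟩, h2⟩
  unfold armLength
  rw [this, Set.ncard_coe_finset, Finset.card_map, Finset.card_filter]
  unfold arm
  push_cast
  refine Finset.sum_congr rfl fun j _ => ?_
  rcases ind_cases (beta lam) (q - e + 1 + j) with ⟨h, h'⟩ | ⟨h, h'⟩
  · rw [h', if_neg (not_not.2 h)]; rfl
  · rw [h', if_pos h]; rfl

theorem wt_eq {e : ℕ} (he : 0 < e) (lam : YoungDiagram) (b : ℤ) :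
    (wt e lam b : ℤ) = gp (rn e (beta lam) b) 0 := by
  have he' : (0 : ℤ) < e := by exact_mod_cast he
  unfold wt gp
  congr 1
  rw [← Set.ncard_image_of_injective (f := fun u : ℤ => b + e * u) {u | u < 0 ∧ u ∉ rn e (beta lam) b}
    fun s t hst => by
      have h1 : (e : ℤ) * s = e * t := by simpa using hst
      exact mul_left_cancel₀ (by omega) h1]
  congr 1
  ext x
  simp only [Set.mem_ofPred_eq, Set.mem_image, mem_rn]
  constructor
  · rintro ⟨h1, h2, h3⟩
    obtain ⟨u, rfl⟩ := exists_level h2.symm.dvd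
    exact ⟨u, ⟨by nlinarith, h3⟩, rfl⟩
  · rintro ⟨u, ⟨h1, h2⟩, rfl⟩
    refine ⟨by nlinarith, Int.ModEq.symm ?_, h2⟩
    exact Int.modEq_iff_dvd.2 ⟨u, by ring⟩

-- A bead at level `t ≥ 0` is counted exactly when fewer than `gp A 0` beads lie in `[0, t)`, so
-- only the first `gp A 0` beads count. For large `n` this gives the formula `mult`.
open Classical in
theorem card_levels {A : Set ℤ} (hA : IsMaya A) (n : ℕ) :
    (((Finset.range n).filter fun t : ℕ => (t : ℤ) ∈ A ∧ (t : ℤ) < gp A t).card : ℤ) =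
      min (gp A 0) (bd A 0 - bd A n) := by
  induction n with
  | zero =>
    have := gp_nonneg A 0
    simp [this]
  | succ n ih =>
    have h1 := bd_succ hA n
    have h2 := bd_sub_gp hA n
    have h3 := bd_sub_gp hA 0
    rw [Finset.range_add_one, Finset.filter_insert]
    push_cast
    rcases ind_cases A n with ⟨h4, h4'⟩ | ⟨h4, h4'⟩
    · by_cases h5 : (n : ℤ) < gp A n
      · rw [if_pos ⟨h4, h5⟩, Finset.card_insert_of_notMem (by simp)]
        push_cast
        rw [ih]; omega
      · rw [if_neg fun hc => h5 hc.2, ih]; omega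
    · rw [if_neg fun hc => h4 hc.1, ih]; omega

theorem mem_beadMovements {e : ℕ} (he : 0 < e) (lam : YoungDiagram) (p : ℤ ×ₗ ℤ) :
    p ∈ beadMovements e lam ↔ ∃ (q : ℤ) (t : ℕ), p = toLex (q, q + e * t) ∧
      (t : ℤ) ∈ rn e (beta lam) q ∧ (t : ℤ) < gp (rn e (beta lam) q) t := by
  have key : ∀ (q : ℤ) (t : ℕ), (t < wt e lam (q + e * t) ↔
      (t : ℤ) < gp (rn e (beta lam) q) t) := fun q t => by
    have h1 := wt_eq he lam (q + e * t)
    rw [gp_shift, zero_add] at h1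
    omega
  unfold beadMovements
  constructor
  · rintro ⟨b, hb, j, hj, rfl⟩
    have hbj : b = b - j * e + e * j := by ring
    refine ⟨b - j * e, j, by rw [← hbj], ?_, (key _ _).1 (by rwa [← hbj])⟩
    rwa [mem_rn, ← hbj]
  · rintro ⟨q, t, rfl, h1, h2⟩
    refine ⟨q + e * t, h1, t, (key q t).2 h2, ?_⟩
    rw [show q + e * t - t * e = q by ring]

theorem card_start {e : ℕ} (he : 0 < e) (lam : YoungDiagram) (q : ℤ) :
    (((beadMovements_finite e lam).toFinset.filter fun p => (ofLex p).1 = q).card : ℤ) =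
      mu e (beta lam) q := by
  classical
  have hA := (beta_isMaya lam).rn he q
  obtain ⟨N, hN⟩ := hA.2
  have h0 : bd (rn e (beta lam) q) (N.toNat : ℤ) = 0 := bd_eq_zero fun u hu => hN u (by omega)
  have h1 := card_levels hA N.toNat
  rw [h0, sub_zero] at h1
  rw [mu_self, mult, ← h1]
  have inj : Function.Injective fun t : ℕ => toLex (q, q + (e : ℤ) * t) := fun s t hst => by
    have h2 : q + (e : ℤ) * s = q + e * t := congrArg (fun x => (ofLex x).2) hst
    have h3 : (e : ℤ) * s = e * t := by omega
    exact_mod_cast mul_left_cancel₀ (by exact_mod_cast he.ne') h3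
  rw [← Finset.card_image_of_injective _ inj]
  congr 2
  ext p
  simp only [Finset.mem_filter, Set.Finite.mem_toFinset, Finset.mem_image, Finset.mem_range]
  rw [mem_beadMovements he]
  constructor
  · rintro ⟨⟨q', t, rfl, h2, h3⟩, h4⟩
    obtain rfl : q' = q := h4
    refine ⟨t, ⟨?_, h2, h3⟩, rfl⟩
    by_contra hc
    exact hN t (by omega) h2
  · rintro ⟨t, ⟨-, h2, h3⟩, rfl⟩
    exact ⟨⟨q, t, rfl, h2, h3⟩, rfl⟩

theorem count_zTuple {e : ℕ} (he : 0 < e) (lam : YoungDiagram) (v : ℤ) :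
    ((zTuple e lam).count v : ℤ) = cnt e (beta lam) v := by
  classical
  have hX := beta_isMaya lam
  unfold zTuple
  rw [← Multiset.coe_count, ← Multiset.map_coe, Finset.sort_eq, Multiset.count_map]
  change (((beadMovements_finite e lam).toFinset.filter
    fun p => v = (armLength e lam (ofLex p).1 : ℤ)).card : ℤ) = _
  rw [Finset.card_eq_sum_card_fiberwise (f := fun p => (ofLex p).1) (t := (mu_finite he hX).toFinset)]
  · unfold cnt
    rw [wsum_eq_sum he hX]
    push_cast
    refine Finset.sum_congr rfl fun q _ => ?_
    rw [Finset.filter_filter, ← card_start he lam q]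
    by_cases h : arm e (beta lam) q = v
    · rw [if_pos h, mul_one]
      congr 2
      ext p
      simp only [Finset.mem_filter]
      refine and_congr_right fun _ => ⟨fun h => h.2, fun h1 => ⟨?_, h1⟩⟩
      rw [armLength_eq, h1, h]
    · rw [if_neg h, mul_zero]
      rw [Nat.cast_eq_zero, Finset.card_eq_zero, Finset.filter_eq_empty_iff]
      rintro p - ⟨h1, h2⟩
      rw [armLength_eq, h2] at h1
      exact h h1.symm
  · intro p hp
    have hp' := (Finset.mem_filter.1 (Finset.mem_coe.1 hp)).1
    simp only [Finset.mem_coe, Set.Finite.mem_toFinset, Function.mem_support]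
    rw [← card_start he lam]
    intro hc
    rw [Nat.cast_eq_zero, Finset.card_eq_zero, Finset.filter_eq_empty_iff] at hc
    exact hc hp' rfl

theorem exists_movement {e : ℕ} (he : 0 < e) {lam : YoungDiagram} {q : ℤ}
    (h : 0 < mu e (beta lam) q) :
    ∃ p ∈ (beadMovements_finite e lam).toFinset, (ofLex p).1 = q := by
  rw [← card_start he lam, Nat.cast_pos, Finset.card_pos] at h
  obtain ⟨p, hp⟩ := h
  exact ⟨p, (Finset.mem_filter.1 hp).1, (Finset.mem_filter.1 hp).2⟩

theorem mu_pos_of_movement {e : ℕ} (he : 0 < e) {lam : YoungDiagram} {p : ℤ ×ₗ ℤ}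
    (hp : p ∈ (beadMovements_finite e lam).toFinset) : 0 < mu e (beta lam) (ofLex p).1 := by
  rw [← card_start he lam, Nat.cast_pos, Finset.card_pos]
  exact ⟨p, Finset.mem_filter.2 ⟨hp, rfl⟩⟩

theorem zTuple_pairwise_iff {e : ℕ} (he : 0 < e) (lam : YoungDiagram) :
    (zTuple e lam).Pairwise (· ≤ ·) ↔ Inc e (beta lam) := by
  have hs := Finset.sortedLT_sort (beadMovements_finite e lam).toFinset
  have hs' : List.Pairwise (· < ·) ((beadMovements_finite e lam).toFinset.sort (· ≤ ·)) :=
    hs.pairwise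
  unfold zTuple
  rw [List.pairwise_map]
  constructor
  · intro h q q' hqq hq hq'
    obtain ⟨p, hp, rfl⟩ := exists_movement he hq
    obtain ⟨p', hp', rfl⟩ := exists_movement he hq'
    have hlt : p < p' := Prod.Lex.lt_iff.2 (Or.inl hqq)
    obtain ⟨i, hi, rfl⟩ := List.getElem_of_mem ((Finset.mem_sort (· ≤ ·)).2 hp)
    obtain ⟨j, hj, rfl⟩ := List.getElem_of_mem ((Finset.mem_sort (· ≤ ·)).2 hp')
    have hij : i < j := by
      by_contra hc
      rcases (not_lt.1 hc).eq_or_lt with rfl | hc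
      · exact lt_irrefl _ hlt
      · exact lt_asymm hlt (List.pairwise_iff_getElem.1 hs' j i hj hi hc)
    have := List.pairwise_iff_getElem.1 h i j hi hj hij
    rwa [armLength_eq, armLength_eq] at this
  · intro h
    refine hs'.imp_of_mem fun {p p'} hp hp' hlt => ?_
    rw [Finset.mem_sort] at hp hp'
    rw [armLength_eq, armLength_eq]
    rcases Prod.Lex.lt_iff.1 hlt with h1 | ⟨h1, -⟩
    · exact h _ _ h1 (mu_pos_of_movement he hp) (mu_pos_of_movement he hp')
    · rw [h1]

theorem isIncreasing_zero_iff {e : ℕ} (he : 0 < e) (lam : YoungDiagram) :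
    IsIncreasing e 0 lam ↔ Inc e (beta lam) := by
  rw [← zTuple_pairwise_iff he, ← List.isChain_iff_pairwise]
  unfold IsIncreasing
  simp only [sub_nonneg]

/-- There is a gap before a start, and by regularity the last gap up to `q` lies within distance
less than `e`. -/
theorem Reg.one_le_arm {e : ℕ} {X : Set ℤ} (he : 0 < e) (hX : IsMaya X) (h : Reg e X) {q : ℤ}
    (hq : 0 < mu e X q) : 1 ≤ arm e X q := by
  have he' : (0 : ℤ) < e := by exact_mod_cast he
  obtain ⟨u, hu, hu'⟩ := (gp_pos_iff (hX.rn he q) 0).1 (mult_pos_iff.1 hq).1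
  obtain ⟨g, ⟨hg1, hg2⟩, hlast⟩ := exists_last (P := fun g => g ∉ X ∧ g ≤ q) q (fun z hz => hz.2)
    ⟨q + e * u, hu', by nlinarith⟩
  have hgq : q - e < g := by
    by_contra hc
    obtain ⟨k, hk1, hk2, hk3⟩ := h g hg1
    have := hlast (g + k) ⟨hk3, by omega⟩
    omega
  unfold arm
  have := Finset.single_le_sum (f := fun j : ℕ => 1 - ind X (q - e + 1 + j))
    (s := Finset.range e) (fun j _ => by
      rcases ind_cases X (q - e + 1 + j) with ⟨_, h⟩ | ⟨_, h⟩ <;> omega)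
    (a := (g - (q - e + 1)).toNat) (Finset.mem_range.2 (by omega))
  beta_reduce at this
  rwa [show q - e + 1 + ((g - (q - e + 1)).toNat : ℤ) = g by omega, ind_notMem hg1, sub_zero] at this

theorem arm_le_of_mem {e : ℕ} (he : 0 < e) {X : Set ℤ} {q : ℤ} (h : q ∈ X) :
    arm e X q ≤ e - 1 := by
  obtain ⟨k, rfl⟩ : ∃ k, e = k + 1 := ⟨e - 1, by omega⟩
  unfold arm
  rw [Finset.sum_range_succ, show q - (k + 1 : ℕ) + 1 + (k : ℤ) = q by push_cast; ring, ind_mem h]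
  have : ∑ j ∈ Finset.range k, (1 - ind X (q - (k + 1 : ℕ) + 1 + j)) ≤
      ∑ _j ∈ Finset.range k, (1 : ℤ) := Finset.sum_le_sum fun j _ => by
    rcases ind_cases X (q - (k + 1 : ℕ) + 1 + j) with ⟨_, h⟩ | ⟨_, h⟩ <;> omega
  simp only [Finset.sum_const, Finset.card_range, nsmul_eq_mul, mul_one] at this
  push_cast at this ⊢
  omega

/-- A start is followed by a bead on its runner, or is one; a bead that starts a movement has at
least one non-gap in its window, and monotonicity carries the bound back to `q`. -/
theorem Inc.arm_le {e : ℕ} (he : 0 < e) {X : Set ℤ} (hX : IsMaya X) (h : Inc e X) {q : ℤ}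
    (hq : 0 < mu e X q) : arm e X q ≤ e - 1 := by
  have hA := hX.rn he q
  obtain ⟨h1, h2⟩ := mult_pos_iff.1 hq
  obtain ⟨u, hu, hu'⟩ := (bd_pos_iff hA 0).1 h2
  rcases hu.eq_or_lt with rfl | hu
  · rw [mem_rn, mul_zero, add_zero] at hu'
    exact arm_le_of_mem he hu'
  · have h3 := gp_mono hA hu.le
    have h4 := h q (q + e * u) (by nlinarith [(by exact_mod_cast he : (0 : ℤ) < e)]) hq (by
      rw [mu_level]; exact mult_pos_iff.2 ⟨by omega, bd_pos_of_mem hA hu' le_rfl⟩)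
    exact h4.trans (arm_le_of_mem he hu')

/-- The effect of the Mullineux map on the arm lengths of an increasing abacus. -/
theorem MK.mirror {e n : ℕ} (he : 2 ≤ e) {X Y : Set ℤ} (h : MK e n X Y) (hR : Reg e X)
    (hI : Inc e X) : Inc e Y ∧ ∀ v, cnt e Y v = cnt e X (e - v) := by
  have hX := h.isMaya.1
  have hc : ∀ v, cnt e X v ≠ 0 → 1 ≤ v ∧ v ≤ e - 1 := by
    intro v hv
    rw [Ne, cnt_eq_zero_iff (by omega) hX] at hv
    push Not at hv
    obtain ⟨q, hq, rfl⟩ := hv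
    exact ⟨hR.one_le_arm (by omega) hX hq, hI.arm_le (by omega) hX hq⟩
  rcases he.eq_or_lt with rfl | he3
  -- For `e = 2` the bounds leave only arm length 1, which `v ↦ 2 - v` fixes.
  · obtain rfl := h.eq_of_two
    refine ⟨hI, fun v => ?_⟩
    by_cases h1 : v = 1
    · subst h1; norm_num
    · have h2 : cnt 2 X v = 0 := by
        by_contra hv; have := hc v hv; push_cast at this; omega
      have h3 : cnt 2 X ((2 : ℕ) - v) = 0 := by
        by_contra hv; have := hc _ hv; push_cast at this; omega
      rw [h2, h3]
  · have hsum := (Int.toNat_of_nonneg (Finset.sum_nonneg (s := Finset.range (e + 1))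
      (f := fun v : ℕ => cnt e X v) fun v _ => cnt_nonneg (by omega) hX v)).symm
    exact mirror_of_balanced he3 _ (h.balanced he) (cnt_nonneg (by omega) hX) hc hsum n X Y h
      (fun _ => rfl) hI fun _ => rfl

/-- Both lists are sorted, since reversing compensates for `z ↦ e - z`, and sorted lists with equal
multiplicities coincide. -/
theorem zTuple_eq_of_mirror {e : ℕ} (he : 0 < e) {lam mu : YoungDiagram} (h1 : Inc e (beta lam))
    (h2 : Inc e (beta mu)) (h : ∀ v, cnt e (beta mu) v = cnt e (beta lam) (e - v)) :
    zTuple e mu = ((zTuple e lam).map fun z => (e : ℤ) - z).reverse := by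
  refine List.Perm.eq_of_pairwise (le := (· ≤ ·)) (fun a b _ _ => le_antisymm)
    ((zTuple_pairwise_iff he mu).2 h2) ?_ (List.perm_iff_count.2 fun v => ?_)
  · rw [List.pairwise_reverse, List.pairwise_map]
    exact ((zTuple_pairwise_iff he lam).2 h1).imp fun h => by omega
  · have h3 := List.count_map_of_injective (zTuple e lam) (fun z => (e : ℤ) - z)
      (fun a b hab => by simpa using hab) (e - v)
    rw [sub_sub_cancel] at h3
    rw [List.count_reverse, h3]
    have h4 := count_zTuple he mu v
    have h5 := count_zTuple he lam (e - v)
    rw [h, ← h5] at h4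
    exact_mod_cast h4

end Abacus

theorem proposition9p2 (e : ℕ) (he : 2 ≤ e) (lam : YoungDiagram)
    (hreg : Abacus.IsRegular e lam) (hinc : Abacus.IsIncreasing e 0 lam) :
    (∃! mu : YoungDiagram, Abacus.MullineuxKleshchev e lam mu) ∧
      ∀ mu : YoungDiagram, Abacus.MullineuxKleshchev e lam mu →
        Abacus.zTuple e mu = ((Abacus.zTuple e lam).map fun z => (e : ℤ) - z).reverse := by
  have hR := hreg.reg he
  have hI := (Abacus.isIncreasing_zero_iff (by omega) lam).1 hinc
  constructor
  · obtain ⟨n, Y, h⟩ := hR.exists_MK he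
    obtain ⟨mu, rfl, hmu⟩ := h.toMullineuxKleshchev he
    refine ⟨mu, hmu, fun nu hnu => ?_⟩
    obtain ⟨m, h'⟩ := hnu.toMK he
    exact Abacus.beta_injective (h'.unique he h)
  · intro mu hmu
    obtain ⟨n, h⟩ := hmu.toMK he
    obtain ⟨h1, h2⟩ := h.mirror he hR hI
    exact Abacus.zTuple_eq_of_mirror (by omega) hI h1 h2
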